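/- Let $K$ be an algebraically closed field (of arbitrary characteristic). Two $K$-algebras $A$ and $B$ are called stably equivalent of Morita type if there are a finitely generated $A$-$B$-bimodule $M$ and a finitely generated $B$-$A$-bimodule $N$ (with $K$ acting centrally, finitely generated over $K$), each projective as a left module and as a right module, such that $M\otimes_B N\simeq A\oplus P$ as $A$-$A$-bimodules for a projective $A$-$A$-bimodule $P$ and $N\otimes_A M\simeq B\oplus Q$ as $B$-$B$-bimodules for a projective $B$-$B$-bimodule $Q$. Let $3\mathcal K$ be the quiver with vertices $0,1,2$ and arrows $\beta:0\to1$, $\gamma:1\to0$, $\delta:1\to2$, $\eta:2\to1$, $\lambda:2\to0$, $\kappa:0\to2$, and let $3\mathcal A$ be the quiver with the same vertices and only the arrows $\beta,\gamma,\delta,\eta$. Paths are composed from left to right. For integers $a\ge b\ge c\ge1$ with $b\ge2$ and $(a,b,c)\ne(2,2,1)$ let $Q(3\mathcal K)^{a,b,c}$ be the path algebra of $3\mathcal K$ over $K$ modulo the relations $$\beta\delta=(\kappa\lambda)^{a-1}\kappa,\quad \eta\gamma=(\lambda\kappa)^{a-1}\lambda,\quad \delta\lambda=(\gamma\beta)^{b-1}\gamma,\quad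 \kappa\eta=(\beta\gamma)^{b-1}\beta,$$ $$\lambda\beta=(\eta\delta)^{c-1}\eta,\quad \gamma\kappa=(\delta\eta)^{c-1}\delta,\quad \gamma\beta\delta=0,\quad \delta\eta\gamma=0,\quad \lambda\kappa\eta=0.$$ Fix $d\in K\setminus\{0,1\}$ and, by convention, let $Q(3\mathcal K)^{2,2,1}:=Q(3\mathcal A)_1^{2,2}(d)$ be the path algebra of $3\mathcal A$ over $K$ modulo the relations $$\beta\delta\eta=\beta\gamma\beta,\quad \delta\eta\gamma=\gamma\beta\gamma,\quad \eta\gamma\beta=d\,\eta\delta\eta,\quad \gamma\beta\delta=d\,\delta\eta\delta,\quad \beta\delta\eta\delta=0,\quad \eta\gamma\beta\gamma=0.$$ Let $a\ge b\ge c\ge1$ with $b\ge2$ and $a'\ge b'\ge c'\ge1$ with $b'\ge2$ be integers. Then $Q(3\mathcal K)^{a,b,c}$ and $Q(3\mathcal K)^{a',b',c'}$ are stably equivalent of Morita type if and only if $a=a'$, $b=b'$ and $c=c'$. -/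

import Mathlib

open scoped TensorProduct

universe u

/-! ## Bimodules over algebras, and their tensor product -/

/-- An `A`-`B`-bimodule over the commutative ring `K`: a left `A`-module which is a right
`B`-module, the two actions commuting with one another and inducing the same action of `K`. -/
structure AlgBimodule (K A B : Type u) [CommRing K] [Ring A] [Ring B] [Algebra K A]
    [Algebra K B] where
  /-- the underlying type -/
  carrier : Type u
  [addCommGroup : AddCommGroup carrier]
  [baseModule : Module K carrier]
  [leftModule : Module A carrier]
  [rightModule : Module Bᵐᵒᵖ carrier]
  [leftTower : IsScalarTower K A carrier]
  [rightTower : IsScalarTower K Bᵐᵒᵖ carrier]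
  [actionsCommute : SMulCommClass A Bᵐᵒᵖ carrier]

namespace AlgBimodule

attribute [instance] addCommGroup baseModule leftModule rightModule leftTower rightTower
  actionsCommute

section Basic

variable {K A B C : Type u} [CommRing K] [Ring A] [Ring B] [Ring C] [Algebra K A]
  [Algebra K B] [Algebra K C]

/-- An `A`-`B`-bimodule is a module over `A ⊗ Bᵐᵒᵖ`, by `(a ⊗ op b) • x = a • (op b • x)`. -/
instance envModule (X : AlgBimodule K A B) : Module (A ⊗[K] Bᵐᵒᵖ) X.carrier :=
  TensorProduct.Algebra.module

/-- The bimodule is projective as a left module. -/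
def LeftProjective (X : AlgBimodule K A B) : Prop := Module.Projective A X.carrier

/-- The bimodule is projective as a right module. -/
def RightProjective (X : AlgBimodule K A B) : Prop := Module.Projective Bᵐᵒᵖ X.carrier

/-- The bimodule is projective as a bimodule. -/
def BiProjective (X : AlgBimodule K A B) : Prop :=
  Module.Projective (A ⊗[K] Bᵐᵒᵖ) X.carrier

/-- The bimodule is finitely generated over the base. -/
def Finite (X : AlgBimodule K A B) : Prop := Module.Finite K X.carrier

/-- Isomorphism of bimodules. -/
def Isomorphic (X Y : AlgBimodule K A B) : Prop :=
  Nonempty (X.carrier ≃ₗ[A ⊗[K] Bᵐᵒᵖ] Y.carrier)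

variable (K A) in
/-- The algebra `A` as a bimodule over itself. -/
def regular : AlgBimodule K A A where
  carrier := A

/-- The direct sum of two bimodules. -/
def directSum (X Y : AlgBimodule K A B) : AlgBimodule K A B where
  carrier := X.carrier × Y.carrier

/-- The relations `x b ⊗ y = x ⊗ b y` which turn the tensor product over `K` into the tensor
product over `B`. -/
def balancing (X : AlgBimodule K A B) (Y : AlgBimodule K B C) :
    Submodule K (X.carrier ⊗[K] Y.carrier) :=
  Submodule.span K {t | ∃ (x : X.carrier) (b : B) (y : Y.carrier),
    t = (MulOpposite.op b • x) ⊗ₜ[K] y - x ⊗ₜ[K] (b • y)}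

/-- The space underlying the tensor product `X ⊗_B Y`. -/
abbrev TensorSpace (X : AlgBimodule K A B) (Y : AlgBimodule K B C) : Type u :=
  (X.carrier ⊗[K] Y.carrier) ⧸ balancing X Y

theorem balancing_le_left (X : AlgBimodule K A B) (Y : AlgBimodule K B C) (a : A) :
    balancing X Y ≤ (balancing X Y).comap
      ((Algebra.lsmul K K X.carrier a).rTensor Y.carrier) := by
  refine Submodule.span_le.2 ?_
  rintro _ ⟨x, b, y, rfl⟩
  refine Submodule.subset_span ⟨a • x, b, y, ?_⟩
  simp [smul_comm a (MulOpposite.op b) x]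

theorem balancing_le_right (X : AlgBimodule K A B) (Y : AlgBimodule K B C) (c : Cᵐᵒᵖ) :
    balancing X Y ≤ (balancing X Y).comap
      ((Algebra.lsmul K K Y.carrier c).lTensor X.carrier) := by
  refine Submodule.span_le.2 ?_
  rintro _ ⟨x, b, y, rfl⟩
  refine Submodule.subset_span ⟨x, b, c • y, ?_⟩
  simp [smul_comm b c y]

/-- The left action `a (x ⊗ y) = (a x) ⊗ y` on `X ⊗_B Y`. -/
def tensorLeft (X : AlgBimodule K A B) (Y : AlgBimodule K B C) :
    A →ₐ[K] Module.End K (TensorSpace X Y) :=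
  AlgHom.ofLinearMap
    { toFun := fun a => (balancing X Y).mapQ (balancing X Y)
        ((Algebra.lsmul K K X.carrier a).rTensor Y.carrier) (balancing_le_left X Y a)
      map_add' := fun a a' => by
        ext x y
        simp
      map_smul' := fun k a => by
        ext x y
        simp [← TensorProduct.smul_tmul'] }
    (by
      ext x y
      simp)
    (fun a a' => by
      ext x y
      simp)

/-- The right action `(x ⊗ y) c = x ⊗ (y c)` on `X ⊗_B Y`. -/
def tensorRight (X : AlgBimodule K A B) (Y : AlgBimodule K B C) :
    Cᵐᵒᵖ →ₐ[K] Module.End K (TensorSpace X Y) :=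
  AlgHom.ofLinearMap
    { toFun := fun c => (balancing X Y).mapQ (balancing X Y)
        ((Algebra.lsmul K K Y.carrier c).lTensor X.carrier) (balancing_le_right X Y c)
      map_add' := fun c c' => by
        ext x y
        simp
      map_smul' := fun k c => by
        ext x y
        simp }
    (by
      ext x y
      simp)
    (fun c c' => by
      ext x y
      simp)

theorem tensorLeft_comm_tensorRight (X : AlgBimodule K A B) (Y : AlgBimodule K B C) (a : A)
    (c : Cᵐᵒᵖ) (t : TensorSpace X Y) :
    tensorLeft X Y a (tensorRight X Y c t) = tensorRight X Y c (tensorLeft X Y a t) := by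
  have h : tensorLeft X Y a ∘ₗ tensorRight X Y c = tensorRight X Y c ∘ₗ tensorLeft X Y a := by
    ext x y
    simp [tensorLeft, tensorRight]
  exact LinearMap.congr_fun h t

/-- The tensor product `X ⊗_B Y` of an `A`-`B`-bimodule and a `B`-`C`-bimodule. -/
def tensor (X : AlgBimodule K A B) (Y : AlgBimodule K B C) : AlgBimodule K A C :=
  letI leftM : Module A (TensorSpace X Y) :=
    Module.compHom _ (tensorLeft X Y : A →+* Module.End K (TensorSpace X Y))
  letI rightM : Module Cᵐᵒᵖ (TensorSpace X Y) :=
    Module.compHom _ (tensorRight X Y : Cᵐᵒᵖ →+* Module.End K (TensorSpace X Y))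
  { carrier := TensorSpace X Y
    leftModule := leftM
    rightModule := rightM
    leftTower := ⟨fun k a t =>
      LinearMap.congr_fun (map_smul (tensorLeft X Y) k a) t⟩
    rightTower := ⟨fun k c t =>
      LinearMap.congr_fun (map_smul (tensorRight X Y) k c) t⟩
    actionsCommute := ⟨fun a c t => tensorLeft_comm_tensorRight X Y a c t⟩ }

end Basic

end AlgBimodule

/-- `A` and `B` are stably equivalent of Morita type: there are finitely generated bimodules
`M` and `N`, projective on either side, with `M ⊗_B N ≅ A ⊕ P` and `N ⊗_A M ≅ B ⊕ Q` as
bimodules, where `P` and `Q` are projective bimodules. -/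
def StablyEquivalentOfMoritaType (K A B : Type u) [CommRing K] [Ring A] [Ring B]
    [Algebra K A] [Algebra K B] : Prop :=
  ∃ (M : AlgBimodule K A B) (N : AlgBimodule K B A)
    (P : AlgBimodule K A A) (Q : AlgBimodule K B B),
    M.Finite ∧ N.Finite ∧
    M.LeftProjective ∧ M.RightProjective ∧
    N.LeftProjective ∧ N.RightProjective ∧
    P.BiProjective ∧ Q.BiProjective ∧
    (M.tensor N).Isomorphic ((AlgBimodule.regular K A).directSum P) ∧
    (N.tensor M).Isomorphic ((AlgBimodule.regular K B).directSum Q)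

/-! ## Path algebras -/

/-- A quiver with vertex set `V` and arrow set `E`. -/
structure ArrowQuiver (V E : Type) where
  /-- the start of an arrow -/
  source : E → V
  /-- the end of an arrow -/
  target : E → V

namespace ArrowQuiver

variable {V E : Type} [Fintype V]

/-- The defining relations of the path algebra, on the free algebra generated by the vertices
and the arrows: the vertices are orthogonal idempotents with sum `1`, and
`e_{source α} α = α = α e_{target α}`. Thus paths are composed from left to right. -/
inductive PathRel (K : Type u) [CommRing K] (q : ArrowQuiver V E) :
    FreeAlgebra K (V ⊕ E) → FreeAlgebra K (V ⊕ E) → Prop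
  | sum_vertices : PathRel K q (∑ i : V, FreeAlgebra.ι K (Sum.inl i)) 1
  | idempotent (i : V) : PathRel K q
      (FreeAlgebra.ι K (Sum.inl i) * FreeAlgebra.ι K (Sum.inl i)) (FreeAlgebra.ι K (Sum.inl i))
  | orthogonal (i j : V) (h : i ≠ j) : PathRel K q
      (FreeAlgebra.ι K (Sum.inl i) * FreeAlgebra.ι K (Sum.inl j)) 0
  | source_mul (x : E) : PathRel K q
      (FreeAlgebra.ι K (Sum.inl (q.source x)) * FreeAlgebra.ι K (Sum.inr x))
      (FreeAlgebra.ι K (Sum.inr x))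
  | mul_target (x : E) : PathRel K q
      (FreeAlgebra.ι K (Sum.inr x) * FreeAlgebra.ι K (Sum.inl (q.target x)))
      (FreeAlgebra.ι K (Sum.inr x))

/-- The path algebra of a quiver with finitely many vertices. -/
abbrev PathAlgebra (K : Type u) [CommRing K] (q : ArrowQuiver V E) : Type u :=
  RingQuot (PathRel K q)

/-- An arrow, as an element of the path algebra. -/
def arrow (K : Type u) [CommRing K] (q : ArrowQuiver V E) (x : E) : PathAlgebra K q :=
  RingQuot.mkAlgHom K (PathRel K q) (FreeAlgebra.ι K (Sum.inr x))

end ArrowQuiver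

/-! ## The quaternion algebras with three simple modules -/

/-- The arrows of the quiver of type `3K`. -/
inductive Arrow3K : Type
  | beta | gamma | delta | eta | lambda | kappa

/-- The quiver of type `3K`: a triangle with a pair of opposite arrows along each edge,
`β : 0 → 1`, `γ : 1 → 0`, `δ : 1 → 2`, `η : 2 → 1`, `λ : 2 → 0`, `κ : 0 → 2`. -/
def quiver3K : ArrowQuiver (Fin 3) Arrow3K where
  source
    | .beta => 0 | .gamma => 1 | .delta => 1 | .eta => 2 | .lambda => 2 | .kappa => 0
  target
    | .beta => 1 | .gamma => 0 | .delta => 2 | .eta => 1 | .lambda => 0 | .kappa => 2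

/-- The arrows of the quiver of type `3A`. -/
inductive Arrow3A : Type
  | beta | gamma | delta | eta

/-- The quiver of type `3A`: a line with a pair of opposite arrows along each edge,
`β : 0 → 1`, `γ : 1 → 0`, `δ : 1 → 2`, `η : 2 → 1`. -/
def quiver3A : ArrowQuiver (Fin 3) Arrow3A where
  source
    | .beta => 0 | .gamma => 1 | .delta => 1 | .eta => 2
  target
    | .beta => 1 | .gamma => 0 | .delta => 2 | .eta => 1

section Relations

open ArrowQuiver

/-- The relations of `Q(3K)^{a,b,c}`. -/
inductive Q3KRel (K : Type u) [CommRing K] (a b c : ℕ) :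
    PathAlgebra K quiver3K → PathAlgebra K quiver3K → Prop
  | beta_delta : Q3KRel K a b c
      (arrow K quiver3K .beta * arrow K quiver3K .delta)
      ((arrow K quiver3K .kappa * arrow K quiver3K .lambda) ^ (a - 1) *
        arrow K quiver3K .kappa)
  | eta_gamma : Q3KRel K a b c
      (arrow K quiver3K .eta * arrow K quiver3K .gamma)
      ((arrow K quiver3K .lambda * arrow K quiver3K .kappa) ^ (a - 1) *
        arrow K quiver3K .lambda)
  | delta_lambda : Q3KRel K a b c
      (arrow K quiver3K .delta * arrow K quiver3K .lambda)
      ((arrow K quiver3K .gamma * arrow K quiver3K .beta) ^ (b - 1) *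
        arrow K quiver3K .gamma)
  | kappa_eta : Q3KRel K a b c
      (arrow K quiver3K .kappa * arrow K quiver3K .eta)
      ((arrow K quiver3K .beta * arrow K quiver3K .gamma) ^ (b - 1) *
        arrow K quiver3K .beta)
  | lambda_beta : Q3KRel K a b c
      (arrow K quiver3K .lambda * arrow K quiver3K .beta)
      ((arrow K quiver3K .eta * arrow K quiver3K .delta) ^ (c - 1) *
        arrow K quiver3K .eta)
  | gamma_kappa : Q3KRel K a b c
      (arrow K quiver3K .gamma * arrow K quiver3K .kappa)
      ((arrow K quiver3K .delta * arrow K quiver3K .eta) ^ (c - 1) *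
        arrow K quiver3K .delta)
  | gamma_beta_delta : Q3KRel K a b c
      (arrow K quiver3K .gamma * arrow K quiver3K .beta * arrow K quiver3K .delta) 0
  | delta_eta_gamma : Q3KRel K a b c
      (arrow K quiver3K .delta * arrow K quiver3K .eta * arrow K quiver3K .gamma) 0
  | lambda_kappa_eta : Q3KRel K a b c
      (arrow K quiver3K .lambda * arrow K quiver3K .kappa * arrow K quiver3K .eta) 0

/-- The relations of `Q(3A)_1^{2,2}(d)`. -/
inductive Q3ARel (K : Type u) [CommRing K] (d : K) :
    PathAlgebra K quiver3A → PathAlgebra K quiver3A → Prop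
  | beta_delta_eta : Q3ARel K d
      (arrow K quiver3A .beta * arrow K quiver3A .delta * arrow K quiver3A .eta)
      (arrow K quiver3A .beta * arrow K quiver3A .gamma * arrow K quiver3A .beta)
  | delta_eta_gamma : Q3ARel K d
      (arrow K quiver3A .delta * arrow K quiver3A .eta * arrow K quiver3A .gamma)
      (arrow K quiver3A .gamma * arrow K quiver3A .beta * arrow K quiver3A .gamma)
  | eta_gamma_beta : Q3ARel K d
      (arrow K quiver3A .eta * arrow K quiver3A .gamma * arrow K quiver3A .beta)
      (d • (arrow K quiver3A .eta * arrow K quiver3A .delta * arrow K quiver3A .eta))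
  | gamma_beta_delta : Q3ARel K d
      (arrow K quiver3A .gamma * arrow K quiver3A .beta * arrow K quiver3A .delta)
      (d • (arrow K quiver3A .delta * arrow K quiver3A .eta * arrow K quiver3A .delta))
  | beta_delta_eta_delta : Q3ARel K d
      (arrow K quiver3A .beta * arrow K quiver3A .delta * arrow K quiver3A .eta *
        arrow K quiver3A .delta) 0
  | eta_gamma_beta_gamma : Q3ARel K d
      (arrow K quiver3A .eta * arrow K quiver3A .gamma * arrow K quiver3A .beta *
        arrow K quiver3A .gamma) 0

end Relations

/-- The algebra given by the quiver of type `3K` and the relations of `Q(3K)^{a,b,c}`. -/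
abbrev Q3KPresented (K : Type u) [CommRing K] (a b c : ℕ) : Type u := RingQuot (Q3KRel K a b c)

/-- The algebra `Q(3A)_1^{2,2}(d)`. -/
abbrev Q3A (K : Type u) [CommRing K] (d : K) : Type u := RingQuot (Q3ARel K d)

/-- The algebra `Q(3K)^{a,b,c}`, with the convention `Q(3K)^{2,2,1} = Q(3A)_1^{2,2}(d)`. -/
noncomputable def Q3K (K : Type u) [CommRing K] (d : K) (a b c : ℕ) : AlgCat.{u} K :=
  if (a, b, c) = (2, 2, 1) then AlgCat.of K (Q3A K d) else AlgCat.of K (Q3KPresented K a b c)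

/-! The invariant is a quotient of the centre. A bimodule map is called decomposable if it is a sum
of maps that factor through `X ⊗_K Y`, with `X` a left module and `Y` a right module, both finite
over `K`. Decomposable maps absorb composition, survive tensoring with a finite bimodule on either
side, and include the identity of a finite projective bimodule. Modulo decomposable maps, a stable
equivalence of Morita type therefore looks like a Morita equivalence. Letting `z ∈ Z(A)` act in the
middle of `N ⊗_A M` and compressing to the summand `B` gives a map `Z(A) → Z(B)` which is
multiplicative modulo decomposable elements (`transfer_mul`) and which detects decomposability
exactly (`transfer_mem_iff`). Hence `StableCenter K A` embeds into `StableCenter K B` and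
conversely, and the powers of their nilradicals have the same dimensions.

For a split symmetric algebra with form `φ`, a central `z` is decomposable iff `φ (z * a) = 0` for
every `a` killed by all simple characters, so the ideal is the Reynolds ideal `Z(A) ∩ soc A`. One
direction is a trace computation (`Decomposable.apply_mul_eq_zero`), the other factors
multiplication by a central socle element through one-dimensional modules
(`mem_decomposableIdeal_of_character`).

For `Q(3K)^{a,b,c}` the quotient is the wedge of `K[x]/x^a`, `K[y]/y^b`, `K[z]/z^c`, whose
generators come from the two-cycles `κλ`, `βγ`, `δη`. For `n ≥ 1` the `n`-th power of its nilradical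
has dimension `max(a-n,0) + max(b-n,0) + max(c-n,0)`, and these numbers determine `a ≥ b ≥ c`. The
algebra `Q(3A)_1^{2,2}(d)` obeys the same formula with `(2,2,1)`.

What remains is to control algebras given by generators and relations. The relations yield explicit
spanning sets of the Peirce components. For the lower bound each algebra is represented by matrices
over a commutative monoid algebra modulo the largest ideal in the kernel of a linear form; every
arrow becomes a monomial times a matrix unit. The linear form composed with the trace is a symmetric
form, and its pairing of the listed paths with complementary paths is triangular. So the nonzero
listed paths are bases, the form is nondegenerate and the representation is faithful
(`PeirceSpanning`). Triangularity for `3K` would fail exactly at `(2,2,1)`, where `βγ` and `κλ`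
become indistinguishable; for `3A` a Gram determinant `d(1-d)` has to be nonzero.

The converse implication is reflexivity, by means of the regular bimodule. -/

/-! ## Homomorphisms of bimodules -/

namespace AlgBimodule

variable {K A B C D : Type u} [CommRing K] [Ring A] [Ring B] [Ring C] [Ring D] [Algebra K A]
  [Algebra K B] [Algebra K C] [Algebra K D]

/-- Homomorphisms of bimodules. -/
abbrev Hom (X Y : AlgBimodule K A B) : Type u := X.carrier →ₗ[A ⊗[K] Bᵐᵒᵖ] Y.carrier

theorem env_smul (X : AlgBimodule K A B) (a : A) (b : Bᵐᵒᵖ) (x : X.carrier) :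
    (a ⊗ₜ[K] b) • x = a • b • x := TensorProduct.Algebra.smul_def a b x

theorem Hom.map_left {X Y : AlgBimodule K A B} (f : Hom X Y) (a : A) (x : X.carrier) :
    f (a • x) = a • f x := by
  have h := map_smul f (a ⊗ₜ[K] (1 : Bᵐᵒᵖ)) x
  simpa [env_smul] using h

theorem Hom.map_right {X Y : AlgBimodule K A B} (f : Hom X Y) (b : Bᵐᵒᵖ) (x : X.carrier) :
    f (b • x) = b • f x := by
  have h := map_smul f ((1 : A) ⊗ₜ[K] b) x
  simpa [env_smul] using h

theorem Hom.map_base {X Y : AlgBimodule K A B} (f : Hom X Y) (k : K) (x : X.carrier) :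
    f (k • x) = k • f x := by
  rw [← algebraMap_smul A k x, Hom.map_left, algebraMap_smul]

/-- A homomorphism of bimodules as a linear map over the base. -/
def Hom.base {X Y : AlgBimodule K A B} (f : Hom X Y) : X.carrier →ₗ[K] Y.carrier where
  toFun := f
  map_add' := map_add f
  map_smul' := f.map_base

@[simp] theorem Hom.base_apply {X Y : AlgBimodule K A B} (f : Hom X Y) (x : X.carrier) :
    f.base x = f x := rfl

/-- A linear map over the base which commutes with both actions, as a homomorphism. -/
def mkHom {X Y : AlgBimodule K A B} (f : X.carrier →ₗ[K] Y.carrier)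
    (hl : ∀ (a : A) x, f (a • x) = a • f x) (hr : ∀ (b : Bᵐᵒᵖ) x, f (b • x) = b • f x) :
    Hom X Y where
  toFun := f
  map_add' := map_add f
  map_smul' := fun e x => by
    induction e using TensorProduct.induction_on with
    | zero =>
      rw [← TensorProduct.zero_tmul A (0 : Bᵐᵒᵖ), RingHom.id_apply, env_smul, env_smul]
      simp
    | tmul a b => simp [env_smul, hl, hr]
    | add e e' h h' => simp only [RingHom.id_apply] at *; rw [add_smul, map_add, h, h', add_smul]

/-! ## The tensor product of bimodules -/

/-- The canonical bilinear map to the tensor product of bimodules. -/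
def tmul (X : AlgBimodule K A B) (Y : AlgBimodule K B C) :
    X.carrier →ₗ[K] Y.carrier →ₗ[K] (X.tensor Y).carrier :=
  (TensorProduct.mk K X.carrier Y.carrier).compr₂ (balancing X Y).mkQ

theorem smul_tmul_left (X : AlgBimodule K A B) (Y : AlgBimodule K B C) (a : A) (x : X.carrier)
    (y : Y.carrier) : a • tmul X Y x y = tmul X Y (a • x) y := rfl

theorem smul_tmul_right (X : AlgBimodule K A B) (Y : AlgBimodule K B C) (c : Cᵐᵒᵖ)
    (x : X.carrier) (y : Y.carrier) : c • tmul X Y x y = tmul X Y x (c • y) := rfl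

theorem tmul_balanced (X : AlgBimodule K A B) (Y : AlgBimodule K B C) (b : B) (x : X.carrier)
    (y : Y.carrier) : tmul X Y (MulOpposite.op b • x) y = tmul X Y x (b • y) :=
  (Submodule.Quotient.eq _).2 (Submodule.subset_span ⟨x, b, y, rfl⟩)

theorem tensor_induction {X : AlgBimodule K A B} {Y : AlgBimodule K B C}
    {p : (X.tensor Y).carrier → Prop} (h0 : p 0) (ht : ∀ x y, p (tmul X Y x y))
    (ha : ∀ s t, p s → p t → p (s + t)) (t : (X.tensor Y).carrier) : p t := by
  obtain ⟨t, rfl⟩ := Submodule.mkQ_surjective (balancing X Y) t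
  induction t using TensorProduct.induction_on with
  | zero => rw [map_zero]; exact h0
  | tmul x y => exact ht x y
  | add s t hs ht => rw [map_add]; exact ha _ _ hs ht

/-- The universal property of the tensor product of bimodules. -/
def tensorLift {X : AlgBimodule K A B} {Y : AlgBimodule K B C} {V : Type u} [AddCommGroup V]
    [Module K V] (f : X.carrier →ₗ[K] Y.carrier →ₗ[K] V)
    (hf : ∀ x (b : B) y, f (MulOpposite.op b • x) y = f x (b • y)) :
    (X.tensor Y).carrier →ₗ[K] V :=
  (balancing X Y).liftQ (TensorProduct.lift f) (show balancing X Y ≤ _ from by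
    refine Submodule.span_le.2 ?_
    rintro _ ⟨x, b, y, rfl⟩
    simp [hf])

@[simp] theorem tensorLift_tmul {X : AlgBimodule K A B} {Y : AlgBimodule K B C} {V : Type u}
    [AddCommGroup V] [Module K V] (f : X.carrier →ₗ[K] Y.carrier →ₗ[K] V)
    (hf : ∀ x (b : B) y, f (MulOpposite.op b • x) y = f x (b • y)) (x : X.carrier)
    (y : Y.carrier) : tensorLift f hf (tmul X Y x y) = f x y := by
  exact (Submodule.liftQ_apply _ _ _).trans (TensorProduct.lift.tmul x y)

/-- A balanced bilinear map commuting with the outer actions, as a homomorphism of bimodules. -/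
def tensorLiftHom {X : AlgBimodule K A B} {Y : AlgBimodule K B C} {Z : AlgBimodule K A C}
    (f : X.carrier →ₗ[K] Y.carrier →ₗ[K] Z.carrier)
    (hf : ∀ x (b : B) y, f (MulOpposite.op b • x) y = f x (b • y))
    (hl : ∀ (a : A) x y, f (a • x) y = a • f x y)
    (hr : ∀ (c : Cᵐᵒᵖ) x y, f x (c • y) = c • f x y) : Hom (X.tensor Y) Z :=
  mkHom (tensorLift f hf)
    (fun a t => by
      induction t using tensor_induction with
      | h0 => simp
      | ht x y => rw [smul_tmul_left, tensorLift_tmul, tensorLift_tmul, hl]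
      | ha s t hs ht => rw [smul_add, map_add, hs, ht, map_add, smul_add])
    (fun c t => by
      induction t using tensor_induction with
      | h0 => simp
      | ht x y => rw [smul_tmul_right, tensorLift_tmul, tensorLift_tmul, hr]
      | ha s t hs ht => rw [smul_add, map_add, hs, ht, map_add, smul_add])

@[simp] theorem tensorLiftHom_tmul {X : AlgBimodule K A B} {Y : AlgBimodule K B C}
    {Z : AlgBimodule K A C} (f : X.carrier →ₗ[K] Y.carrier →ₗ[K] Z.carrier)
    (hf : ∀ x (b : B) y, f (MulOpposite.op b • x) y = f x (b • y))
    (hl : ∀ (a : A) x y, f (a • x) y = a • f x y)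
    (hr : ∀ (c : Cᵐᵒᵖ) x y, f x (c • y) = c • f x y) (x : X.carrier) (y : Y.carrier) :
    tensorLiftHom f hf hl hr (tmul X Y x y) = f x y := tensorLift_tmul f hf x y

/-- The tensor product of two homomorphisms of bimodules. -/
def tensorMap {X X' : AlgBimodule K A B} {Y Y' : AlgBimodule K B C} (f : Hom X X')
    (g : Hom Y Y') : Hom (X.tensor Y) (X'.tensor Y') :=
  tensorLiftHom ((tmul X' Y').compl₁₂ f.base g.base)
    (fun x b y => by simp [Hom.map_left, Hom.map_right, tmul_balanced])
    (fun a x y => by simp [Hom.map_left, smul_tmul_left])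
    (fun c x y => by simp [Hom.map_right, smul_tmul_right])

@[simp] theorem tensorMap_tmul {X X' : AlgBimodule K A B} {Y Y' : AlgBimodule K B C}
    (f : Hom X X') (g : Hom Y Y') (x : X.carrier) (y : Y.carrier) :
    tensorMap f g (tmul X Y x y) = tmul X' Y' (f x) (g y) := tensorLiftHom_tmul _ _ _ _ x y

/-- The associativity of the tensor product, with a fixed element on the right. -/
def assocRight (X : AlgBimodule K A B) (Y : AlgBimodule K B C) (Z : AlgBimodule K C D)
    (z : Z.carrier) : (X.tensor Y).carrier →ₗ[K] (X.tensor (Y.tensor Z)).carrier :=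
  tensorLift ((tmul X (Y.tensor Z)).compl₂ ((tmul Y Z).flip z)) (fun x b y => by
    rw [LinearMap.compl₂_apply, LinearMap.compl₂_apply, LinearMap.flip_apply,
      LinearMap.flip_apply, tmul_balanced, smul_tmul_left])

@[simp] theorem assocRight_tmul (X : AlgBimodule K A B) (Y : AlgBimodule K B C)
    (Z : AlgBimodule K C D) (z : Z.carrier) (x : X.carrier) (y : Y.carrier) :
    assocRight X Y Z z (tmul X Y x y) = tmul X _ x (tmul Y Z y z) := tensorLift_tmul _ _ x y

/-- The associativity of the tensor product, from left to right. -/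
def assoc (X : AlgBimodule K A B) (Y : AlgBimodule K B C) (Z : AlgBimodule K C D) :
    Hom ((X.tensor Y).tensor Z) (X.tensor (Y.tensor Z)) :=
  tensorLiftHom
    (LinearMap.flip
      { toFun := assocRight X Y Z
        map_add' := fun z z' => LinearMap.ext fun t => by
          induction t using tensor_induction with
          | h0 => rw [map_zero, map_zero]
          | ht x y => rw [LinearMap.add_apply, assocRight_tmul, assocRight_tmul, assocRight_tmul,
              map_add, map_add]
          | ha s t hs ht => rw [map_add, hs, ht, ← map_add]
        map_smul' := fun k z => LinearMap.ext fun t => by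
          rw [RingHom.id_apply]
          induction t using tensor_induction with
          | h0 => rw [map_zero, map_zero]
          | ht x y => rw [LinearMap.smul_apply, assocRight_tmul, assocRight_tmul, map_smul, map_smul]
          | ha s t hs ht => rw [map_add, hs, ht, ← map_add] })
    (fun t c z => by
      change assocRight X Y Z z _ = assocRight X Y Z _ t
      induction t using tensor_induction with
      | h0 => rw [smul_zero, map_zero, map_zero]
      | ht x y => rw [smul_tmul_right, assocRight_tmul, assocRight_tmul, tmul_balanced]
      | ha s t hs ht => rw [smul_add, map_add, hs, ht, ← map_add])
    (fun a t z => by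
      change assocRight X Y Z z _ = _ • assocRight X Y Z z _
      induction t using tensor_induction with
      | h0 => rw [smul_zero, map_zero, smul_zero]
      | ht x y => rw [smul_tmul_left, assocRight_tmul, assocRight_tmul, smul_tmul_left]
      | ha s t hs ht => rw [smul_add, map_add, hs, ht, ← smul_add, ← map_add])
    (fun d t z => by
      change assocRight X Y Z _ t = _ • assocRight X Y Z z t
      induction t using tensor_induction with
      | h0 => rw [map_zero, map_zero, smul_zero]
      | ht x y => rw [assocRight_tmul, assocRight_tmul, smul_tmul_right, smul_tmul_right]
      | ha s t hs ht => rw [map_add, hs, ht, ← smul_add, ← map_add])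

@[simp] theorem assoc_tmul (X : AlgBimodule K A B) (Y : AlgBimodule K B C)
    (Z : AlgBimodule K C D) (x : X.carrier) (y : Y.carrier) (z : Z.carrier) :
    assoc X Y Z (tmul _ Z (tmul X Y x y) z) = tmul X _ x (tmul Y Z y z) :=
  (tensorLiftHom_tmul _ _ _ _ _ z).trans (assocRight_tmul X Y Z z x y)

/-- The inverse of the associativity of the tensor product, with a fixed element on the left. -/
def assocLeft (X : AlgBimodule K A B) (Y : AlgBimodule K B C) (Z : AlgBimodule K C D)
    (x : X.carrier) : (Y.tensor Z).carrier →ₗ[K] ((X.tensor Y).tensor Z).carrier :=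
  tensorLift ((tmul (X.tensor Y) Z).comp (tmul X Y x)) (fun y c z => by
    rw [LinearMap.comp_apply, LinearMap.comp_apply, ← tmul_balanced, smul_tmul_right])

@[simp] theorem assocLeft_tmul (X : AlgBimodule K A B) (Y : AlgBimodule K B C)
    (Z : AlgBimodule K C D) (x : X.carrier) (y : Y.carrier) (z : Z.carrier) :
    assocLeft X Y Z x (tmul Y Z y z) = tmul _ Z (tmul X Y x y) z := tensorLift_tmul _ _ y z

/-- The associativity of the tensor product, from right to left. -/
def assocInv (X : AlgBimodule K A B) (Y : AlgBimodule K B C) (Z : AlgBimodule K C D) :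
    Hom (X.tensor (Y.tensor Z)) ((X.tensor Y).tensor Z) :=
  tensorLiftHom
    { toFun := assocLeft X Y Z
      map_add' := fun x x' => LinearMap.ext fun t => by
        induction t using tensor_induction with
        | h0 => rw [map_zero, map_zero]
        | ht y z => rw [LinearMap.add_apply, assocLeft_tmul, assocLeft_tmul, assocLeft_tmul,
            map_add, LinearMap.add_apply, map_add, LinearMap.add_apply]
        | ha s t hs ht => rw [map_add, hs, ht, ← map_add]
      map_smul' := fun k x => LinearMap.ext fun t => by
        rw [RingHom.id_apply]
        induction t using tensor_induction with
        | h0 => rw [map_zero, map_zero]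
        | ht y z => rw [LinearMap.smul_apply, assocLeft_tmul, assocLeft_tmul, map_smul,
            LinearMap.smul_apply, map_smul, LinearMap.smul_apply]
        | ha s t hs ht => rw [map_add, hs, ht, ← map_add] }
    (fun x b t => by
      change assocLeft X Y Z _ t = assocLeft X Y Z x _
      induction t using tensor_induction with
      | h0 => rw [smul_zero, map_zero, map_zero]
      | ht y z => rw [smul_tmul_left, assocLeft_tmul, assocLeft_tmul, tmul_balanced]
      | ha s t hs ht => rw [smul_add, map_add, hs, ht, ← map_add])
    (fun a x t => by
      change assocLeft X Y Z _ t = _ • assocLeft X Y Z x t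
      induction t using tensor_induction with
      | h0 => rw [map_zero, map_zero, smul_zero]
      | ht y z => rw [assocLeft_tmul, assocLeft_tmul, smul_tmul_left, smul_tmul_left]
      | ha s t hs ht => rw [map_add, hs, ht, ← smul_add, ← map_add])
    (fun d x t => by
      change assocLeft X Y Z x _ = _ • assocLeft X Y Z x t
      induction t using tensor_induction with
      | h0 => rw [smul_zero, map_zero, smul_zero]
      | ht y z => rw [smul_tmul_right, assocLeft_tmul, assocLeft_tmul, smul_tmul_right]
      | ha s t hs ht => rw [smul_add, map_add, hs, ht, ← smul_add, ← map_add])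

@[simp] theorem assocInv_tmul (X : AlgBimodule K A B) (Y : AlgBimodule K B C)
    (Z : AlgBimodule K C D) (x : X.carrier) (y : Y.carrier) (z : Z.carrier) :
    assocInv X Y Z (tmul X _ x (tmul Y Z y z)) = tmul _ Z (tmul X Y x y) z :=
  (tensorLiftHom_tmul _ _ _ _ x _).trans (assocLeft_tmul X Y Z x y z)

theorem assoc_assocInv (X : AlgBimodule K A B) (Y : AlgBimodule K B C) (Z : AlgBimodule K C D)
    (t : (X.tensor (Y.tensor Z)).carrier) : assoc X Y Z (assocInv X Y Z t) = t := by
  induction t using tensor_induction with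
  | h0 => rw [map_zero, map_zero]
  | ht x s =>
    induction s using tensor_induction with
    | h0 => rw [map_zero, map_zero, map_zero]
    | ht y z => rw [assocInv_tmul, assoc_tmul]
    | ha s t hs ht => rw [map_add, map_add, map_add, hs, ht]
  | ha s t hs ht => rw [map_add, map_add, hs, ht]

theorem assocInv_assoc (X : AlgBimodule K A B) (Y : AlgBimodule K B C) (Z : AlgBimodule K C D)
    (t : ((X.tensor Y).tensor Z).carrier) : assocInv X Y Z (assoc X Y Z t) = t := by
  induction t using tensor_induction with
  | h0 => rw [map_zero, map_zero]
  | ht s z =>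
    induction s using tensor_induction with
    | h0 => rw [map_zero, LinearMap.zero_apply, map_zero, map_zero]
    | ht x y => rw [assoc_tmul, assocInv_tmul]
    | ha s t hs ht => rw [map_add, LinearMap.add_apply, map_add, map_add, hs, ht]
  | ha s t hs ht => rw [map_add, map_add, hs, ht]

/-- An element of the algebra as an element of the regular bimodule. -/
def toRegular (a : A) : (regular K A).carrier := a

theorem exists_toRegular (x : (regular K A).carrier) : ∃ a : A, x = toRegular a := ⟨x, rfl⟩

theorem smul_regular (a b : A) : a • (toRegular b : (regular K A).carrier) = toRegular (a * b) :=
  rfl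

theorem op_smul_regular (a b : A) :
    MulOpposite.op a • (toRegular b : (regular K A).carrier) = toRegular (b * a) := rfl

/-- The unit law for the tensor product. -/
def leftUnit (X : AlgBimodule K A B) : Hom ((regular K A).tensor X) X :=
  tensorLiftHom (X := regular K A) (Y := X) (Z := X) (Algebra.lsmul K K X.carrier (A := A)).toLinearMap
    (fun a b x => mul_smul (α := A) a b x)
    (fun a b x => mul_smul (α := A) a b x)
    (fun b a x => smul_comm (M := A) (N := Bᵐᵒᵖ) a b x)

@[simp] theorem leftUnit_tmul (X : AlgBimodule K A B) (a : A) (x : X.carrier) :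
    leftUnit X (tmul (regular K A) X (toRegular a) x) = a • x := tensorLiftHom_tmul _ _ _ _ _ x

/-- The inverse of the unit law for the tensor product. -/
def leftUnitInv (X : AlgBimodule K A B) : Hom X ((regular K A).tensor X) :=
  mkHom (tmul (regular K A) X (toRegular 1))
    (fun a x => by
      rw [← tmul_balanced, smul_tmul_left, op_smul_regular, smul_regular, one_mul, mul_one])
    (fun b x => (smul_tmul_right _ _ _ _ _).symm)

@[simp] theorem leftUnitInv_apply (X : AlgBimodule K A B) (x : X.carrier) :
    leftUnitInv X x = tmul (regular K A) X (toRegular 1) x := rfl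

theorem leftUnit_leftUnitInv (X : AlgBimodule K A B) (x : X.carrier) :
    leftUnit X (leftUnitInv X x) = x := by
  rw [leftUnitInv_apply, leftUnit_tmul, one_smul]

theorem leftUnitInv_leftUnit (X : AlgBimodule K A B) (t : ((regular K A).tensor X).carrier) :
    leftUnitInv X (leftUnit X t) = t := by
  induction t using tensor_induction with
  | h0 => rw [map_zero, map_zero]
  | ht a x =>
    obtain ⟨a', ha⟩ := exists_toRegular a
    rw [ha]
    rw [leftUnit_tmul, Hom.map_left, leftUnitInv_apply, smul_tmul_left, smul_regular, mul_one]
  | ha s t hs ht => rw [map_add, map_add, hs, ht]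

end AlgBimodule

/-! ### Decomposable homomorphisms of bimodules -/

namespace AlgBimodule

variable {K A B C D : Type u} [CommRing K] [Ring A] [Ring B] [Ring C] [Ring D] [Algebra K A]
  [Algebra K B] [Algebra K C] [Algebra K D]

theorem Finite.tensor {X : AlgBimodule K A B} {Y : AlgBimodule K B C} (hX : X.Finite)
    (hY : Y.Finite) : (X.tensor Y).Finite := by
  have : Module.Finite K X.carrier := hX
  have : Module.Finite K Y.carrier := hY
  exact inferInstanceAs (Module.Finite K (TensorSpace X Y))

/-- The identity of a bimodule. -/
abbrev Hom.id (X : AlgBimodule K A B) : Hom X X := LinearMap.id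

theorem tensorMap_id_comp (M : AlgBimodule K A B) {X Y Z : AlgBimodule K B C} (g : Hom Y Z)
    (f : Hom X Y) : tensorMap (Hom.id M) (g ∘ₗ f) =
      tensorMap (Hom.id M) g ∘ₗ tensorMap (Hom.id M) f :=
  LinearMap.ext fun t => by
    induction t using tensor_induction with
    | h0 => rw [map_zero, map_zero]
    | ht x y => simp
    | ha s t hs ht => rw [map_add, hs, ht, ← map_add]

theorem tensorMap_comp_id (M : AlgBimodule K B C) {X Y Z : AlgBimodule K A B} (g : Hom Y Z)
    (f : Hom X Y) : tensorMap (g ∘ₗ f) (Hom.id M) =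
      tensorMap g (Hom.id M) ∘ₗ tensorMap f (Hom.id M) :=
  LinearMap.ext fun t => by
    induction t using tensor_induction with
    | h0 => rw [map_zero, map_zero]
    | ht x y => simp
    | ha s t hs ht => rw [map_add, hs, ht, ← map_add]

theorem tensorMap_add_right {X X' : AlgBimodule K A B} {Y Y' : AlgBimodule K B C} (f : Hom X X')
    (g g' : Hom Y Y') : tensorMap f (g + g') = tensorMap f g + tensorMap f g' :=
  LinearMap.ext fun t => by
    induction t using tensor_induction with
    | h0 => rw [map_zero, map_zero]
    | ht x y => rw [LinearMap.add_apply, tensorMap_tmul, tensorMap_tmul, tensorMap_tmul,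
        LinearMap.add_apply, map_add]
    | ha s t hs ht => rw [map_add, hs, ht, ← map_add]

theorem tensorMap_add_left {X X' : AlgBimodule K A B} {Y Y' : AlgBimodule K B C}
    (f f' : Hom X X') (g : Hom Y Y') : tensorMap (f + f') g = tensorMap f g + tensorMap f' g :=
  LinearMap.ext fun t => by
    induction t using tensor_induction with
    | h0 => rw [map_zero, map_zero]
    | ht x y => rw [LinearMap.add_apply, tensorMap_tmul, tensorMap_tmul, tensorMap_tmul,
        LinearMap.add_apply, map_add, LinearMap.add_apply]
    | ha s t hs ht => rw [map_add, hs, ht, ← map_add]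

theorem tensorMap_zero_right {X X' : AlgBimodule K A B} {Y Y' : AlgBimodule K B C}
    (f : Hom X X') : tensorMap f (0 : Hom Y Y') = 0 := by
  simpa using tensorMap_add_right f (0 : Hom Y Y') 0

theorem tensorMap_zero_left {X X' : AlgBimodule K A B} {Y Y' : AlgBimodule K B C}
    (g : Hom Y Y') : tensorMap (0 : Hom X X') g = 0 := by
  simpa using tensorMap_add_left (0 : Hom X X') 0 g

/-- A homomorphism of bimodules is decomposable if it is a sum of homomorphisms each of which
factors through the tensor product over the base of a left module and a right module, both
finitely generated over the base. -/
inductive Decomposable {T T' : AlgBimodule K A B} : Hom T T' → Prop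
  | zero : Decomposable 0
  | add (f g : Hom T T') : Decomposable f → Decomposable g → Decomposable (f + g)
  | factor (X : AlgBimodule K A K) (Y : AlgBimodule K K B) (hX : X.Finite) (hY : Y.Finite)
      (f : Hom T (X.tensor Y)) (g : Hom (X.tensor Y) T') : Decomposable (g ∘ₗ f)

namespace Decomposable

theorem comp_left {T T' T'' : AlgBimodule K A B} {f : Hom T T'} (hf : Decomposable f)
    (g : Hom T' T'') : Decomposable (g ∘ₗ f) := by
  induction hf with
  | zero => rw [LinearMap.comp_zero]; exact .zero
  | add f f' _ _ h h' => rw [LinearMap.comp_add]; exact .add _ _ h h'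
  | factor X Y hX hY f f' => rw [← LinearMap.comp_assoc]; exact .factor X Y hX hY _ _

theorem comp_right {T T' T'' : AlgBimodule K A B} {g : Hom T' T''} (hg : Decomposable g)
    (f : Hom T T') : Decomposable (g ∘ₗ f) := by
  induction hg with
  | zero => rw [LinearMap.zero_comp]; exact .zero
  | add g g' _ _ h h' => rw [LinearMap.add_comp]; exact .add _ _ h h'
  | factor X Y hX hY g g' => rw [LinearMap.comp_assoc]; exact .factor X Y hX hY _ _

theorem sum {T T' : AlgBimodule K A B} {ι : Type*} (s : Finset ι) (f : ι → Hom T T')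
    (hf : ∀ i ∈ s, Decomposable (f i)) : Decomposable (∑ i ∈ s, f i) := by
  classical
  induction s using Finset.induction_on with
  | empty => rw [Finset.sum_empty]; exact .zero
  | insert i s hi ih =>
    rw [Finset.sum_insert hi]
    exact .add _ _ (hf i (Finset.mem_insert_self i s))
      (ih fun j hj => hf j (Finset.mem_insert_of_mem hj))

/-- By associativity `M ⊗ (X ⊗_K Y) = (M ⊗ X) ⊗_K Y`, so a factorization keeps its shape. Allowing
arbitrary finite modules `X` and `Y`, rather than projective ones, means that finiteness of `M` is
all this needs. -/
theorem whisker_left {M : AlgBimodule K A B} (hM : M.Finite) {T T' : AlgBimodule K B C}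
    {f : Hom T T'} (hf : Decomposable f) :
    Decomposable (tensorMap (Hom.id M) f) := by
  induction hf with
  | zero => rw [tensorMap_zero_right]; exact .zero
  | add f g _ _ h h' => rw [tensorMap_add_right]; exact .add _ _ h h'
  | factor X Y hX hY f g =>
    have h := Decomposable.factor (M.tensor X) Y (hM.tensor hX) hY
      (assocInv M X Y ∘ₗ tensorMap (Hom.id M) f) (tensorMap (Hom.id M) g ∘ₗ assoc M X Y)
    have e : (tensorMap (Hom.id M) g ∘ₗ assoc M X Y) ∘ₗ (assocInv M X Y ∘ₗ
        tensorMap (Hom.id M) f) = tensorMap (Hom.id M) (g ∘ₗ f) := by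
      rw [tensorMap_id_comp]
      refine LinearMap.ext fun t => ?_
      simp only [LinearMap.comp_apply, assoc_assocInv]
    rwa [e] at h

theorem whisker_right {M : AlgBimodule K B C} (hM : M.Finite) {T T' : AlgBimodule K A B}
    {f : Hom T T'} (hf : Decomposable f) :
    Decomposable (tensorMap f (Hom.id M)) := by
  induction hf with
  | zero => rw [tensorMap_zero_left]; exact .zero
  | add f g _ _ h h' => rw [tensorMap_add_left]; exact .add _ _ h h'
  | factor X Y hX hY f g =>
    have h := Decomposable.factor X (Y.tensor M) hX (hY.tensor hM)
      (assoc X Y M ∘ₗ tensorMap f (Hom.id M)) (tensorMap g (Hom.id M) ∘ₗ assocInv X Y M)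
    have e : (tensorMap g (Hom.id M) ∘ₗ assocInv X Y M) ∘ₗ (assoc X Y M ∘ₗ
        tensorMap f (Hom.id M)) = tensorMap (g ∘ₗ f) (Hom.id M) := by
      rw [tensorMap_comp_id]
      refine LinearMap.ext fun t => ?_
      simp only [LinearMap.comp_apply, assocInv_assoc]
    rwa [e] at h

end Decomposable

/-- A left module as a bimodule over the base on the right. -/
def ofLeft (K A X : Type u) [CommRing K] [Ring A] [Algebra K A] [AddCommGroup X] [Module K X]
    [Module A X] [IsScalarTower K A X] : AlgBimodule K A K :=
  letI : Module Kᵐᵒᵖ X := Module.compHom X (RingEquiv.toOpposite K).symm.toRingHom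
  { carrier := X
    rightTower := ⟨fun k c x => mul_smul (α := K) k c.unop x⟩
    actionsCommute := ⟨fun a c x => smul_algebra_smul_comm (R := K) c.unop a x⟩ }

/-- A right module as a bimodule over the base on the left. -/
def ofRight (K B Y : Type u) [CommRing K] [Ring B] [Algebra K B] [AddCommGroup Y] [Module K Y]
    [Module Bᵐᵒᵖ Y] [IsScalarTower K Bᵐᵒᵖ Y] : AlgBimodule K K B :=
  { carrier := Y
    actionsCommute := ⟨fun k b y => (smul_algebra_smul_comm (R := K) k b y).symm⟩ }

theorem env_smul_assoc (X : AlgBimodule K A B) (k : K) (e : A ⊗[K] Bᵐᵒᵖ) (x : X.carrier) :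
    (k • e) • x = k • e • x := by
  have h : k • e = (algebraMap K A k ⊗ₜ[K] (1 : Bᵐᵒᵖ)) * e := Algebra.smul_def k e
  rw [h, mul_smul, env_smul, one_smul, algebraMap_smul]

/-- The action on a fixed element of a bimodule, as a bilinear map. -/
def actOn (P : AlgBimodule K A B) (p : P.carrier) : A →ₗ[K] B →ₗ[K] P.carrier :=
  LinearMap.mk₂ K (fun a b => a • MulOpposite.op b • p)
    (fun a a' b => add_smul a a' _)
    (fun k a b => smul_assoc k a _)
    (fun a b b' => by rw [MulOpposite.op_add, add_smul, smul_add])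
    (fun k a b => by rw [MulOpposite.op_smul, smul_assoc, smul_algebra_smul_comm])

/-- The homomorphism from the free bimodule of rank one which is given by an element. -/
def ofElement (P : AlgBimodule K A B) (p : P.carrier) :
    Hom ((ofLeft K A A).tensor (ofRight K B B)) P :=
  tensorLiftHom (X := ofLeft K A A) (Y := ofRight K B B) (actOn P p)
    (fun (a : A) k (b : B) => show actOn P p (k • a) b = actOn P p a (k • b) by
      rw [map_smul, map_smul, LinearMap.smul_apply])
    (fun a (x : A) (b : B) => mul_smul a x (MulOpposite.op b • p))
    (fun c (a : A) (b : B) => show a • MulOpposite.op (b * c.unop) • p =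
        c • a • MulOpposite.op b • p by
      rw [MulOpposite.op_mul, MulOpposite.op_unop, mul_smul, smul_comm a c])

theorem ofElement_one (P : AlgBimodule K A B) (p : P.carrier) :
    ofElement P p (tmul (ofLeft K A A) (ofRight K B B) (1 : A) (1 : B)) = p :=
  (tensorLiftHom_tmul _ _ _ _ _ _).trans (by
    change (1 : A) • MulOpposite.op (1 : B) • p = p
    rw [MulOpposite.op_one, one_smul, one_smul])

/-- `P` is a direct summand of a free bimodule of finite rank, and a free bimodule of rank one is `A
⊗_K B`. The identity of `P` is the sum over the coordinates of maps through these copies. -/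
theorem decomposable_id [Module.Finite K A] [Module.Finite K B] {P : AlgBimodule K A B}
    (hP : P.BiProjective) (hfin : P.Finite) : Decomposable (Hom.id P) := by
  have : Module.Projective (A ⊗[K] Bᵐᵒᵖ) P.carrier := hP
  have : Module.Finite K P.carrier := hfin
  have : IsScalarTower K (A ⊗[K] Bᵐᵒᵖ) P.carrier := ⟨env_smul_assoc P⟩
  have : Module.Finite (A ⊗[K] Bᵐᵒᵖ) P.carrier := Module.Finite.of_restrictScalars_finite K _ _
  obtain ⟨n, r, s, -, -, hrs⟩ :=
    Module.Finite.exists_comp_eq_id_of_projective (A ⊗[K] Bᵐᵒᵖ) P.carrier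
  have key : Hom.id P = ∑ k : Fin n, ofElement P (r (Pi.single k 1)) ∘ₗ
      (LinearMap.toSpanSingleton (A ⊗[K] Bᵐᵒᵖ) _
        (tmul (ofLeft K A A) (ofRight K B B) (1 : A) (1 : B)) ∘ₗ LinearMap.proj k ∘ₗ s) := by
    refine LinearMap.ext fun t => ?_
    have h : Hom.id P t = r (s t) := (LinearMap.congr_fun hrs t).symm
    rw [LinearMap.sum_apply, h]
    simp only [LinearMap.comp_apply, LinearMap.toSpanSingleton_apply, LinearMap.map_smul,
      ofElement_one, LinearMap.proj_apply]
    conv_lhs => rw [← Finset.univ_sum_single (s t), map_sum]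
    refine Finset.sum_congr rfl fun k _ => ?_
    rw [← map_smul]
    congr 1
    ext j
    by_cases h : j = k
    · subst h; simp
    · simp [h]
  rw [key]
  refine Decomposable.sum _ _ fun k _ => .factor (ofLeft K A A) (ofRight K B B) ?_ ?_ _ _
  · exact inferInstanceAs (Module.Finite K A)
  · exact inferInstanceAs (Module.Finite K B)

end AlgBimodule

/-! ### Central elements and the transfer map -/

namespace AlgBimodule

variable {K A B C D : Type u} [CommRing K] [Ring A] [Ring B] [Ring C] [Ring D] [Algebra K A]
  [Algebra K B] [Algebra K C] [Algebra K D]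

/-- The action of a central element on a bimodule. -/
def centralAct (M : AlgBimodule K A B) (z : Subalgebra.center K A) : Hom M M :=
  mkHom (Algebra.lsmul K K M.carrier (z : A))
    (fun a x => by
      change (z : A) • a • x = a • (z : A) • x
      rw [← mul_smul, ← mul_smul, Subalgebra.mem_center_iff.1 z.2])
    (fun b x => by
      change (z : A) • b • x = b • (z : A) • x
      rw [smul_comm])

@[simp] theorem centralAct_apply (M : AlgBimodule K A B) (z : Subalgebra.center K A)
    (x : M.carrier) : centralAct M z x = (z : A) • x := rfl

theorem comp_centralAct {M M' : AlgBimodule K A B} (f : Hom M M') (z : Subalgebra.center K A) :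
    f ∘ₗ centralAct M z = centralAct M' z ∘ₗ f :=
  LinearMap.ext fun x => f.map_left _ x

theorem centralAct_add (M : AlgBimodule K A B) (z w : Subalgebra.center K A) :
    centralAct M (z + w) = centralAct M z + centralAct M w :=
  LinearMap.ext fun x => add_smul (z : A) (w : A) x

theorem centralAct_mul (M : AlgBimodule K A B) (z w : Subalgebra.center K A) :
    centralAct M (z * w) = centralAct M z ∘ₗ centralAct M w :=
  LinearMap.ext fun x => mul_smul (z : A) (w : A) x

theorem centralAct_one (M : AlgBimodule K A B) : centralAct M 1 = Hom.id M :=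
  LinearMap.ext fun x => one_smul A x

theorem tensorMap_centralAct (M : AlgBimodule K A B) (N : AlgBimodule K B C)
    (z : Subalgebra.center K A) :
    tensorMap (centralAct M z) (Hom.id N) = centralAct (M.tensor N) z :=
  LinearMap.ext fun t => by
    induction t using tensor_induction with
    | h0 => rw [map_zero, map_zero]
    | ht x y => rw [tensorMap_tmul, centralAct_apply, centralAct_apply, smul_tmul_left]; rfl
    | ha s t hs ht => rw [map_add, hs, ht, ← map_add]

/-- The central element which is given by an endomorphism of the regular bimodule. -/
def ofEndo (f : Hom (regular K A) (regular K A)) : Subalgebra.center K A :=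
  ⟨(f (toRegular 1) : A), Subalgebra.mem_center_iff.2 fun a => by
    have h1 := f.map_left a (toRegular 1)
    have h2 := f.map_right (MulOpposite.op a) (toRegular 1)
    rw [smul_regular, mul_one] at h1
    rw [op_smul_regular, one_mul] at h2
    exact h1.symm.trans h2⟩

theorem centralAct_ofEndo (f : Hom (regular K A) (regular K A)) :
    centralAct (regular K A) (ofEndo f) = f :=
  LinearMap.ext fun x => by
    obtain ⟨a, ha⟩ := exists_toRegular x
    have h2 := f.map_right (MulOpposite.op a) (toRegular 1)
    rw [op_smul_regular, one_mul] at h2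
    rw [ha, h2]
    rfl

theorem ofEndo_centralAct (z : Subalgebra.center K A) :
    ofEndo (centralAct (regular K A) z) = z := Subtype.ext (mul_one (z : A))

variable (K A) in
/-- The ideal of all central elements the multiplication by which is a decomposable endomorphism
of the regular bimodule. -/
def decomposableIdeal : Ideal (Subalgebra.center K A) where
  carrier := {z | Decomposable (centralAct (regular K A) z)}
  zero_mem' := by
    have h : centralAct (regular K A) 0 = 0 := LinearMap.ext fun x => zero_smul A x
    change Decomposable _
    rw [h]
    exact .zero
  add_mem' := fun {z w} hz hw => by
    change Decomposable _
    rw [centralAct_add]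
    exact .add _ _ hz hw
  smul_mem' := fun z w hw => by
    change Decomposable (centralAct _ (z * w))
    rw [centralAct_mul]
    exact Decomposable.comp_left hw _

theorem mem_decomposableIdeal {z : Subalgebra.center K A} :
    z ∈ decomposableIdeal K A ↔ Decomposable (centralAct (regular K A) z) := Iff.rfl

/-- The regular bimodule is a direct summand of the bimodule, with a complement whose identity is
decomposable. -/
structure RegularSummand (T : AlgBimodule K A A) where
  /-- the inclusion -/
  incl : Hom (regular K A) T
  /-- the projection -/
  proj : Hom T (regular K A)
  proj_comp_incl : proj ∘ₗ incl = Hom.id (regular K A)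
  decomposable : Decomposable (Hom.id T - incl ∘ₗ proj)

/-- The complementary idempotent factors through the identity of `P`, which is decomposable because
`P` is projective. -/
theorem nonempty_regularSummand [Module.Finite K A] {T P : AlgBimodule K A A} (hT : T.Finite)
    (hP : P.BiProjective) (h : T.Isomorphic ((regular K A).directSum P)) :
    Nonempty (RegularSummand T) := by
  obtain ⟨e⟩ := h
  let inl : Hom (regular K A) ((regular K A).directSum P) :=
    mkHom (LinearMap.inl K (regular K A).carrier P.carrier)
      (fun a x => Prod.ext rfl (smul_zero a).symm) (fun a x => Prod.ext rfl (smul_zero a).symm)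
  let inr : Hom P ((regular K A).directSum P) :=
    mkHom (LinearMap.inr K (regular K A).carrier P.carrier)
      (fun a x => Prod.ext (smul_zero (M := A) (A := (regular K A).carrier) a).symm rfl)
      (fun a x => Prod.ext (smul_zero (M := Aᵐᵒᵖ) (A := (regular K A).carrier) a).symm rfl)
  let fst : Hom ((regular K A).directSum P) (regular K A) :=
    mkHom (LinearMap.fst K (regular K A).carrier P.carrier) (fun a x => rfl) (fun a x => rfl)
  let snd : Hom ((regular K A).directSum P) P :=
    mkHom (LinearMap.snd K (regular K A).carrier P.carrier) (fun a x => rfl) (fun a x => rfl)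
  let e₁ : Hom T ((regular K A).directSum P) := e.toLinearMap
  let e₂ : Hom ((regular K A).directSum P) T := e.symm.toLinearMap
  -- `P` is a quotient of `T`, so its finiteness need not be part of the definition of a stable
  -- equivalence.
  have hfin : P.Finite := by
    have : Module.Finite K T.carrier := hT
    refine Module.Finite.of_surjective (snd.base ∘ₗ e₁.base) fun x => ⟨e₂ (inr x), ?_⟩
    exact congrArg snd (e.apply_symm_apply (inr x))
  refine ⟨⟨e₂ ∘ₗ inl, fst ∘ₗ e₁, LinearMap.ext fun x => ?_, ?_⟩⟩
  · exact congrArg fst (e.apply_symm_apply (inl x))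
  · have key : Hom.id T - (e₂ ∘ₗ inl) ∘ₗ (fst ∘ₗ e₁) = (e₂ ∘ₗ inr) ∘ₗ Hom.id P ∘ₗ (snd ∘ₗ e₁) := by
      refine LinearMap.ext fun x => ?_
      rw [LinearMap.sub_apply, sub_eq_iff_eq_add]
      have h1 : e₁ x = inr (snd (e₁ x)) + inl (fst (e₁ x)) :=
        Prod.ext (zero_add _).symm (add_zero _).symm
      have h2 : e₂ (e₁ x) = x := e.symm_apply_apply x
      calc x = e₂ (e₁ x) := h2.symm
        _ = e₂ (inr (snd (e₁ x)) + inl (fst (e₁ x))) := congrArg e₂ h1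
        _ = _ := map_add e₂ _ _
    rw [key]
    exact ((decomposable_id hP hfin).comp_right _).comp_left _

section Transfer

variable {M : AlgBimodule K A B} {N : AlgBimodule K B A} (rA : RegularSummand (M.tensor N))
  (rB : RegularSummand (N.tensor M))

/-- The action of a central element of `A` in the middle of `N ⊗_A M`. -/
def middleAct (N : AlgBimodule K B A) (M : AlgBimodule K A B) (z : Subalgebra.center K A) :
    Hom (N.tensor M) (N.tensor M) := tensorMap (Hom.id N) (centralAct M z)

theorem middleAct_add (z w : Subalgebra.center K A) :
    middleAct N M (z + w) = middleAct N M z + middleAct N M w := by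
  rw [middleAct, centralAct_add, tensorMap_add_right]; rfl

theorem middleAct_mul (z w : Subalgebra.center K A) :
    middleAct N M (z * w) = middleAct N M z ∘ₗ middleAct N M w := by
  rw [middleAct, centralAct_mul, tensorMap_id_comp]; rfl

theorem middleAct_one : middleAct N M 1 = Hom.id (N.tensor M) := by
  rw [middleAct, centralAct_one]
  refine LinearMap.ext fun t => ?_
  induction t using tensor_induction with
  | h0 => rw [map_zero, map_zero]
  | ht x y => rw [tensorMap_tmul]; rfl
  | ha s t hs ht => rw [map_add, hs, ht, ← map_add]

theorem middleAct_smul (k : K) (z : Subalgebra.center K A) (t : (N.tensor M).carrier) :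
    middleAct N M (k • z) t = k • middleAct N M z t := by
  induction t using tensor_induction with
  | h0 => rw [map_zero, map_zero, smul_zero]
  | ht x y =>
    rw [middleAct, middleAct, tensorMap_tmul, tensorMap_tmul, ← map_smul]
    congr 1
    exact smul_assoc k (z : A) y
  | ha s t hs ht => rw [map_add, hs, ht, ← smul_add, ← map_add]

/-- The compression to `B` of the action of a central element of `A` on `N ⊗_A M`. -/
def compress (z : Subalgebra.center K A) : Hom (regular K B) (regular K B) :=
  rB.proj ∘ₗ middleAct N M z ∘ₗ rB.incl

/-- The transfer map between the centers. -/
def transfer : Subalgebra.center K A →ₗ[K] Subalgebra.center K B where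
  toFun z := ofEndo (compress rB z)
  map_add' z w := Subtype.ext (by
    change compress rB (z + w) (toRegular 1) = _
    rw [compress, middleAct_add, LinearMap.add_comp, LinearMap.comp_add]
    rfl)
  map_smul' k z := Subtype.ext (by
    change rB.proj (middleAct N M (k • z) (rB.incl (toRegular 1))) =
      k • rB.proj (middleAct N M z (rB.incl (toRegular 1)))
    rw [middleAct_smul, Hom.map_base])

theorem centralAct_transfer (z : Subalgebra.center K A) :
    centralAct (regular K B) (transfer rB z) = compress rB z := centralAct_ofEndo _

theorem transfer_one : transfer rB (1 : Subalgebra.center K A) = 1 := by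
  change ofEndo (compress rB 1) = 1
  rw [compress, middleAct_one, LinearMap.id_comp, rB.proj_comp_incl, ← centralAct_one,
    ofEndo_centralAct]

/-- Compressing `z ∘ w` and composing the two compressions differ by the term in which the
complementary idempotent stands between `z` and `w`, and that idempotent is decomposable. -/
theorem transfer_mul (z w : Subalgebra.center K A) :
    transfer rB (z * w) - transfer rB z * transfer rB w ∈ decomposableIdeal K B := by
  have h : Decomposable (rB.proj ∘ₗ middleAct N M z ∘ₗ (Hom.id _ - rB.incl ∘ₗ rB.proj) ∘ₗ
      middleAct N M w ∘ₗ rB.incl) :=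
    ((rB.decomposable.comp_right _).comp_left _).comp_left _
  have e : centralAct (regular K B) (transfer rB (z * w) - transfer rB z * transfer rB w) =
      rB.proj ∘ₗ middleAct N M z ∘ₗ (Hom.id _ - rB.incl ∘ₗ rB.proj) ∘ₗ
      middleAct N M w ∘ₗ rB.incl := by
    have e1 : centralAct (regular K B) (transfer rB (z * w) - transfer rB z * transfer rB w) +
        compress rB z ∘ₗ compress rB w = compress rB (z * w) := by
      rw [← centralAct_transfer, ← centralAct_transfer, ← centralAct_mul, ← centralAct_add,
        sub_add_cancel, centralAct_transfer]
    rw [← eq_sub_iff_add_eq] at e1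
    rw [e1, compress, compress, compress, middleAct_mul]
    refine LinearMap.ext fun x => ?_
    simp only [LinearMap.sub_apply, LinearMap.comp_apply, LinearMap.id_apply, map_sub]
  rw [mem_decomposableIdeal, e]
  exact h

/-- `M` is `A ⊗_A M`, and `z` acts there through the left factor. -/
theorem decomposable_centralAct_of_mem (hM : M.Finite) {z : Subalgebra.center K A}
    (hz : z ∈ decomposableIdeal K A) : Decomposable (centralAct M z) := by
  have h := ((Decomposable.whisker_right hM hz).comp_right (leftUnitInv M)).comp_left (leftUnit M)
  have e : leftUnit M ∘ₗ tensorMap (centralAct (regular K A) z) (Hom.id M) ∘ₗ leftUnitInv M =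
      centralAct M z := by
    rw [tensorMap_centralAct, ← LinearMap.comp_assoc, comp_centralAct, LinearMap.comp_assoc]
    refine LinearMap.ext fun x => ?_
    rw [LinearMap.comp_apply, LinearMap.comp_apply, leftUnit_leftUnitInv]
  rwa [e] at h

-- Tensoring the action on `M` with `N` gives the action on `M ⊗_B N`, of which the regular bimodule
-- is a summand preserved by `z`.
include rA in
theorem mem_of_decomposable_centralAct (hN : N.Finite) {z : Subalgebra.center K A}
    (hz : Decomposable (centralAct M z)) : z ∈ decomposableIdeal K A := by
  have h := ((Decomposable.whisker_right hN hz).comp_right rA.incl).comp_left rA.proj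
  rw [tensorMap_centralAct, ← LinearMap.comp_assoc, comp_centralAct, LinearMap.comp_assoc,
    rA.proj_comp_incl, LinearMap.comp_id] at h
  exact h

-- The nontrivial direction recovers the action of `z` from its compression in three moves: from `B`
-- to `N ⊗_A M`, whose complement is decomposable; from there to `M ⊗_B N ⊗_A M`; and, by
-- compressing `M ⊗_B N` to `A`, to the action on `M` alone.
include rA in
theorem transfer_mem_iff (hM : M.Finite) (hN : N.Finite) (z : Subalgebra.center K A) :
    transfer rB z ∈ decomposableIdeal K B ↔ z ∈ decomposableIdeal K A := by
  rw [mem_decomposableIdeal, centralAct_transfer]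
  constructor
  · intro h
    have h1 : Decomposable (middleAct N M z) := by
      -- Peirce decomposition of the middle action with respect to the idempotent onto `B`: one
      -- corner is the compression, and every other term contains the complementary idempotent.
      have e : middleAct N M z = rB.incl ∘ₗ compress rB z ∘ₗ rB.proj +
          ((rB.incl ∘ₗ rB.proj) ∘ₗ middleAct N M z ∘ₗ (Hom.id _ - rB.incl ∘ₗ rB.proj) +
            (Hom.id _ - rB.incl ∘ₗ rB.proj) ∘ₗ middleAct N M z) := by
        refine LinearMap.ext fun x => ?_
        simp only [compress, LinearMap.sub_apply, LinearMap.comp_apply, LinearMap.id_apply,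
          map_sub, LinearMap.add_apply]
        abel
      rw [e]
      exact .add _ _ ((h.comp_right _).comp_left _)
        (.add _ _ ((rB.decomposable.comp_left _).comp_left _) (rB.decomposable.comp_right _))
    -- Rebracketing turns the action in the middle of `N ⊗ M` into an action on the last factor of
    -- `(M ⊗ N) ⊗ M`, away from the factor that is compressed next.
    have h2 : Decomposable (tensorMap (Hom.id (M.tensor N)) (centralAct M z)) := by
      have h := ((h1.whisker_left hM).comp_right (assoc M N M)).comp_left (assocInv M N M)
      have e : assocInv M N M ∘ₗ tensorMap (Hom.id M) (middleAct N M z) ∘ₗ assoc M N M =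
          tensorMap (Hom.id (M.tensor N)) (centralAct M z) := by
        refine LinearMap.ext fun t => ?_
        rw [LinearMap.comp_apply, LinearMap.comp_apply]
        induction t using tensor_induction with
        | h0 => rw [map_zero, map_zero, map_zero, map_zero]
        | ht s z =>
          induction s using tensor_induction with
          | h0 => simp only [map_zero, LinearMap.zero_apply]
          | ht x y =>
            rw [assoc_tmul, tensorMap_tmul, middleAct, tensorMap_tmul, tensorMap_tmul]
            exact assocInv_tmul _ _ _ _ _ _
          | ha s t hs ht => simp only [map_add, LinearMap.add_apply, hs, ht]
        | ha s t hs ht => rw [map_add, map_add, map_add, hs, ht, ← map_add]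
      rwa [e] at h
    refine mem_of_decomposable_centralAct rA hN ?_
    -- Compressing `M ⊗ N` to `A` in the left factor leaves `A ⊗_A M = M`, with `z` still acting on
    -- `M`.
    have h3 := (((h2.comp_right (tensorMap rA.incl (Hom.id M))).comp_left
      (tensorMap rA.proj (Hom.id M))).comp_right (leftUnitInv M)).comp_left (leftUnit M)
    have e : leftUnit M ∘ₗ (tensorMap rA.proj (Hom.id M) ∘ₗ tensorMap (Hom.id (M.tensor N))
        (centralAct M z) ∘ₗ tensorMap rA.incl (Hom.id M)) ∘ₗ leftUnitInv M = centralAct M z := by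
      refine LinearMap.ext fun x => ?_
      have hp : rA.proj (rA.incl (toRegular 1)) = toRegular 1 :=
        LinearMap.congr_fun rA.proj_comp_incl _
      rw [LinearMap.comp_apply, LinearMap.comp_apply, LinearMap.comp_apply, LinearMap.comp_apply,
        leftUnitInv_apply, tensorMap_tmul, tensorMap_tmul, tensorMap_tmul]
      change leftUnit M (tmul (regular K A) M (rA.proj (rA.incl (toRegular 1))) _) = _
      rw [hp, leftUnit_tmul, one_smul]
      rfl
    rwa [e] at h3
  · intro hz
    exact (((decomposable_centralAct_of_mem hM hz).whisker_left hN).comp_right _).comp_left _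

/-- The transfer map modulo the decomposable ideal. -/
noncomputable def transferHom :
    Subalgebra.center K A →ₐ[K] Subalgebra.center K B ⧸ decomposableIdeal K B :=
  AlgHom.ofLinearMap ((Ideal.Quotient.mkₐ K (decomposableIdeal K B)).toLinearMap ∘ₗ transfer rB)
    ((congrArg (Ideal.Quotient.mk _) (transfer_one rB)).trans (map_one _))
    (fun z w => (Ideal.Quotient.eq.2 (transfer_mul rB z w)).trans (map_mul _ _ _))

include rA rB in
theorem exists_injective_algHom (hM : M.Finite) (hN : N.Finite) :
    ∃ f : (Subalgebra.center K A ⧸ decomposableIdeal K A) →ₐ[K]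
      (Subalgebra.center K B ⧸ decomposableIdeal K B), Function.Injective f := by
  have h (z : Subalgebra.center K A) : transferHom rB z = 0 ↔ z ∈ decomposableIdeal K A :=
    Ideal.Quotient.eq_zero_iff_mem.trans (transfer_mem_iff rA rB hM hN z)
  refine ⟨Ideal.Quotient.liftₐ _ (transferHom rB) fun z hz => (h z).2 hz, ?_⟩
  intro x y hxy
  obtain ⟨x, rfl⟩ := Ideal.Quotient.mk_surjective x
  obtain ⟨y, rfl⟩ := Ideal.Quotient.mk_surjective y
  refine Ideal.Quotient.eq.2 ((h (x - y)).1 ?_)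
  rw [map_sub, sub_eq_zero]
  exact hxy

end Transfer

end AlgBimodule

/-- The dimension of a power of the nilradical. -/
noncomputable def nilradicalPowRank (K S : Type u) [CommRing K] [CommRing S] [Algebra K S]
    (n : ℕ) : ℕ :=
  Module.finrank K ↥(((nilradical S).restrictScalars K) ^ n : Submodule K S)

/-- An algebra map sends nilpotents to nilpotents and commutes with powers of subspaces. Injectivity
preserves dimension. -/
theorem nilradicalPowRank_le {K S S' : Type u} [Field K] [CommRing S] [Algebra K S] [CommRing S']
    [Algebra K S'] [Module.Finite K S'] (f : S →ₐ[K] S') (hf : Function.Injective f) (n : ℕ) :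
    nilradicalPowRank K S n ≤ nilradicalPowRank K S' n := by
  have h : Submodule.map f.toLinearMap (((nilradical S).restrictScalars K) ^ n) ≤
      ((nilradical S').restrictScalars K) ^ n := by
    rw [Submodule.map_pow]
    refine pow_le_pow_left' ?_ n
    rintro _ ⟨x, hx, rfl⟩
    exact IsNilpotent.map (mem_nilradical.1 hx) f
  rw [nilradicalPowRank, (Submodule.equivMapOfInjective f.toLinearMap hf _).finrank_eq]
  exact Submodule.finrank_mono h

/-- The center modulo the decomposable ideal. -/
abbrev StableCenter (K A : Type u) [CommRing K] [Ring A] [Algebra K A] : Type u :=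
  Subalgebra.center K A ⧸ AlgBimodule.decomposableIdeal K A

/-- Embeddings in both directions are enough for equality of dimensions, so it need not be shown
that the two transfer maps are mutually inverse. -/
theorem StablyEquivalentOfMoritaType.nilradicalPowRank_eq {K A B : Type u} [Field K] [Ring A]
    [Ring B] [Algebra K A] [Algebra K B] [Module.Finite K A] [Module.Finite K B]
    (h : StablyEquivalentOfMoritaType K A B) (n : ℕ) :
    nilradicalPowRank K (StableCenter K A) n = nilradicalPowRank K (StableCenter K B) n := by
  obtain ⟨M, N, P, Q, hM, hN, -, -, -, -, hP, hQ, hA, hB⟩ := h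
  obtain ⟨rA⟩ := AlgBimodule.nonempty_regularSummand (hM.tensor hN) hP hA
  obtain ⟨rB⟩ := AlgBimodule.nonempty_regularSummand (hN.tensor hM) hQ hB
  obtain ⟨f, hf⟩ := AlgBimodule.exists_injective_algHom rA rB hM hN
  obtain ⟨g, hg⟩ := AlgBimodule.exists_injective_algHom rB rA hN hM
  exact le_antisymm (nilradicalPowRank_le f hf n) (nilradicalPowRank_le g hg n)

/-! ### Reflexivity, and criteria for a central element to be decomposable -/

namespace AlgBimodule

section Regular

variable {K A : Type u} [CommRing K] [Ring A] [Algebra K A]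

theorem leftProjective_regular : (regular K A).LeftProjective :=
  inferInstanceAs (Module.Projective A A)

theorem rightProjective_regular : (regular K A).RightProjective :=
  let e : Aᵐᵒᵖ ≃ₗ[Aᵐᵒᵖ] (regular K A).carrier :=
    { toFun := fun a => toRegular a.unop
      invFun := fun a => MulOpposite.op (show A from a)
      map_add' := fun _ _ => rfl
      map_smul' := fun _ _ => rfl
      left_inv := fun _ => rfl
      right_inv := fun _ => rfl }
  Module.Projective.of_equiv e

variable (K A) in
/-- The zero bimodule. -/
def zero : AlgBimodule K A A where
  carrier := PUnit

instance : Subsingleton (zero K A).carrier := inferInstanceAs (Subsingleton PUnit)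

theorem biProjective_zero : (zero K A).BiProjective := by
  have : Module.Free (A ⊗[K] Aᵐᵒᵖ) (zero K A).carrier := Module.Free.of_subsingleton _ _
  exact Module.Projective.of_free

theorem isomorphic_regular_tensor :
    ((regular K A).tensor (regular K A)).Isomorphic ((regular K A).directSum (zero K A)) := by
  let f : Hom ((regular K A).tensor (regular K A)) ((regular K A).directSum (zero K A)) :=
    mkHom (LinearMap.inl K (regular K A).carrier (zero K A).carrier ∘ₗ
        (leftUnit (regular K A)).base)
      (fun a x => Prod.ext ((leftUnit (regular K A)).map_left a x) rfl)
      (fun a x => Prod.ext ((leftUnit (regular K A)).map_right a x) rfl)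
  let g : Hom ((regular K A).directSum (zero K A)) ((regular K A).tensor (regular K A)) :=
    mkHom ((leftUnitInv (regular K A)).base ∘ₗ
        LinearMap.fst K (regular K A).carrier (zero K A).carrier)
      (fun a x => (leftUnitInv (regular K A)).map_left a x.1)
      (fun a x => (leftUnitInv (regular K A)).map_right a x.1)
  exact ⟨LinearEquiv.ofLinearMap f g
    (LinearMap.ext fun x => Prod.ext (leftUnit_leftUnitInv _ x.1) rfl)
    (LinearMap.ext fun x => leftUnitInv_leftUnit _ x)⟩

theorem stablyEquivalent_refl [Module.Finite K A] : StablyEquivalentOfMoritaType K A A :=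
  ⟨regular K A, regular K A, zero K A, zero K A, ‹Module.Finite K A›, ‹Module.Finite K A›,
    leftProjective_regular, rightProjective_regular, leftProjective_regular,
    rightProjective_regular, biProjective_zero, biProjective_zero, isomorphic_regular_tensor,
    isomorphic_regular_tensor⟩

end Regular

section Trace

variable {K A L : Type u} [Field K] [Ring A] [Ring L] [Algebra K A] [Algebra K L]

/-- An element of the regular bimodule as an element of the algebra. -/
def fromRegular : (regular K A).carrier →ₗ[K] A := LinearMap.id

theorem fromRegular_smul (a : A) (x : (regular K A).carrier) :
    fromRegular (a • x) = a * fromRegular x := rfl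

theorem fromRegular_op_smul (a : A) (x : (regular K A).carrier) :
    fromRegular (MulOpposite.op a • x) = fromRegular x * a := rfl

variable (φ : A →ₗ[K] K) (X : AlgBimodule K A L) (Y : AlgBimodule K L A)
  (g : Hom (X.tensor Y) (regular K A))

/-- The pairing which is given by a bimodule homomorphism to the regular bimodule and a linear
form. -/
def pairing : X.carrier →ₗ[K] Y.carrier →ₗ[K] K := (tmul X Y).compr₂ (φ ∘ₗ fromRegular ∘ₗ g.base)

/-- The contraction with the pairing. -/
def contract (hL : Function.Surjective (algebraMap K L)) :
    (X.tensor Y).carrier →ₗ[K] Module.End K X.carrier :=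
  tensorLift
    (LinearMap.mk₂ K (fun x y => ((pairing φ X Y g).flip y).smulRight x)
      (fun x x' y => by ext; simp)
      (fun k x y => by ext v; exact smul_comm _ _ _)
      (fun x y y' => by ext; simp [add_smul])
      (fun k x y => by ext; simp [mul_smul]))
    (fun x l y => by
      obtain ⟨k, rfl⟩ := hL l
      ext v
      rw [algebraMap_smul]
      have h : MulOpposite.op (algebraMap K L k) • x = k • x := algebraMap_smul Lᵐᵒᵖ k x
      simp [h, smul_comm k])

variable (hL : Function.Surjective (algebraMap K L))

theorem contract_tmul (x v : X.carrier) (y : Y.carrier) :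
    contract φ X Y g hL (tmul X Y x y) v = φ (fromRegular (g (tmul X Y v y))) • x := by
  rw [contract, tensorLift_tmul]
  rfl

theorem contract_smul_left (a : A) (t : (X.tensor Y).carrier) (v : X.carrier) :
    contract φ X Y g hL (a • t) v = a • contract φ X Y g hL t v := by
  induction t using tensor_induction with
  | h0 => simp
  | ht x y => rw [smul_tmul_left, contract_tmul, contract_tmul, smul_algebra_smul_comm]
  | ha s t hs ht => rw [smul_add, map_add, map_add, LinearMap.add_apply, LinearMap.add_apply, hs,
      ht, smul_add]

/-- Symmetry of `φ` moves `a` from the right end of `g (v ⊗ y)` to its left end, where it acts on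
`v`. -/
theorem contract_smul_right (hφ : ∀ a b, φ (a * b) = φ (b * a)) (a : A)
    (t : (X.tensor Y).carrier) (v : X.carrier) :
    contract φ X Y g hL (MulOpposite.op a • t) v = contract φ X Y g hL t (a • v) := by
  induction t using tensor_induction with
  | h0 => simp
  | ht x y =>
    rw [smul_tmul_right, contract_tmul, contract_tmul, ← smul_tmul_right, ← smul_tmul_left,
      Hom.map_left, Hom.map_right, fromRegular_smul, fromRegular_op_smul, hφ]
  | ha s t hs ht => rw [smul_add, map_add, map_add, LinearMap.add_apply, LinearMap.add_apply, hs,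
      ht]

/-- A pure tensor contracts to an operator of rank one, whose trace is the value of its functional
on its vector. By linearity this expresses `φ (a * g t)` as the trace of an operator on the left
module `X`. -/
theorem trace_contract (hX : X.Finite) (a : A) (t : (X.tensor Y).carrier) :
    LinearMap.trace K X.carrier (contract φ X Y g hL t * Algebra.lsmul K K X.carrier a) =
      φ (a * fromRegular (g t)) := by
  have : Module.Finite K X.carrier := hX
  induction t using tensor_induction with
  | h0 => simp
  | ht x y =>
    have h : contract φ X Y g hL (tmul X Y x y) * Algebra.lsmul K K X.carrier a =
        ((pairing φ X Y g).flip y ∘ₗ Algebra.lsmul K K X.carrier a).smulRight x := by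
      ext v
      exact contract_tmul φ X Y g hL x (a • v) y
    rw [h, LinearMap.trace_smulRight]
    change φ (fromRegular (g (tmul X Y (a • x) y))) = _
    rw [← smul_tmul_left, Hom.map_left, fromRegular_smul]
  | ha s t hs ht => rw [map_add, add_mul, map_add, hs, ht, map_add, map_add, mul_add, map_add]

/-- For a factorization through `X ⊗_K Y`, the value in question is the trace on `X` of the product
of `a` with a contraction commuting with `a`. If `a` is nilpotent, so is the product, and its trace
vanishes. -/
theorem Decomposable.apply_mul_eq_zero {f : Hom (regular K A) (regular K A)}
    (hf : Decomposable f) (φ : A →ₗ[K] K) (hφ : ∀ a b, φ (a * b) = φ (b * a)) {a : A}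
    (ha : IsNilpotent a) : φ (a * fromRegular (f (toRegular 1))) = 0 := by
  induction hf with
  | zero => rw [LinearMap.zero_apply, map_zero, mul_zero, map_zero]
  | add f g _ _ hf hg => rw [LinearMap.add_apply, map_add, mul_add, map_add, hf, hg, add_zero]
  | factor X Y hX hY f g =>
    have : Module.Finite K X.carrier := hX
    rw [LinearMap.comp_apply, ← trace_contract φ X Y g Function.surjective_id hX]
    refine IsNilpotent.eq_zero (LinearMap.isNilpotent_trace_of_isNilpotent ?_)
    -- The two operators commute because `a * 1 = 1 * a` in the regular bimodule: the tensor `f 1`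
    -- is fixed under exchanging left and right multiplication by `a`.
    refine Commute.isNilpotent_mul_left ?_ (ha.map (Algebra.lsmul K K X.carrier))
    refine LinearMap.ext fun v => ?_
    change contract φ X Y g _ (f (toRegular 1)) (a • v) =
      a • contract φ X Y g _ (f (toRegular 1)) v
    rw [← contract_smul_right φ X Y g _ hφ, ← contract_smul_left, ← Hom.map_left,
      ← Hom.map_right, smul_regular, op_smul_regular, one_mul, mul_one]

/-- Multiplication by `s` is `a ↦ χ a • s`. It factors through `K ⊗_K K`, where `A` acts by `χ` from
both sides and `1 ⊗ 1` is sent to `s`. -/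
theorem mem_decomposableIdeal_of_character (χ : A →ₐ[K] K) (s : Subalgebra.center K A)
    (hs : ∀ a : A, a * s = χ a • (s : A)) : s ∈ decomposableIdeal K A := by
  let _ : Module A K := Module.compHom K χ.toRingHom
  let _ : Module Aᵐᵒᵖ K := Module.compHom K (χ.toRingHom.fromOpposite fun x y => mul_comm _ _)
  have hA (a : A) (k : K) : a • k = χ a * k := rfl
  have hA' (a : Aᵐᵒᵖ) (k : K) : a • k = χ a.unop * k := rfl
  have : IsScalarTower K A K := ⟨fun k a x => by simp [hA, mul_assoc]⟩
  have : IsScalarTower K Aᵐᵒᵖ K := ⟨fun k a x => by simp [hA', mul_assoc]⟩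
  let X := ofLeft K A K
  let Y := ofRight K A K
  have hs' (a : A) : (s : A) * a = χ a • (s : A) := by
    rw [← hs, Subalgebra.mem_center_iff.1 s.2]
  let one : (X.tensor Y).carrier := tmul X Y (1 : K) (1 : K)
  have hone (a : A) : a • one = χ a • one := by
    have h : a • (1 : K) = χ a • (1 : K) := by rw [hA, smul_eq_mul]
    have h' := congrArg (fun k : K => tmul X Y k (1 : K)) h
    exact h'.trans (LinearMap.map_smul₂ (tmul X Y) (χ a) (1 : K) (1 : K))
  have hone' (a : Aᵐᵒᵖ) : a • one = χ a.unop • one := by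
    have h : a • (1 : K) = χ a.unop • (1 : K) := by rw [hA', smul_eq_mul]
    have h' := congrArg (fun k : K => tmul X Y (1 : K) k) h
    exact h'.trans (map_smul (tmul X Y (1 : K)) (χ a.unop) (1 : K))
  let f : Hom (regular K A) (X.tensor Y) := mkHom
    ((LinearMap.toSpanSingleton K _ one) ∘ₗ χ.toLinearMap ∘ₗ fromRegular)
    (fun a x => by
      change χ (a * fromRegular x) • one = a • χ (fromRegular x) • one
      rw [map_mul, mul_comm, mul_smul, smul_algebra_smul_comm (χ (fromRegular x)) a one, hone])
    (fun a x => by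
      change χ (fromRegular x * a.unop) • one = a • χ (fromRegular x) • one
      rw [map_mul, mul_smul, smul_algebra_smul_comm (χ (fromRegular x)) a one, hone', smul_comm])
  let m : K →ₗ[K] K →ₗ[K] (regular K A).carrier :=
    (LinearMap.mul K K).compr₂ (LinearMap.toSpanSingleton K (regular K A).carrier (toRegular s))
  have hm (x y : K) : m x y = toRegular ((x * y) • (s : A)) := rfl
  let g : Hom (X.tensor Y) (regular K A) := tensorLiftHom (X := X) (Y := Y) m
    (fun (x : K) (k : K) (y : K) => show m (k * x) y = m x (k * y) by
      rw [hm, hm, mul_assoc, mul_left_comm])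
    (fun a (x : K) (y : K) => show m (χ a * x) y = a • m x y by
      rw [hm, hm, smul_regular, mul_smul_comm, hs, smul_smul]
      congr 2
      ring)
    (fun a (x : K) (y : K) => show m x (χ a.unop * y) = a • m x y by
      rw [hm, hm, ← MulOpposite.op_unop a, op_smul_regular, smul_mul_assoc, hs', smul_smul]
      congr 2
      simp
      ring)
  have key : centralAct (regular K A) s = g ∘ₗ f := by
    refine LinearMap.ext fun x => ?_
    have h : g one = m 1 1 := tensorLiftHom_tmul _ _ _ _ _ _
    change _ = g (χ (fromRegular x) • one)
    rw [Hom.map_base, h, hm]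
    change (s : A) * fromRegular x = χ (fromRegular x) • ((1 * 1 : K) • (s : A))
    rw [hs', one_mul, one_smul]
  rw [mem_decomposableIdeal, key]
  exact .factor X Y (inferInstanceAs (Module.Finite K K)) (inferInstanceAs (Module.Finite K K)) _ _

end Trace

end AlgBimodule

section Wedge

/-! ## The powers of the nilradical of a wedge of truncated polynomial algebras -/

variable {K S : Type u} [Field K] [CommRing S] [Algebra K S]

/-- The span of the powers with exponent at least `k` of the members of a family. -/
def powSpan (K : Type u) {S : Type u} [Field K] [CommRing S] [Algebra K S] {ι : Type} (x : ι → S)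
    (k : ℕ) : Submodule K S := Submodule.span K {s | ∃ i j, k ≤ j ∧ s = x i ^ j}

/-- Products of powers of different generators vanish, so only powers of a single generator survive
and exponents add. The zeroth power is left out: there the left side is the line of scalars, while
`powSpan K x 0` contains all powers. -/
theorem powSpan_one_pow {ι : Type} (x : ι → S) (hx : ∀ i j, i ≠ j → x i * x j = 0) (k : ℕ) :
    powSpan K x 1 ^ (k + 1) = powSpan K x (k + 1) := by
  induction k with
  | zero => rw [zero_add, pow_one]
  | succ k ih =>
    rw [pow_succ, ih, powSpan, powSpan, powSpan, Submodule.span_mul_span]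
    apply le_antisymm
    · refine Submodule.span_le.2 ?_
      rintro _ ⟨_, ⟨i, j, hj, rfl⟩, _, ⟨i', j', hj', rfl⟩, rfl⟩
      by_cases h : i = i'
      · subst h
        exact Submodule.subset_span ⟨i, j + j', by omega, (pow_add _ _ _).symm⟩
      · have h0 : x i ^ j * x i' ^ j' = 0 := by
          obtain ⟨j, rfl⟩ := Nat.exists_eq_add_of_le' (Nat.le_of_add_left_le hj)
          obtain ⟨j', rfl⟩ := Nat.exists_eq_add_of_le' hj'
          rw [pow_succ, pow_succ, mul_mul_mul_comm, hx i i' h, mul_zero]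
        change x i ^ j * x i' ^ j' ∈ _
        rw [h0]
        exact Submodule.zero_mem _
    · refine Submodule.span_le.2 ?_
      rintro _ ⟨i, j, hj, rfl⟩
      refine Submodule.subset_span ⟨x i ^ (j - 1), ⟨i, j - 1, by omega, rfl⟩, x i ^ 1,
        ⟨i, 1, le_rfl, rfl⟩, ?_⟩
      change x i ^ (j - 1) * x i ^ 1 = _
      rw [← pow_add]
      congr 1
      omega

/-- The monomials of a wedge of truncated polynomial algebras. -/
def wedgeMonomial {ι : Type} (n : ι → ℕ) (x : ι → S) : Option (Σ i, Fin (n i - 1)) → S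
  | none => 1
  | some t => x t.1 ^ (t.2.1 + 1)

variable {ι : Type} [Fintype ι] {n : ι → ℕ} {x : ι → S}

-- The ring is the sum of the scalars and of the span of the positive powers, and the latter is
-- nilpotent. A nilpotent element can therefore have no scalar part.
omit [Fintype ι] in
theorem restrictScalars_nilradical_eq (hx' : ∀ i, x i ^ n i = 0)
    (hli : LinearIndependent K (wedgeMonomial n x))
    (hsp : ⊤ ≤ Submodule.span K (Set.range (wedgeMonomial n x))) :
    (nilradical S).restrictScalars K = powSpan K x 1 := by
  have hle : powSpan K x 1 ≤ (nilradical S).restrictScalars K := by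
    refine Submodule.span_le.2 ?_
    rintro _ ⟨i, j, hj, rfl⟩
    have : IsNilpotent (x i) := ⟨n i, hx' i⟩
    exact mem_nilradical.2 (this.pow_of_pos (by omega))
  refine le_antisymm (fun s hs => ?_) hle
  have h : s ∈ Submodule.span K {(1 : S)} ⊔ powSpan K x 1 := by
    have h : Submodule.span K (Set.range (wedgeMonomial n x)) ≤
        Submodule.span K {(1 : S)} ⊔ powSpan K x 1 := by
      refine Submodule.span_le.2 ?_
      rintro _ ⟨t, rfl⟩
      cases t with
      | none => exact Submodule.mem_sup_left (Submodule.mem_span_singleton_self _)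
      | some t => exact Submodule.mem_sup_right (Submodule.subset_span ⟨t.1, _, by omega, rfl⟩)
    exact h (hsp trivial)
  obtain ⟨y, hy, r, hr, rfl⟩ := Submodule.mem_sup.1 h
  obtain ⟨c, rfl⟩ := Submodule.mem_span_singleton.1 hy
  -- The scalar part is a difference of nilpotents, hence a nilpotent scalar, hence zero because `1
  -- ≠ 0`.
  have hc : c • (1 : S) ∈ nilradical S := by
    have := (nilradical S).sub_mem hs (hle hr)
    rwa [add_sub_cancel_right] at this
  obtain ⟨m, hm⟩ := mem_nilradical.1 hc
  have h1 : (1 : S) ≠ 0 := hli.ne_zero none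
  rw [smul_pow, one_pow, smul_eq_zero, or_iff_left h1] at hm
  rw [eq_zero_of_pow_eq_zero hm, zero_smul, zero_add]
  exact hr

theorem finrank_powSpan (hx' : ∀ i, x i ^ n i = 0)
    (hli : LinearIndependent K (wedgeMonomial n x)) (k : ℕ) :
    Module.finrank K (powSpan K x (k + 1)) = ∑ i, (n i - (k + 1)) := by
  let y : (Σ i, Fin (n i - (k + 1))) → S := fun t => x t.1 ^ (t.2.1 + (k + 1))
  have hspan : powSpan K x (k + 1) = Submodule.span K (Set.range y) := by
    apply le_antisymm
    · refine Submodule.span_le.2 ?_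
      rintro _ ⟨i, j, hj, rfl⟩
      by_cases h : j < n i
      · refine Submodule.subset_span ⟨⟨i, j - (k + 1), by omega⟩, ?_⟩
        simp only [y]
        congr 1
        omega
      · rw [SetLike.mem_coe, pow_eq_zero_of_le (not_lt.1 h) (hx' i)]
        exact Submodule.zero_mem _
    · refine Submodule.span_le.2 ?_
      rintro _ ⟨t, rfl⟩
      exact Submodule.subset_span ⟨t.1, _, by omega, rfl⟩
  let f : (Σ i, Fin (n i - (k + 1))) → Option (Σ i, Fin (n i - 1)) :=
    fun t => some ⟨t.1, t.2.1 + k, by have := t.2.2; omega⟩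
  have hf : Function.Injective f := by
    rintro ⟨i, j⟩ ⟨i', j'⟩ h
    simp only [f, Option.some.injEq, Sigma.mk.injEq] at h
    obtain ⟨rfl, h⟩ := h
    simp only [heq_eq_eq, Fin.mk.injEq, Nat.add_right_cancel_iff] at h
    rw [Fin.ext h]
  have hy : LinearIndependent K y := hli.comp f hf
  rw [hspan, finrank_span_eq_card hy]
  simp

theorem nilradicalPowRank_wedge (hx : ∀ i j, i ≠ j → x i * x j = 0) (hx' : ∀ i, x i ^ n i = 0)
    (hli : LinearIndependent K (wedgeMonomial n x))
    (hsp : ⊤ ≤ Submodule.span K (Set.range (wedgeMonomial n x))) (k : ℕ) :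
    nilradicalPowRank K S (k + 1) = ∑ i, (n i - (k + 1)) := by
  rw [nilradicalPowRank, restrictScalars_nilradical_eq hx' hli hsp, powSpan_one_pow x hx,
    finrank_powSpan hx' hli]

end Wedge

/-! ## Split symmetric algebras -/

/-- A symmetrizing trace form on an algebra, all of whose simple modules are one-dimensional,
together with the characters on the simple modules and a corresponding complete set of orthogonal
idempotents. -/
structure SplitSymmetric (K A ι : Type*) [Field K] [Ring A] [Algebra K A] [Fintype ι]
    [DecidableEq ι] where
  /-- the idempotents -/
  e : ι → A
  /-- the characters -/
  χ : ι → A →ₐ[K] K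
  /-- the trace form -/
  φ : A →ₗ[K] K
  φ_comm (a b : A) : φ (a * b) = φ (b * a)
  φ_nondegenerate (a : A) : (∀ b, φ (b * a) = 0) → a = 0
  sum_e : ∑ i, e i = 1
  e_mul_e (i j : ι) : e i * e j = if i = j then e i else 0
  χ_e (i j : ι) : χ i (e j) = if i = j then 1 else 0
  mem_span_nilpotent (a : A) : (∀ i, χ i a = 0) → a ∈ Submodule.span K {u | IsNilpotent u}

namespace SplitSymmetric

open AlgBimodule

variable {K A : Type u} {ι : Type*} [Field K] [Ring A] [Algebra K A] [Fintype ι] [DecidableEq ι]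
  (S : SplitSymmetric K A ι)

theorem χ_sub (i : ι) (a : A) : S.χ i (a - ∑ j, S.χ j a • S.e j) = 0 := by
  simp [map_sub, map_sum, S.χ_e]

/-- The common kernel of the characters is spanned by nilpotents, and on nilpotents the trace
criterion applies. -/
theorem φ_eq_zero_of_mem {z : Subalgebra.center K A} (hz : z ∈ decomposableIdeal K A) {a : A}
    (ha : ∀ i, S.χ i a = 0) : S.φ (z * a) = 0 := by
  have h : ∀ a ∈ Submodule.span K {u : A | IsNilpotent u}, S.φ (z * a) = 0 := by
    intro a ha
    induction ha using Submodule.span_induction with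
    | mem u hu =>
      have h := Decomposable.apply_mul_eq_zero hz S.φ S.φ_comm hu
      rw [S.φ_comm]
      refine Eq.trans ?_ h
      change _ = S.φ (u * ((z : A) * 1))
      rw [mul_one]
    | zero => rw [mul_zero, map_zero]
    | add a b _ _ ha hb => rw [mul_add, map_add, ha, hb, add_zero]
    | smul k a _ ha => rw [mul_smul_comm, map_smul, ha, smul_zero]
  exact h a (S.mem_span_nilpotent a ha)

/-- Such a `z` annihilates the radical, so it lies in the socle. It splits into the pieces `z * e
i`, on each of which `A` acts from both sides through the single character `χ i`. -/
theorem mem_of_φ_eq_zero {z : Subalgebra.center K A}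
    (hz : ∀ a : A, (∀ i, S.χ i a = 0) → S.φ (z * a) = 0) : z ∈ decomposableIdeal K A := by
  -- The common kernel of the characters is an ideal, so the hypothesis applies to all multiples of
  -- `a`, and nondegeneracy upgrades a vanishing form to a vanishing product.
  have hz' (a : A) (ha : ∀ i, S.χ i a = 0) : (z : A) * a = 0 := by
    refine S.φ_nondegenerate _ fun b => ?_
    rw [← mul_assoc, Subalgebra.mem_center_iff.1 z.2, mul_assoc]
    exact hz _ fun i => by rw [map_mul, ha, mul_zero]
  have hza (a : A) : (z : A) * a = ∑ j, S.χ j a • ((z : A) * S.e j) := by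
    have h := hz' _ fun i => S.χ_sub i a
    rw [mul_sub, sub_eq_zero, Finset.mul_sum] at h
    rw [h]
    exact Finset.sum_congr rfl fun j _ => mul_smul_comm _ _ _
  have hr (i : ι) (a : A) : (z : A) * S.e i * a = S.χ i a • ((z : A) * S.e i) := by
    rw [mul_assoc, hza]
    simp [map_mul, S.χ_e]
  have hl (i : ι) (a : A) : a * ((z : A) * S.e i) = S.χ i a • ((z : A) * S.e i) := by
    rw [← mul_assoc, Subalgebra.mem_center_iff.1 z.2 a, mul_assoc, hza]
    simp [map_mul, S.χ_e]
  have hc (i : ι) : (z : A) * S.e i ∈ Subalgebra.center K A :=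
    Subalgebra.mem_center_iff.2 fun a => by rw [hl, hr]
  have hsum : z = ∑ i, (⟨(z : A) * S.e i, hc i⟩ : Subalgebra.center K A) := by
    refine Subtype.ext ?_
    rw [AddSubmonoidClass.coe_finsetSum, ← Finset.mul_sum, S.sum_e, mul_one]
  rw [hsum]
  exact Ideal.sum_mem _ fun i _ => mem_decomposableIdeal_of_character (S.χ i) _ (hl i)

-- The monomials are independent modulo the ideal, and the tests bound the dimension of the quotient
-- by the number of monomials. Hence the monomials form a basis, and the wedge computation applies.
include S in
theorem nilradicalPowRank_stableCenter {κ : Type} [Fintype κ] (n : κ → ℕ)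
    (x : κ → Subalgebra.center K A) (t : Option (Σ i, Fin (n i - 1)) → A)
    (ht : ∀ z : Subalgebra.center K A, (∀ j, S.φ (z * t j) = 0) → z ∈ decomposableIdeal K A)
    (hli : ∀ c : Option (Σ i, Fin (n i - 1)) → K,
      ∑ j, c j • wedgeMonomial n x j ∈ decomposableIdeal K A → ∀ j, c j = 0)
    (hx : ∀ i j, i ≠ j → x i * x j ∈ decomposableIdeal K A)
    (hx' : ∀ i, x i ^ n i ∈ decomposableIdeal K A) (k : ℕ) :
    nilradicalPowRank K (StableCenter K A) (k + 1) = ∑ i, (n i - (k + 1)) := by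
  let π : Subalgebra.center K A →ₐ[K] StableCenter K A := Ideal.Quotient.mkₐ K _
  have hπ (z) : π z = 0 ↔ z ∈ decomposableIdeal K A := Ideal.Quotient.eq_zero_iff_mem
  have hy : wedgeMonomial n (fun i => π (x i)) = π ∘ wedgeMonomial n x := by
    funext j
    cases j with
    | none => exact (map_one π).symm
    | some j => exact (map_pow π _ _).symm
  have hli' : LinearIndependent K (wedgeMonomial n fun i => π (x i)) := by
    rw [Fintype.linearIndependent_iff]
    intro c hc
    refine hli c ((hπ _).1 ?_)
    rw [map_sum, ← hc, hy]
    simp only [map_smul, Function.comp_apply]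
  -- An element on which all tests vanish is decomposable, so the stable centre is a quotient of the
  -- image of `ev`. This also proves its finiteness.
  let ev : Subalgebra.center K A →ₗ[K] (Option (Σ i, Fin (n i - 1)) → K) :=
    LinearMap.pi fun j => S.φ ∘ₗ LinearMap.mulRight K (t j) ∘ₗ
      (Subalgebra.center K A).val.toLinearMap
  have hev : LinearMap.ker ev ≤ LinearMap.ker π.toLinearMap := fun z hz =>
    (hπ z).2 (ht z fun j => congrFun (LinearMap.mem_ker.1 hz) j)
  let q : (Subalgebra.center K A ⧸ LinearMap.ker ev) →ₗ[K] StableCenter K A :=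
    (LinearMap.ker ev).liftQ π.toLinearMap hev
  have hq : Function.Surjective q := fun z => by
    obtain ⟨z, rfl⟩ := Ideal.Quotient.mk_surjective z
    exact ⟨Submodule.Quotient.mk z, rfl⟩
  have : Module.Finite K (Subalgebra.center K A ⧸ LinearMap.ker ev) :=
    Module.Finite.equiv ev.quotKerEquivRange.symm
  have hfin : Module.Finite K (StableCenter K A) := Module.Finite.of_surjective q hq
  have hle : Module.finrank K (StableCenter K A) ≤ Fintype.card (Option (Σ i, Fin (n i - 1))) :=
    calc Module.finrank K (StableCenter K A)
        ≤ Module.finrank K (Subalgebra.center K A ⧸ LinearMap.ker ev) :=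
          LinearMap.finrank_le_finrank_of_surjective hq
      _ = Module.finrank K (LinearMap.range ev) := ev.quotKerEquivRange.finrank_eq
      _ ≤ Module.finrank K (Option (Σ i, Fin (n i - 1)) → K) := Submodule.finrank_le _
      _ = _ := Module.finrank_fintype_fun_eq_card K
  have hsp := hli'.span_eq_top_of_card_eq_finrank'
    (le_antisymm hli'.fintype_card_le_finrank hle)
  refine nilradicalPowRank_wedge (fun i j hij => ?_) (fun i => ?_) hli' hsp.ge k
  · rw [← map_mul]
    exact (hπ _).2 (hx i j hij)
  · rw [← map_pow]
    exact (hπ _).2 (hx' i)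

end SplitSymmetric

/-- At `k + 1 = a` one side is zero, whence `a' ≤ a`, and symmetrically. With `a = a'` cancelled, `k
+ 1 = b` and `k + 1 = b'` compare `b` with `b'`, and the total at `k = 0` then gives `c = c'`. -/
theorem eq_of_sum_sub_eq {a b c a' b' c' : ℕ} (hab : b ≤ a) (hbc : c ≤ b) (hc : 1 ≤ c)
    (hab' : b' ≤ a') (hbc' : c' ≤ b') (hc' : 1 ≤ c')
    (h : ∀ k, (a - (k + 1)) + (b - (k + 1)) + (c - (k + 1)) =
      (a' - (k + 1)) + (b' - (k + 1)) + (c' - (k + 1))) : a = a' ∧ b = b' ∧ c = c' := by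
  have h0 := h 0
  have h1 := h (a - 1)
  have h2 := h (a' - 1)
  have h3 := h (b - 1)
  have h4 := h (b' - 1)
  have ha : a = a' := by omega
  have hb : b = b' := by omega
  omega

section Weight

/-! ## Gorenstein quotients of monoid algebras -/

variable {K : Type u} {M : Type} [Field K]

/-- The linear form on a monoid algebra with given values on the monomials. -/
noncomputable def weightFormAux (w : M → K) : AddMonoidAlgebra K M →ₗ[K] K :=
  Finsupp.linearCombination K w ∘ₗ (AddMonoidAlgebra.coeffLinearEquiv K).toLinearMap

theorem weightFormAux_single (w : M → K) (m : M) (k : K) :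
    weightFormAux w (AddMonoidAlgebra.single m k) = k * w m := by
  simp [weightFormAux, AddMonoidAlgebra.coeffLinearEquiv]

variable [AddCommMonoid M]

/-- The largest ideal in the kernel of the linear form. -/
noncomputable def weightIdeal (w : M → K) : Ideal (AddMonoidAlgebra K M) where
  carrier := {f | ∀ g, weightFormAux w (f * g) = 0}
  zero_mem' g := by rw [zero_mul, map_zero]
  add_mem' hf hg h := by rw [add_mul, map_add, hf, hg, add_zero]
  smul_mem' c f hf g := by
    change weightFormAux w (c * f * g) = 0
    rw [mul_comm c, mul_assoc]
    exact hf _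

/-- The quotient of the monoid algebra by the largest ideal in the kernel of the linear form. -/
abbrev WeightRing (w : M → K) : Type u := AddMonoidAlgebra K M ⧸ weightIdeal w

/-- The linear form on the quotient. -/
noncomputable def weightForm (w : M → K) : WeightRing w →ₗ[K] K :=
  ((weightIdeal w).restrictScalars K).liftQ (weightFormAux w) (fun f hf => by
    have h := (show f ∈ weightIdeal w from hf) 1
    rwa [mul_one] at h) ∘ₗ (Submodule.Quotient.restrictScalarsEquiv K (weightIdeal w)).symm.toLinearMap

/-- The monomials in the quotient. -/
noncomputable def weightMonomial (w : M → K) (m : M) : WeightRing w :=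
  Ideal.Quotient.mk _ (AddMonoidAlgebra.single m 1)

theorem weightForm_monomial (w : M → K) (m : M) : weightForm w (weightMonomial w m) = w m :=
  (weightFormAux_single w m 1).trans (one_mul _)

theorem weightMonomial_mul (w : M → K) (m n : M) :
    weightMonomial w m * weightMonomial w n = weightMonomial w (m + n) := by
  rw [weightMonomial, weightMonomial, ← map_mul, AddMonoidAlgebra.single_mul_single, one_mul]
  rfl

theorem weightMonomial_zero (w : M → K) : weightMonomial w 0 = 1 := rfl

theorem weightMonomial_pow (w : M → K) (m : M) (n : ℕ) :
    weightMonomial w m ^ n = weightMonomial w (n • m) := by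
  induction n with
  | zero => rw [pow_zero, zero_smul, weightMonomial_zero]
  | succ n ih => rw [pow_succ, ih, weightMonomial_mul, succ_nsmul]

/-- Membership in `weightIdeal` needs to be tested only against monomials. Every identity in
`WeightRing` thus becomes an identity between values of `w`. -/
theorem weightMonomial_eq_smul (w : M → K) {m n : M} {k : K}
    (h : ∀ l, w (m + l) = k * w (n + l)) : weightMonomial w m = k • weightMonomial w n := by
  have h1 : weightMonomial w m - k • weightMonomial w n =
      Ideal.Quotient.mk (weightIdeal w) (AddMonoidAlgebra.single m 1 - k • AddMonoidAlgebra.single n 1) := by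
    rw [map_sub]
    rfl
  rw [← sub_eq_zero, h1, Ideal.Quotient.eq_zero_iff_mem]
  intro g
  induction g using AddMonoidAlgebra.induction_linear with
  | zero => rw [mul_zero, map_zero]
  | add f g hf hg => rw [mul_add, map_add, hf, hg, add_zero]
  | single l c =>
    rw [sub_mul, smul_mul_assoc, AddMonoidAlgebra.single_mul_single,
      AddMonoidAlgebra.single_mul_single, map_sub, map_smul, weightFormAux_single,
      weightFormAux_single, h, smul_eq_mul]
    ring

theorem weightMonomial_eq (w : M → K) {m n : M} (h : ∀ l, w (m + l) = w (n + l)) :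
    weightMonomial w m = weightMonomial w n := by
  have := weightMonomial_eq_smul w (m := m) (n := n) (k := 1) fun l => by rw [h, one_mul]
  rwa [one_smul] at this

theorem weightMonomial_eq_zero (w : M → K) {m : M} (h : ∀ l, w (m + l) = 0) :
    weightMonomial w m = 0 := by
  have := weightMonomial_eq_smul w (m := m) (n := m) (k := 0) fun l => by rw [h, zero_mul]
  rwa [zero_smul] at this

end Weight

namespace ArrowQuiver

/-! ## Representations of path algebras -/

variable {K : Type u} [CommRing K] {V E : Type} [Fintype V] (q : ArrowQuiver V E)

/-- A vertex, as an element of the path algebra. -/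
def vertex (K : Type u) [CommRing K] (i : V) : PathAlgebra K q :=
  RingQuot.mkAlgHom K (PathRel K q) (FreeAlgebra.ι K (Sum.inl i))

variable {q}

/-- The universal property of the path algebra. -/
def lift {T : Type*} [Ring T] [Algebra K T] (v : V → T) (x : E → T) (hsum : ∑ i, v i = 1)
    (hidem : ∀ i, v i * v i = v i) (horth : ∀ i j, i ≠ j → v i * v j = 0)
    (hsource : ∀ y, v (q.source y) * x y = x y) (htarget : ∀ y, x y * v (q.target y) = x y) :
    PathAlgebra K q →ₐ[K] T :=
  RingQuot.liftAlgHom K ⟨FreeAlgebra.lift K (Sum.elim v x), by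
    rintro _ _ (_ | i | ⟨i, j, h⟩ | y | y)
    · simpa using hsum
    · simpa using hidem i
    · simpa using horth i j h
    · simpa using hsource y
    · simpa using htarget y⟩

section Lift

variable {T : Type*} [Ring T] [Algebra K T] (v : V → T) (x : E → T) (hsum : ∑ i, v i = 1)
  (hidem : ∀ i, v i * v i = v i) (horth : ∀ i j, i ≠ j → v i * v j = 0)
  (hsource : ∀ y, v (q.source y) * x y = x y) (htarget : ∀ y, x y * v (q.target y) = x y)

@[simp] theorem lift_vertex (i : V) :
    lift v x hsum hidem horth hsource htarget (q.vertex K i) = v i := by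
  simp [lift, vertex]

@[simp] theorem lift_arrow (y : E) :
    lift v x hsum hidem horth hsource htarget (q.arrow K y) = x y := by
  simp [lift, arrow]

end Lift

theorem sum_vertex : ∑ i, q.vertex K i = 1 := by
  have h := RingQuot.mkAlgHom_rel K (PathRel.sum_vertices (K := K) (q := q))
  rwa [map_sum, map_one] at h

theorem vertex_mul_self (i : V) : q.vertex K i * q.vertex K i = q.vertex K i := by
  have h := RingQuot.mkAlgHom_rel K (PathRel.idempotent (K := K) (q := q) i)
  rwa [map_mul] at h

theorem vertex_mul_of_ne {i j : V} (hij : i ≠ j) : q.vertex K i * q.vertex K j = 0 := by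
  have h := RingQuot.mkAlgHom_rel K (PathRel.orthogonal (K := K) (q := q) i j hij)
  rwa [map_mul, map_zero] at h

theorem source_mul_arrow (y : E) : q.vertex K (q.source y) * q.arrow K y = q.arrow K y := by
  have h := RingQuot.mkAlgHom_rel K (PathRel.source_mul (K := K) (q := q) y)
  rwa [map_mul] at h

theorem arrow_mul_target (y : E) : q.arrow K y * q.vertex K (q.target y) = q.arrow K y := by
  have h := RingQuot.mkAlgHom_rel K (PathRel.mul_target (K := K) (q := q) y)
  rwa [map_mul] at h

theorem mem_of_surjective {A : Type*} [Ring A] [Algebra K A] (f : PathAlgebra K q →ₐ[K] A)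
    (hf : Function.Surjective f) (W : Submodule K A) (h1 : 1 ∈ W)
    (hv : ∀ i, ∀ a ∈ W, f (q.vertex K i) * a ∈ W) (hx : ∀ y, ∀ a ∈ W, f (q.arrow K y) * a ∈ W)
    (a : A) : a ∈ W := by
  have h (p : FreeAlgebra K (V ⊕ E)) :
      ∀ a ∈ W, f (RingQuot.mkAlgHom K (PathRel K q) p) * a ∈ W := by
    induction p using FreeAlgebra.induction with
    | grade0 r =>
      intro a ha
      rw [AlgHom.commutes, AlgHom.commutes, ← Algebra.smul_def]
      exact W.smul_mem r ha
    | grade1 y =>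
      cases y with
      | inl i => exact hv i
      | inr y => exact hx y
    | mul p p' hp hp' =>
      intro a ha
      rw [map_mul, map_mul, mul_assoc]
      exact hp _ (hp' _ ha)
    | add p p' hp hp' =>
      intro a ha
      rw [map_add, map_add, add_mul]
      exact W.add_mem (hp _ ha) (hp' _ ha)
  obtain ⟨b, rfl⟩ := hf a
  obtain ⟨p, rfl⟩ := RingQuot.mkAlgHom_surjective K (PathRel K q) b
  simpa using h p 1 h1

variable [DecidableEq V]

/-- The representation of the path algebra by matrices over a commutative algebra which maps
every arrow to a multiple of a matrix unit. -/
def matrixRep {R : Type*} [CommRing R] [Algebra K R] (x : E → R) :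
    PathAlgebra K q →ₐ[K] Matrix V V R :=
  lift (fun i => Matrix.single i i 1) (fun y => Matrix.single (q.source y) (q.target y) (x y))
    (by
      ext i j
      by_cases h : i = j
      · subst h; simp [Matrix.sum_apply, Matrix.single_apply]
      · simp [Matrix.sum_apply, Matrix.single_apply, h]
        rw [Finset.card_eq_zero.2, Nat.cast_zero]
        exact Finset.filter_eq_empty_iff.2 fun x _ hx => h (hx.1.symm.trans hx.2))
    (fun i => by simp) (fun i j h => by simp [h]) (fun y => by simp) (fun y => by simp)

/-- The character of the path algebra which is given by a vertex. -/
def character (q : ArrowQuiver V E) (K : Type u) [CommRing K] (i : V) : PathAlgebra K q →ₐ[K] K :=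
  lift (fun j => if i = j then 1 else 0) (fun _ => 0) (by simp) (fun j => by by_cases h : i = j <;> simp [h])
    (fun j j' h => by
      by_cases hi : i = j
      · simp [show i ≠ j' from fun h' => h (hi.symm.trans h')]
      · simp [hi])
    (fun y => by simp) (fun y => by simp)

end ArrowQuiver

/-- The equations are solved in the order of increasing height. The conclusion is `c t • u t = 0`
instead of `c t = 0`, so that infinite families with vanishing members are allowed. -/
theorem smul_eq_zero_of_triangular {K V T : Type*} [Field K] [AddCommGroup V] [Module K V]
    (u : T → V) (f : T → V →ₗ[K] K) (h : T → ℕ)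
    (hu : ∀ t, u t ≠ 0 → f t (u t) ≠ 0 ∧ ∀ t', f t (u t') ≠ 0 → t' = t ∨ h t' < h t)
    (c : T →₀ K) (hc : ∀ t, u t ≠ 0 → f t (Finsupp.linearCombination K u c) = 0) (t : T) :
    c t • u t = 0 := by
  induction hn : h t using Nat.strong_induction_on generalizing t with
  | _ n ih =>
    by_cases ht : u t = 0
    · rw [ht, smul_zero]
    obtain ⟨h1, h2⟩ := hu t ht
    have h3 := hc t ht
    rw [Finsupp.linearCombination_apply, Finsupp.sum, map_sum, Finset.sum_eq_single t] at h3
    · rw [map_smul, smul_eq_zero, or_iff_left h1] at h3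
      rw [h3, zero_smul]
    · intro t' _ ht'
      by_cases h4 : f t (u t') = 0
      · rw [map_smul, h4, smul_zero]
      · have h5 := (h2 t' h4).resolve_left ht'
        rw [ih (h t') (hn ▸ h5) t' rfl, map_zero]
    · intro h4
      rw [Finsupp.notMem_support_iff.1 h4, zero_smul, map_zero]

theorem Matrix.diagonal_mul_single {V R : Type*} [Fintype V] [DecidableEq V] [Semiring R]
    (d : V → R) (i j : V) (x : R) :
    Matrix.diagonal d * Matrix.single i j x = Matrix.single i j (d i * x) := by
  ext k l
  rw [Matrix.diagonal_mul, Matrix.single_apply, Matrix.single_apply]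
  by_cases h : i = k ∧ j = l
  · rw [if_pos h, if_pos h, h.1]
  · rw [if_neg h, if_neg h, mul_zero]

theorem Matrix.single_mul_diagonal {V R : Type*} [Fintype V] [DecidableEq V] [Semiring R]
    (d : V → R) (i j : V) (x : R) :
    Matrix.single i j x * Matrix.diagonal d = Matrix.single i j (x * d j) := by
  ext k l
  rw [Matrix.mul_diagonal, Matrix.single_apply, Matrix.single_apply]
  by_cases h : i = k ∧ j = l
  · rw [if_pos h, if_pos h, h.2]
  · rw [if_neg h, if_neg h, zero_mul]

section Path

/-! ## Matrices of monomials -/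

/-- The image of `x` is the matrix unit at `i`, `j`, multiplied by the monomial `m`. -/
def IsMonomialAt {K : Type u} {M : Type} {V B : Type*} [Field K] [AddCommMonoid M] [Fintype V]
    [DecidableEq V] [Ring B] [Algebra K B] {w : M → K}
    (ρ : B →ₐ[K] Matrix V V (WeightRing w)) (x : B) (i j : V) (m : M) : Prop :=
  ρ x = Matrix.single i j (weightMonomial w m)

/-- The trace form of a representation by matrices. -/
noncomputable def traceForm {K : Type u} {M : Type} {V B : Type*} [Field K] [AddCommMonoid M]
    [Fintype V] [DecidableEq V] [Ring B] [Algebra K B] {w : M → K}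
    (ρ : B →ₐ[K] Matrix V V (WeightRing w)) : B →ₗ[K] K :=
  weightForm w ∘ₗ Matrix.traceLinearMap V K (WeightRing w) ∘ₗ ρ.toLinearMap

variable {K : Type u} {M : Type} {V B : Type*} [Field K] [AddCommMonoid M] [Fintype V]
  [DecidableEq V] [Ring B] [Algebra K B]
  {w : M → K} {ρ : B →ₐ[K] Matrix V V (WeightRing w)}

theorem traceForm_apply (x : B) : traceForm ρ x = weightForm w (ρ x).trace := rfl

theorem traceForm_mul_comm (x y : B) : traceForm ρ (x * y) = traceForm ρ (y * x) := by
  rw [traceForm_apply, map_mul, Matrix.trace_mul_comm, ← map_mul, traceForm_apply]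

namespace IsMonomialAt

variable {x y : B} {i j k l : V} {m n : M}

theorem mul (hx : IsMonomialAt ρ x i j m) (hy : IsMonomialAt ρ y j k n) :
    IsMonomialAt ρ (x * y) i k (m + n) := by
  rw [IsMonomialAt, map_mul, hx, hy, Matrix.single_mul_single_same, weightMonomial_mul]

theorem pow_mul (hx : IsMonomialAt ρ x i i m) (hy : IsMonomialAt ρ y i j n) (r : ℕ) :
    IsMonomialAt ρ (x ^ r * y) i j (r • m + n) := by
  induction r with
  | zero => rwa [pow_zero, one_mul, zero_smul, zero_add]
  | succ r ih => rw [pow_succ', mul_assoc, succ_nsmul', add_assoc]; exact hx.mul ih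

theorem pow (hx : IsMonomialAt ρ x i i m) (r : ℕ) :
    IsMonomialAt ρ (x ^ (r + 1)) i i ((r + 1) • m) := by
  rw [pow_succ, succ_nsmul]
  exact hx.pow_mul hx r

theorem congr (hx : IsMonomialAt ρ x i j m) (h : m = n) : IsMonomialAt ρ x i j n := h ▸ hx

theorem map_eq_map (hx : IsMonomialAt ρ x i j m) (hy : IsMonomialAt ρ y i j n)
    (h : ∀ l, w (m + l) = w (n + l)) : ρ x = ρ y := by
  rw [hx, hy, weightMonomial_eq w h]

theorem map_eq_zero (hx : IsMonomialAt ρ x i j m) (h : ∀ l, w (m + l) = 0) : ρ x = 0 := by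
  rw [hx, weightMonomial_eq_zero w h, Matrix.single_zero]

theorem traceForm_eq (hx : IsMonomialAt ρ x i i m) : traceForm ρ x = w m := by
  rw [traceForm_apply, hx, Matrix.trace_single_eq_same, weightForm_monomial]

theorem traceForm_mul (hx : IsMonomialAt ρ x i j m) (hy : IsMonomialAt ρ y j i n) :
    traceForm ρ (x * y) = w (m + n) := (hx.mul hy).traceForm_eq

theorem diagonal_mul {z : B} {d : V → WeightRing w} (hz : ρ z = Matrix.diagonal d)
    (hx : IsMonomialAt ρ x i i m) :
    traceForm ρ (z * x) = weightForm w (d i * weightMonomial w m) := by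
  rw [traceForm_apply, map_mul, hz, hx, Matrix.diagonal_mul_single, Matrix.trace_single_eq_same]

end IsMonomialAt

end Path

/-! ### Peirce components on which a trace form is nondegenerate -/

section Blocks

/-- Spanning sets of the Peirce components of an algebra which is represented by matrices, on
which the trace form is nondegenerate. -/
structure PeirceSpanning (K A : Type u) {M : Type} (V T : Type) [Field K] [Ring A] [Algebra K A]
    [AddCommMonoid M] [Fintype V] [DecidableEq V] (w : M → K) where
  /-- the idempotents -/
  e : V → A
  /-- the characters -/
  χ : V → A →ₐ[K] K
  /-- the representation -/
  ρ : A →ₐ[K] Matrix V V (WeightRing w)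
  /-- the spanning sets -/
  u : V → V → Option T → A
  sum_e : ∑ i, e i = 1
  e_mul_e (i j : V) : e i * e j = if i = j then e i else 0
  χ_e (i j : V) : χ i (e j) = if i = j then 1 else 0
  u_none (i j : V) : u i j none = if i = j then e i else 0
  mem_span (a : A) (i j : V) : e i * a * e j ∈ Submodule.span K (Set.range (u i j))
  nilpotent (i : V) (t : T) : IsNilpotent (u i i (some t))
  finite (i j : V) : {t | u i j (some t) ≠ 0}.Finite
  /-- the elements which test for the members of the spanning sets -/
  v : V → V → Option T → A
  /-- the order in which the coefficients are found -/
  height : V → V → Option T → ℕ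
  triangular (i j : V) (t : Option T) : u i j t ≠ 0 → traceForm ρ (v i j t * u i j t) ≠ 0 ∧
    ∀ t', traceForm ρ (v i j t * u i j t') ≠ 0 → t' = t ∨ height i j t' < height i j t

namespace PeirceSpanning

open AlgBimodule

variable {K A : Type u} {M : Type} {V T : Type} [Field K] [Ring A] [Algebra K A]
    [AddCommMonoid M] [Fintype V] [DecidableEq V] {w : M → K} (S : PeirceSpanning K A V T w)

theorem eq_sum (a : A) : a = ∑ i, ∑ j, S.e i * a * S.e j := by
  simp_rw [← Finset.mul_sum, S.sum_e, mul_one, ← Finset.sum_mul, S.sum_e, one_mul]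

/-- By cyclicity of the trace, pairing a test with a Peirce component of `a` is pairing an element
of the algebra with `a`. Triangularity then kills the component term by term. -/
theorem traceForm_nondegenerate (a : A) (h : ∀ b, traceForm S.ρ (b * a) = 0) : a = 0 := by
  rw [S.eq_sum a]
  refine Finset.sum_eq_zero fun i _ => Finset.sum_eq_zero fun j _ => ?_
  obtain ⟨c, hc⟩ := (Finsupp.mem_span_range_iff_exists_finsupp).1 (S.mem_span a i j)
  rw [← hc]
  refine Finset.sum_eq_zero fun t _ => ?_
  refine smul_eq_zero_of_triangular (S.u i j)
    (fun t => traceForm S.ρ ∘ₗ LinearMap.mulLeft K (S.v i j t)) (S.height i j) (S.triangular i j) c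
    (fun t _ => ?_) t
  rw [Finsupp.linearCombination_apply, hc]
  change traceForm S.ρ (S.v i j t * (S.e i * a * S.e j)) = 0
  rw [← mul_assoc, traceForm_mul_comm, ← mul_assoc, ← mul_assoc, h]

theorem ρ_injective : Function.Injective S.ρ := by
  rw [injective_iff_map_eq_zero]
  intro a ha
  refine S.traceForm_nondegenerate a fun b => ?_
  rw [traceForm_apply, map_mul, ha, mul_zero, Matrix.trace_zero, map_zero]

theorem χ_u (i : V) (t : T) : S.χ i (S.u i i (some t)) = 0 :=
  ((S.nilpotent i t).map (S.χ i)).eq_zero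

/-- The remaining spanning elements of a diagonal component are nilpotent and vanish under `χ i`, so
the coefficient of the idempotent is `χ i a = 0`. -/
theorem mem_span_some (a : A) (ha : ∀ i, S.χ i a = 0) (i j : V) :
    S.e i * a * S.e j ∈ Submodule.span K (Set.range fun t => S.u i j (some t)) := by
  have h := S.mem_span a i j
  rw [show Set.range (S.u i j) = insert (S.u i j none) (Set.range fun t => S.u i j (some t)) from
    Option.range_eq _, Submodule.mem_span_insert, S.u_none] at h
  obtain ⟨k, z, hz, h⟩ := h
  by_cases hij : i = j
  · subst hij
    have h1 := congrArg (S.χ i) h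
    have h2 : S.χ i z = 0 := by
      have : Submodule.span K (Set.range fun t => S.u i i (some t)) ≤
          LinearMap.ker (S.χ i).toLinearMap := by
        refine Submodule.span_le.2 ?_
        rintro _ ⟨t, rfl⟩
        exact S.χ_u i t
      exact this hz
    rw [if_pos rfl, map_mul, map_mul, ha, mul_zero, zero_mul, map_add, h2, map_smul, S.χ_e,
      if_pos rfl, add_zero, smul_eq_mul, mul_one] at h1
    rw [h, ← h1, zero_smul, zero_add]
    exact hz
  · rw [h, if_neg hij, smul_zero, zero_add]
    exact hz

/-- The trace form and the characters. -/
noncomputable def splitSymmetric : SplitSymmetric K A V where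
  e := S.e
  χ := S.χ
  φ := traceForm S.ρ
  φ_comm := traceForm_mul_comm
  φ_nondegenerate := S.traceForm_nondegenerate
  sum_e := S.sum_e
  e_mul_e := S.e_mul_e
  χ_e := S.χ_e
  mem_span_nilpotent a ha := by
    rw [S.eq_sum a]
    refine Submodule.sum_mem _ fun i _ => Submodule.sum_mem _ fun j _ => ?_
    by_cases hij : i = j
    · subst hij
      refine Submodule.span_mono ?_ (S.mem_span_some a ha i i)
      rintro _ ⟨t, rfl⟩
      exact S.nilpotent i t
    -- Off the diagonal the element squares to zero, since `e j * e i = 0`.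
    · refine Submodule.subset_span ⟨2, ?_⟩
      rw [pow_two, mul_assoc, ← mul_assoc (S.e j), ← mul_assoc (S.e j), S.e_mul_e,
        if_neg (Ne.symm hij), zero_mul, zero_mul, mul_zero]

include S in
theorem moduleFinite : Module.Finite K A := by
  have hf (i j : V) : (Set.range (S.u i j)).Finite := by
    refine (((S.finite i j).image fun t => S.u i j (some t)).union
      (Set.toFinite {0, S.u i j none})).subset ?_
    rintro _ ⟨t, rfl⟩
    cases t with
    | none => exact Or.inr (Or.inr rfl)
    | some t =>
      by_cases h : S.u i j (some t) = 0
      · exact Or.inr (Or.inl h)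
      · exact Or.inl ⟨t, h, rfl⟩
  refine ⟨Submodule.fg_def.2 ⟨⋃ i, ⋃ j, Set.range (S.u i j),
    Set.finite_iUnion fun i => Set.finite_iUnion fun j => hf i j, ?_⟩⟩
  refine eq_top_iff.2 fun a _ => ?_
  rw [S.eq_sum a]
  refine Submodule.sum_mem _ fun i _ => Submodule.sum_mem _ fun j _ => ?_
  refine Submodule.span_mono ?_ (S.mem_span a i j)
  exact Set.subset_iUnion_of_subset i (Set.subset_iUnion_of_subset j subset_rfl)

/-- A central element has no trace against off-diagonal Peirce components, so it suffices to test
against the non-idempotent spanning elements at each vertex. -/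
theorem mem_decomposableIdeal (z : Subalgebra.center K A)
    (hz : ∀ i t, traceForm S.ρ (z * S.u i i (some t)) = 0) : z ∈ decomposableIdeal K A := by
  refine S.splitSymmetric.mem_of_φ_eq_zero fun a ha => ?_
  change traceForm S.ρ _ = 0
  rw [S.eq_sum a, Finset.mul_sum, map_sum]
  refine Finset.sum_eq_zero fun i _ => ?_
  rw [Finset.mul_sum, map_sum]
  refine Finset.sum_eq_zero fun j _ => ?_
  by_cases hij : i = j
  · subst hij
    have h : Submodule.span K (Set.range fun t => S.u i i (some t)) ≤
        LinearMap.ker (traceForm S.ρ ∘ₗ LinearMap.mulLeft K (z : A)) := by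
      refine Submodule.span_le.2 ?_
      rintro _ ⟨t, rfl⟩
      exact hz i t
    exact h (S.mem_span_some a ha i i)
  · rw [← mul_assoc, traceForm_mul_comm, ← mul_assoc, ← mul_assoc,
      Subalgebra.mem_center_iff.1 z.2, mul_assoc (z : A), S.e_mul_e, if_neg (Ne.symm hij), mul_zero,
      zero_mul, map_zero]

end PeirceSpanning

end Blocks

/-! ### Spanning sets and central elements, checked on vertices and arrows -/

namespace ArrowQuiver

variable {K A : Type u} {V E : Type} [Fintype V] [Field K] [Ring A] [Algebra K A] [DecidableEq V]
  {q : ArrowQuiver V E}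
  {f : PathAlgebra K q →ₐ[K] A}

/-- Every element is built from `1` by left multiplications by vertices and arrows, so it is enough
that left multiplication by an arrow respects the proposed spans. -/
theorem mem_span_of_surjective {T : Type*} (hf : Function.Surjective f)
    (u : V → V → Option T → A) (hu : ∀ i, u i i none = f (q.vertex K i))
    (h : ∀ y j t, f (q.arrow K y) * u (q.target y) j t ∈
      Submodule.span K (Set.range (u (q.source y) j))) (a : A) (i j : V) :
    f (q.vertex K i) * a * f (q.vertex K j) ∈ Submodule.span K (Set.range (u i j)) := by
  let W : Submodule K A := ⨅ i, ⨅ j, (Submodule.span K (Set.range (u i j))).comap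
    (LinearMap.mulRight K (f (q.vertex K j)) ∘ₗ LinearMap.mulLeft K (f (q.vertex K i)))
  have hW (a : A) : a ∈ W ↔ ∀ i j, f (q.vertex K i) * a * f (q.vertex K j) ∈
      Submodule.span K (Set.range (u i j)) := by
    simp [W]
  refine (hW a).1 (mem_of_surjective f hf W ((hW 1).2 fun i j => ?_) (fun k a ha => (hW _).2 ?_)
    (fun y a ha => (hW _).2 ?_) a) i j
  · rw [mul_one, ← map_mul]
    by_cases hij : i = j
    · subst hij
      rw [vertex_mul_self, ← hu]
      exact Submodule.subset_span ⟨none, rfl⟩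
    · rw [vertex_mul_of_ne hij, map_zero]
      exact Submodule.zero_mem _
  · intro i j
    rw [← mul_assoc, ← map_mul]
    by_cases hik : i = k
    · subst hik
      rw [vertex_mul_self]
      exact (hW a).1 ha i j
    · rw [vertex_mul_of_ne hik, map_zero, zero_mul, zero_mul]
      exact Submodule.zero_mem _
  · intro i j
    rw [← mul_assoc, ← map_mul, ← source_mul_arrow, ← mul_assoc]
    by_cases hi : i = q.source y
    · subst hi
      rw [vertex_mul_self, source_mul_arrow, ← arrow_mul_target, map_mul, mul_assoc, mul_assoc,
        ← mul_assoc (f (q.vertex K _))]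
      have h1 : Submodule.span K (Set.range (u (q.target y) j)) ≤
          (Submodule.span K (Set.range (u (q.source y) j))).comap
            (LinearMap.mulLeft K (f (q.arrow K y))) := by
        refine Submodule.span_le.2 ?_
        rintro _ ⟨t, rfl⟩
        exact h y j t
      exact h1 ((hW a).1 ha _ j)
    · rw [vertex_mul_of_ne hi, zero_mul, map_zero, zero_mul, zero_mul]
      exact Submodule.zero_mem _

@[simp] theorem matrixRep_vertex {R : Type*} [CommRing R] [Algebra K R] (x : E → R) (i : V) :
    matrixRep x (q.vertex K i) = Matrix.single i i 1 :=
  lift_vertex ..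

@[simp] theorem matrixRep_arrow {R : Type*} [CommRing R] [Algebra K R] (x : E → R) (y : E) :
    matrixRep x (q.arrow K y) = Matrix.single (q.source y) (q.target y) (x y) :=
  lift_arrow ..

@[simp] theorem character_vertex (i j : V) :
    character q K i (q.vertex K j) = if i = j then 1 else 0 :=
  lift_vertex ..

@[simp] theorem character_arrow (i : V) (y : E) : character q K i (q.arrow K y) = 0 :=
  lift_arrow ..

/-- Faithfulness of the representation reduces centrality to matrices. A diagonal matrix commutes
with the vertices automatically, and with an arrow when its two end entries agree after
multiplication by the arrow. -/
theorem mem_center_of_surjective (hf : Function.Surjective f) {R : Type*} [CommRing R]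
    [Algebra K R] {ρ : A →ₐ[K] Matrix V V R} (hρ : Function.Injective ρ) {x : E → R}
    (hx : ∀ a, ρ (f a) = matrixRep x a) {d : V → R} {z : A} (hz : ρ z = Matrix.diagonal d)
    (hd : ∀ y, d (q.source y) * x y = x y * d (q.target y)) : z ∈ Subalgebra.center K A := by
  have h1 (y : E) : z * f (q.arrow K y) = f (q.arrow K y) * z := by
    refine hρ ?_
    rw [map_mul, map_mul, hz, hx]
    rw [matrixRep_arrow, Matrix.diagonal_mul_single, Matrix.single_mul_diagonal, hd]
  have h2 (i : V) : z * f (q.vertex K i) = f (q.vertex K i) * z := by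
    refine hρ ?_
    rw [map_mul, map_mul, hz, hx]
    rw [matrixRep_vertex, Matrix.diagonal_mul_single, Matrix.single_mul_diagonal, mul_comm]
  refine Subalgebra.mem_center_iff.2 fun a => Eq.symm ?_
  refine sub_eq_zero.1 (mem_of_surjective f hf
    (LinearMap.ker (LinearMap.mulLeft K z - LinearMap.mulRight K z)) ?_ ?_ ?_ a)
  · simp
  · intro i a ha
    have ha' : z * a - a * z = 0 := ha
    change z * (f (q.vertex K i) * a) - f (q.vertex K i) * a * z = 0
    rw [← mul_assoc, h2, mul_assoc, mul_assoc, ← mul_sub, ha', mul_zero]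
  · intro y a ha
    have ha' : z * a - a * z = 0 := ha
    change z * (f (q.arrow K y) * a) - f (q.arrow K y) * a * z = 0
    rw [← mul_assoc, h1, mul_assoc, mul_assoc, ← mul_sub, ha', mul_zero]

end ArrowQuiver

/-! ### Consequences of the relations of type `3K` -/

theorem mul_mul_pow_eq {A : Type*} [Monoid A] (x y : A) (n : ℕ) :
    x * (y * x) ^ n = (x * y) ^ n * x := by
  induction n with
  | zero => rw [pow_zero, pow_zero, mul_one, one_mul]
  | succ n ih => rw [pow_succ, ← mul_assoc, ih, mul_assoc, pow_succ, mul_assoc, mul_assoc]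

theorem mul_mul_eq_zero_of_assoc {A : Type*} [Ring A] {x y z : A} (h : x * y * z = 0) :
    x * (y * z) = 0 := by
  rw [← mul_assoc, h]

theorem mul_mul_mul_eq_zero_of_assoc {A : Type*} [Ring A] {x y z : A} (h : x * y * z = 0) (t : A) :
    x * (y * (z * t)) = 0 := by
  rw [← mul_assoc, ← mul_assoc, h, zero_mul]

/-- The relations of `Q(3K)^{p+2,q+2,r+1}`. -/
structure Relations3K {A : Type*} [Ring A] (p q r : ℕ) (β γ δ η l κ : A) : Prop where
  βδ : β * δ = (κ * l) ^ (p + 1) * κ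
  ηγ : η * γ = (l * κ) ^ (p + 1) * l
  δl : δ * l = (γ * β) ^ (q + 1) * γ
  κη : κ * η = (β * γ) ^ (q + 1) * β
  lβ : l * β = (η * δ) ^ r * η
  γκ : γ * κ = (δ * η) ^ r * δ
  γβδ : γ * β * δ = 0
  δηγ : δ * η * γ = 0
  lκη : l * κ * η = 0

namespace Relations3K

variable {A : Type*} [Ring A] {p q r : ℕ} {β γ δ η l κ : A}
  (h : Relations3K p q r β γ δ η l κ)
include h

/-- Replacing two consecutive sides of the triangle by a path along a two-cycle exposes a factor
already known to vanish. In this way the three given zero relations produce this one and the next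
four. -/
theorem βδη : β * δ * η = 0 := by
  rw [h.βδ, pow_succ]
  simp only [mul_assoc, mul_mul_eq_zero_of_assoc h.lκη, mul_zero]

theorem ηγβ : η * γ * β = 0 := by
  rw [h.ηγ, mul_assoc, h.lβ, ← mul_mul_pow_eq, pow_succ]
  simp only [mul_assoc, mul_mul_mul_eq_zero_of_assoc h.lκη, mul_zero]

theorem δlκ : δ * l * κ = 0 := by
  rw [h.δl, mul_assoc, h.γκ, ← mul_mul_pow_eq, pow_succ]
  simp only [mul_assoc, mul_mul_mul_eq_zero_of_assoc h.γβδ, mul_zero]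

theorem κηδ : κ * η * δ = 0 := by
  rw [h.κη, pow_succ]
  simp only [mul_assoc, mul_mul_eq_zero_of_assoc h.γβδ, mul_zero]

theorem ηδl : η * δ * l = 0 := by
  rw [mul_assoc, h.δl, pow_succ']
  simp only [mul_assoc, mul_mul_mul_eq_zero_of_assoc h.ηγβ]

theorem lβγβ : l * β * γ * β = 0 := by
  rw [h.lβ]
  simp only [mul_assoc, mul_mul_eq_zero_of_assoc h.ηγβ, mul_zero]

theorem γκlκ : γ * κ * l * κ = 0 := by
  rw [h.γκ]
  simp only [mul_assoc, mul_mul_eq_zero_of_assoc h.δlκ, mul_zero]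

/-- The case `r = 0` is special here and in `γκl`: then `λβ = η` and `γκ = δ`, so `δ` and `η` are
redundant arrows and these paths need not vanish. -/
theorem lβγ : l * β * γ = if r = 0 then (l * κ) ^ (p + 1) * l else 0 := by
  rw [h.lβ]
  cases r with
  | zero => rw [if_pos rfl, pow_zero, one_mul, h.ηγ]
  | succ r =>
    rw [if_neg r.succ_ne_zero, pow_succ]
    simp only [mul_assoc, mul_mul_eq_zero_of_assoc h.δηγ, mul_zero]

theorem γκl : γ * κ * l = if r = 0 then (γ * β) ^ (q + 1) * γ else 0 := by
  rw [h.γκ]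
  cases r with
  | zero => rw [if_pos rfl, pow_zero, one_mul, h.δl]
  | succ r =>
    rw [if_neg r.succ_ne_zero, pow_succ]
    simp only [mul_assoc, mul_mul_eq_zero_of_assoc h.ηδl, mul_zero]

/-- Both sides equal `κηγ`. At the other vertices the common values are `γκη` and `λβδ`; so the two
cycles of length two through a vertex have the same top power, the socle element there. -/
theorem βγ_pow : (β * γ) ^ (q + 2) = (κ * l) ^ (p + 2) := by
  rw [pow_succ, ← mul_assoc, ← h.κη, mul_assoc, h.ηγ, ← mul_mul_pow_eq, ← mul_assoc, ← pow_succ']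

theorem γβ_pow : (γ * β) ^ (q + 2) = (δ * η) ^ (r + 1) := by
  rw [pow_succ', mul_assoc, mul_mul_pow_eq, ← h.κη, ← mul_assoc, h.γκ, mul_assoc, ← pow_succ]

theorem lκ_pow : (l * κ) ^ (p + 2) = (η * δ) ^ (r + 1) := by
  rw [pow_succ', mul_assoc, mul_mul_pow_eq, ← h.βδ, ← mul_assoc, h.lβ, mul_assoc, ← pow_succ]

/-- A top power is annihilated by a further arrow: it is rewritten along the other two-cycle at the
vertex, where the arrow creates a zero relation. -/
theorem βγ_pow_mul_β : (β * γ) ^ (q + 2) * β = 0 := by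
  rw [h.βγ_pow, pow_succ, mul_assoc, mul_assoc, h.lβ, ← mul_mul_pow_eq, pow_succ]
  simp only [mul_assoc, mul_mul_mul_eq_zero_of_assoc h.lκη, mul_zero]

theorem γβ_pow_mul_γ : (γ * β) ^ (q + 2) * γ = 0 := by
  rw [h.γβ_pow, pow_succ, mul_assoc, h.δηγ, mul_zero]

theorem κl_pow_mul_κ : (κ * l) ^ (p + 2) * κ = 0 := by
  rw [← h.βγ_pow, pow_succ, mul_assoc, mul_assoc, h.γκ, ← mul_mul_pow_eq, pow_succ]
  simp only [mul_assoc, mul_mul_mul_eq_zero_of_assoc h.γβδ, mul_zero]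

theorem lκ_pow_mul_l : (l * κ) ^ (p + 2) * l = 0 := by
  rw [← mul_mul_pow_eq, ← h.βγ_pow, pow_succ', pow_succ', ← mul_assoc, ← mul_assoc, ← mul_assoc,
    ← mul_assoc, h.lβγβ, zero_mul, zero_mul]

theorem δη_pow_mul_δ : (δ * η) ^ (r + 1) * δ = 0 := by
  rw [← mul_mul_pow_eq, ← h.lκ_pow, pow_succ', ← mul_assoc, ← mul_assoc, h.δlκ, zero_mul]

theorem ηδ_pow_mul_η : (η * δ) ^ (r + 1) * η = 0 := by
  rw [← mul_mul_pow_eq, ← h.γβ_pow, pow_succ', ← mul_assoc, ← mul_assoc, h.ηγβ, zero_mul]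

/-! ### Powers which vanish -/

theorem βγ_pow_eq_zero {n : ℕ} (hn : q + 3 ≤ n) : (β * γ) ^ n = 0 := by
  obtain ⟨n, rfl⟩ := Nat.exists_eq_add_of_le' hn
  rw [pow_add, show q + 3 = q + 2 + 1 from rfl, pow_succ (β * γ) (q + 2), ← mul_assoc _ β,
    h.βγ_pow_mul_β, zero_mul, mul_zero]

theorem γβ_pow_eq_zero {n : ℕ} (hn : q + 3 ≤ n) : (γ * β) ^ n = 0 := by
  obtain ⟨n, rfl⟩ := Nat.exists_eq_add_of_le' hn
  rw [pow_add, show q + 3 = q + 2 + 1 from rfl, pow_succ (γ * β) (q + 2), ← mul_assoc _ γ,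
    h.γβ_pow_mul_γ, zero_mul, mul_zero]

theorem κl_pow_eq_zero {n : ℕ} (hn : p + 3 ≤ n) : (κ * l) ^ n = 0 := by
  obtain ⟨n, rfl⟩ := Nat.exists_eq_add_of_le' hn
  rw [pow_add, show p + 3 = p + 2 + 1 from rfl, pow_succ (κ * l) (p + 2), ← mul_assoc _ κ,
    h.κl_pow_mul_κ, zero_mul, mul_zero]

theorem lκ_pow_eq_zero {n : ℕ} (hn : p + 3 ≤ n) : (l * κ) ^ n = 0 := by
  obtain ⟨n, rfl⟩ := Nat.exists_eq_add_of_le' hn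
  rw [pow_add, show p + 3 = p + 2 + 1 from rfl, pow_succ (l * κ) (p + 2), ← mul_assoc _ l,
    h.lκ_pow_mul_l, zero_mul, mul_zero]

theorem δη_pow_eq_zero {n : ℕ} (hn : r + 2 ≤ n) : (δ * η) ^ n = 0 := by
  obtain ⟨n, rfl⟩ := Nat.exists_eq_add_of_le' hn
  rw [pow_add, show r + 2 = r + 1 + 1 from rfl, pow_succ (δ * η) (r + 1), ← mul_assoc _ δ,
    h.δη_pow_mul_δ, zero_mul, mul_zero]

theorem ηδ_pow_eq_zero {n : ℕ} (hn : r + 2 ≤ n) : (η * δ) ^ n = 0 := by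
  obtain ⟨n, rfl⟩ := Nat.exists_eq_add_of_le' hn
  rw [pow_add, show r + 2 = r + 1 + 1 from rfl, pow_succ (η * δ) (r + 1), ← mul_assoc _ η,
    h.ηδ_pow_mul_η, zero_mul, mul_zero]

theorem βγ_pow_mul_eq_zero {n : ℕ} (hn : q + 2 ≤ n) : (β * γ) ^ n * β = 0 := by
  obtain ⟨n, rfl⟩ := Nat.exists_eq_add_of_le' hn
  rw [pow_add, mul_assoc, h.βγ_pow_mul_β, mul_zero]

theorem γβ_pow_mul_eq_zero {n : ℕ} (hn : q + 2 ≤ n) : (γ * β) ^ n * γ = 0 := by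
  obtain ⟨n, rfl⟩ := Nat.exists_eq_add_of_le' hn
  rw [pow_add, mul_assoc, h.γβ_pow_mul_γ, mul_zero]

theorem κl_pow_mul_eq_zero {n : ℕ} (hn : p + 2 ≤ n) : (κ * l) ^ n * κ = 0 := by
  obtain ⟨n, rfl⟩ := Nat.exists_eq_add_of_le' hn
  rw [pow_add, mul_assoc, h.κl_pow_mul_κ, mul_zero]

theorem lκ_pow_mul_eq_zero {n : ℕ} (hn : p + 2 ≤ n) : (l * κ) ^ n * l = 0 := by
  obtain ⟨n, rfl⟩ := Nat.exists_eq_add_of_le' hn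
  rw [pow_add, mul_assoc, h.lκ_pow_mul_l, mul_zero]

theorem δη_pow_mul_eq_zero {n : ℕ} (hn : r + 1 ≤ n) : (δ * η) ^ n * δ = 0 := by
  obtain ⟨n, rfl⟩ := Nat.exists_eq_add_of_le' hn
  rw [pow_add, mul_assoc, h.δη_pow_mul_δ, mul_zero]

theorem ηδ_pow_mul_eq_zero {n : ℕ} (hn : r + 1 ≤ n) : (η * δ) ^ n * η = 0 := by
  obtain ⟨n, rfl⟩ := Nat.exists_eq_add_of_le' hn
  rw [pow_add, mul_assoc, h.ηδ_pow_mul_η, mul_zero]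

/-! ### Products of an arrow and a path which vanish -/

theorem β_mul_δη_pow (n : ℕ) : β * (δ * η) ^ (n + 1) = 0 := by
  rw [pow_succ', ← mul_assoc, ← mul_assoc, h.βδη, zero_mul]

theorem γ_mul_κl_pow (n : ℕ) : γ * (κ * l) ^ (n + 2) = 0 := by
  rw [pow_succ', pow_succ', ← mul_assoc, ← mul_assoc, ← mul_assoc, ← mul_assoc, h.γκlκ, zero_mul,
    zero_mul]

theorem γ_mul_κl_pow_mul_κ (n : ℕ) : γ * ((κ * l) ^ (n + 1) * κ) = 0 := by
  rw [← mul_mul_pow_eq, pow_succ', ← mul_assoc, ← mul_assoc, ← mul_assoc, h.γκlκ, zero_mul]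

theorem δ_mul_lκ_pow (n : ℕ) : δ * (l * κ) ^ (n + 1) = 0 := by
  rw [pow_succ', ← mul_assoc, ← mul_assoc, h.δlκ, zero_mul]

theorem η_mul_γβ_pow (n : ℕ) : η * (γ * β) ^ (n + 1) = 0 := by
  rw [pow_succ', ← mul_assoc, ← mul_assoc, h.ηγβ, zero_mul]

theorem l_mul_βγ_pow (n : ℕ) : l * (β * γ) ^ (n + 2) = 0 := by
  rw [pow_succ', pow_succ', ← mul_assoc, ← mul_assoc, ← mul_assoc, ← mul_assoc, h.lβγβ, zero_mul,
    zero_mul]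

theorem l_mul_βγ_pow_mul_β (n : ℕ) : l * ((β * γ) ^ (n + 1) * β) = 0 := by
  rw [← mul_mul_pow_eq, pow_succ', ← mul_assoc, ← mul_assoc, ← mul_assoc, h.lβγβ, zero_mul]

theorem κ_mul_ηδ_pow (n : ℕ) : κ * (η * δ) ^ (n + 1) = 0 := by
  rw [pow_succ', ← mul_assoc, ← mul_assoc, h.κηδ, zero_mul]

end Relations3K

/-! ### Spanning sets of the Peirce components of type `3K` -/

section Family3K

open Sum

variable {K A : Type u} [Field K] [Ring A] [Algebra K A]

/-- A family which consists of one element and of two sequences. -/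
def blockFamily (x : A) (f g : ℕ → A) : Option (ℕ ⊕ ℕ) → A
  | none => x
  | some (inl n) => f n
  | some (inr n) => g n

/-- The paths along the cycles of length two, which span the Peirce components of
`Q(3K)^{p+2,q+2,r+1}`. -/
def paths3K (p r : ℕ) (e : Fin 3 → A) (x : Arrow3K → A) :
    Fin 3 → Fin 3 → Option (ℕ ⊕ ℕ) → A
  | 0, 0 => blockFamily (e 0) (fun n => (x .beta * x .gamma) ^ (n + 1))
      fun n => if n < p + 1 then (x .kappa * x .lambda) ^ (n + 1) else 0
  | 0, 1 => blockFamily 0 (fun n => (x .beta * x .gamma) ^ n * x .beta) 0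
  | 0, 2 => blockFamily 0 (fun n => (x .kappa * x .lambda) ^ n * x .kappa) 0
  | 1, 0 => blockFamily 0 (fun n => (x .gamma * x .beta) ^ n * x .gamma) 0
  | 1, 1 => blockFamily (e 1) (fun n => (x .gamma * x .beta) ^ (n + 1))
      fun n => if n < r then (x .delta * x .eta) ^ (n + 1) else 0
  | 1, 2 => blockFamily 0 (fun n => (x .delta * x .eta) ^ n * x .delta) 0
  | 2, 0 => blockFamily 0 (fun n => (x .lambda * x .kappa) ^ n * x .lambda) 0
  | 2, 1 => blockFamily 0 (fun n => (x .eta * x .delta) ^ n * x .eta) 0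
  | 2, 2 => blockFamily (e 2) (fun n => (x .lambda * x .kappa) ^ (n + 1))
      fun n => if n < r then (x .eta * x .delta) ^ (n + 1) else 0

theorem mem_span_range_of_eq {T : Type*} {u : T → A} (t : T) {a : A} (h : a = u t) :
    a ∈ Submodule.span K (Set.range u) := h ▸ Submodule.subset_span ⟨t, rfl⟩

theorem mem_span_range_of_eq_zero {T : Type*} {u : T → A} {a : A} (h : a = 0) :
    a ∈ Submodule.span K (Set.range u) := h ▸ Submodule.zero_mem _

theorem mul_ite_mem {W : Submodule K A} {x y : A} {c : Prop} [Decidable c] (h : x * y ∈ W) :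
    x * (if c then y else 0) ∈ W := by
  split_ifs
  · exact h
  · rw [mul_zero]
    exact W.zero_mem

variable {p q r : ℕ} {e : Fin 3 → A} {x : Arrow3K → A}
  (h : Relations3K p q r (x .beta) (x .gamma) (x .delta) (x .eta) (x .lambda) (x .kappa))
include h

/-- The common top power at a vertex is listed only once, in the first sequence of `paths3K`; the
second one stops just below it. Hence the three ranges of `n`. -/
theorem Relations3K.κl_pow_mem (n : ℕ) : (x .kappa * x .lambda) ^ (n + 1) ∈
    Submodule.span K (Set.range (paths3K p r e x 0 0)) := by
  obtain hn | hn | hn : n < p + 1 ∨ n = p + 1 ∨ p + 2 ≤ n := by omega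
  · exact mem_span_range_of_eq (some (inr n)) (if_pos hn).symm
  · subst hn
    exact mem_span_range_of_eq (some (inl (q + 1))) h.βγ_pow.symm
  · exact mem_span_range_of_eq_zero (h.κl_pow_eq_zero (by omega))

theorem Relations3K.δη_pow_mem (n : ℕ) : (x .delta * x .eta) ^ (n + 1) ∈
    Submodule.span K (Set.range (paths3K p r e x 1 1)) := by
  obtain hn | hn | hn : n < r ∨ n = r ∨ r + 1 ≤ n := by omega
  · exact mem_span_range_of_eq (some (inr n)) (if_pos hn).symm
  · subst hn
    exact mem_span_range_of_eq (some (inl (q + 1))) h.γβ_pow.symm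
  · exact mem_span_range_of_eq_zero (h.δη_pow_eq_zero (by omega))

theorem Relations3K.ηδ_pow_mem (n : ℕ) : (x .eta * x .delta) ^ (n + 1) ∈
    Submodule.span K (Set.range (paths3K p r e x 2 2)) := by
  obtain hn | hn | hn : n < r ∨ n = r ∨ r + 1 ≤ n := by omega
  · exact mem_span_range_of_eq (some (inr n)) (if_pos hn).symm
  · subst hn
    exact mem_span_range_of_eq (some (inl (p + 1))) h.lκ_pow.symm
  · exact mem_span_range_of_eq_zero (h.ηδ_pow_eq_zero (by omega))

/-- An arrow either prolongs a path along its own two-cycle, or meets a single arrow and is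
rewritten by a relation, or gives zero. This bounds the algebra from above. -/
theorem Relations3K.arrow_mul_path_mem (he : ∀ y, x y * e (quiver3K.target y) = x y) (y : Arrow3K)
    (j : Fin 3) (t : Option (ℕ ⊕ ℕ)) : x y * paths3K p r e x (quiver3K.target y) j t ∈
      Submodule.span K (Set.range (paths3K p r e x (quiver3K.source y) j)) :=
  match y, j, t with
  | .beta, 0, none => mem_span_range_of_eq_zero (mul_zero _)
  | .beta, 0, some (inl n) => mem_span_range_of_eq (some (inl n)) (by
      change _ * (_ ^ n * _) = _ ^ (n + 1)
      rw [← mul_assoc, mul_mul_pow_eq, mul_assoc, pow_succ])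
  | .beta, 0, some (inr n) => mem_span_range_of_eq_zero (mul_zero _)
  | .beta, 1, none => mem_span_range_of_eq (some (inl 0)) (by
      change _ * e (quiver3K.target .beta) = _ ^ 0 * _
      rw [he, pow_zero, one_mul])
  | .beta, 1, some (inl n) => mem_span_range_of_eq (some (inl (n + 1))) (mul_mul_pow_eq _ _ _)
  | .beta, 1, some (inr n) => mul_ite_mem (mem_span_range_of_eq_zero (h.β_mul_δη_pow n))
  | .beta, 2, none => mem_span_range_of_eq_zero (mul_zero _)
  | .beta, 2, some (inl 0) => mem_span_range_of_eq (some (inl (p + 1))) (by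
      change _ * (_ ^ 0 * _) = _ ^ (p + 1) * _
      rw [pow_zero, one_mul, h.βδ])
  | .beta, 2, some (inl (n + 1)) => mem_span_range_of_eq_zero (by
      change _ * (_ ^ (n + 1) * _) = 0
      rw [← mul_assoc, h.β_mul_δη_pow, zero_mul])
  | .beta, 2, some (inr n) => mem_span_range_of_eq_zero (mul_zero _)
  | .gamma, 0, none => mem_span_range_of_eq (some (inl 0)) (by
      change _ * e (quiver3K.target .gamma) = _ ^ 0 * _
      rw [he, pow_zero, one_mul])
  | .gamma, 0, some (inl n) => mem_span_range_of_eq (some (inl (n + 1))) (mul_mul_pow_eq _ _ _)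
  -- For `r = 0` the product `γκλ` is the longest power of `γβ` times `γ`. The product `λβγ` below
  -- behaves in the same way.
  | .gamma, 0, some (inr 0) => by
      refine mul_ite_mem (y := (x .kappa * x .lambda) ^ (0 + 1)) (c := 0 < p + 1) ?_
      rw [zero_add, pow_one, ← mul_assoc, h.γκl]
      split_ifs
      · exact mem_span_range_of_eq (some (inl (q + 1))) rfl
      · exact Submodule.zero_mem _
  | .gamma, 0, some (inr (n + 1)) => mul_ite_mem (mem_span_range_of_eq_zero (h.γ_mul_κl_pow n))
  | .gamma, 1, none => mem_span_range_of_eq_zero (mul_zero _)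
  | .gamma, 1, some (inl n) => mem_span_range_of_eq (some (inl n)) (by
      change _ * (_ ^ n * _) = _ ^ (n + 1)
      rw [← mul_assoc, mul_mul_pow_eq, mul_assoc, pow_succ])
  | .gamma, 1, some (inr n) => mem_span_range_of_eq_zero (mul_zero _)
  | .gamma, 2, none => mem_span_range_of_eq_zero (mul_zero _)
  | .gamma, 2, some (inl 0) => mem_span_range_of_eq (some (inl r)) (by
      change _ * (_ ^ 0 * _) = _ ^ r * _
      rw [pow_zero, one_mul, h.γκ])
  | .gamma, 2, some (inl (n + 1)) => mem_span_range_of_eq_zero (h.γ_mul_κl_pow_mul_κ n)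
  | .gamma, 2, some (inr n) => mem_span_range_of_eq_zero (mul_zero _)
  | .delta, 0, none => mem_span_range_of_eq_zero (mul_zero _)
  | .delta, 0, some (inl 0) => mem_span_range_of_eq (some (inl (q + 1))) (by
      change _ * (_ ^ 0 * _) = _ ^ (q + 1) * _
      rw [pow_zero, one_mul, h.δl])
  | .delta, 0, some (inl (n + 1)) => mem_span_range_of_eq_zero (by
      change _ * (_ ^ (n + 1) * _) = 0
      rw [← mul_assoc, h.δ_mul_lκ_pow, zero_mul])
  | .delta, 0, some (inr n) => mem_span_range_of_eq_zero (mul_zero _)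
  | .delta, 1, none => mem_span_range_of_eq_zero (mul_zero _)
  | .delta, 1, some (inl n) => by
      change _ * (_ ^ n * _) ∈ _
      rw [← mul_assoc, mul_mul_pow_eq, mul_assoc, ← pow_succ]
      exact h.δη_pow_mem n
  | .delta, 1, some (inr n) => mem_span_range_of_eq_zero (mul_zero _)
  | .delta, 2, none => mem_span_range_of_eq (some (inl 0)) (by
      change _ * e (quiver3K.target .delta) = _ ^ 0 * _
      rw [he, pow_zero, one_mul])
  | .delta, 2, some (inl n) => mem_span_range_of_eq_zero (h.δ_mul_lκ_pow n)
  | .delta, 2, some (inr n) =>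
      mul_ite_mem (mem_span_range_of_eq (some (inl (n + 1))) (mul_mul_pow_eq _ _ _))
  | .eta, 0, none => mem_span_range_of_eq_zero (mul_zero _)
  | .eta, 0, some (inl 0) => mem_span_range_of_eq (some (inl (p + 1))) (by
      change _ * (_ ^ 0 * _) = _ ^ (p + 1) * _
      rw [pow_zero, one_mul, h.ηγ])
  | .eta, 0, some (inl (n + 1)) => mem_span_range_of_eq_zero (by
      change _ * (_ ^ (n + 1) * _) = 0
      rw [← mul_assoc, h.η_mul_γβ_pow, zero_mul])
  | .eta, 0, some (inr n) => mem_span_range_of_eq_zero (mul_zero _)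
  | .eta, 1, none => mem_span_range_of_eq (some (inl 0)) (by
      change _ * e (quiver3K.target .eta) = _ ^ 0 * _
      rw [he, pow_zero, one_mul])
  | .eta, 1, some (inl n) => mem_span_range_of_eq_zero (h.η_mul_γβ_pow n)
  | .eta, 1, some (inr n) =>
      mul_ite_mem (mem_span_range_of_eq (some (inl (n + 1))) (mul_mul_pow_eq _ _ _))
  | .eta, 2, none => mem_span_range_of_eq_zero (mul_zero _)
  | .eta, 2, some (inl n) => by
      change _ * (_ ^ n * _) ∈ _
      rw [← mul_assoc, mul_mul_pow_eq, mul_assoc, ← pow_succ]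
      exact h.ηδ_pow_mem n
  | .eta, 2, some (inr n) => mem_span_range_of_eq_zero (mul_zero _)
  | .lambda, 0, none => mem_span_range_of_eq (some (inl 0)) (by
      change _ * e (quiver3K.target .lambda) = _ ^ 0 * _
      rw [he, pow_zero, one_mul])
  | .lambda, 0, some (inl 0) => by
      change _ * _ ^ (0 + 1) ∈ _
      rw [zero_add, pow_one, ← mul_assoc, h.lβγ]
      split_ifs
      · exact mem_span_range_of_eq (some (inl (p + 1))) rfl
      · exact Submodule.zero_mem _
  | .lambda, 0, some (inl (n + 1)) => mem_span_range_of_eq_zero (h.l_mul_βγ_pow n)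
  | .lambda, 0, some (inr n) =>
      mul_ite_mem (mem_span_range_of_eq (some (inl (n + 1))) (mul_mul_pow_eq _ _ _))
  | .lambda, 1, none => mem_span_range_of_eq_zero (mul_zero _)
  | .lambda, 1, some (inl 0) => mem_span_range_of_eq (some (inl r)) (by
      change _ * (_ ^ 0 * _) = _ ^ r * _
      rw [pow_zero, one_mul, h.lβ])
  | .lambda, 1, some (inl (n + 1)) => mem_span_range_of_eq_zero (h.l_mul_βγ_pow_mul_β n)
  | .lambda, 1, some (inr n) => mem_span_range_of_eq_zero (mul_zero _)
  | .lambda, 2, none => mem_span_range_of_eq_zero (mul_zero _)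
  | .lambda, 2, some (inl n) => mem_span_range_of_eq (some (inl n)) (by
      change _ * (_ ^ n * _) = _ ^ (n + 1)
      rw [← mul_assoc, mul_mul_pow_eq, mul_assoc, pow_succ])
  | .lambda, 2, some (inr n) => mem_span_range_of_eq_zero (mul_zero _)
  | .kappa, 0, none => mem_span_range_of_eq_zero (mul_zero _)
  | .kappa, 0, some (inl n) => by
      change _ * (_ ^ n * _) ∈ _
      rw [← mul_assoc, mul_mul_pow_eq, mul_assoc, ← pow_succ]
      exact h.κl_pow_mem n
  | .kappa, 0, some (inr n) => mem_span_range_of_eq_zero (mul_zero _)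
  | .kappa, 1, none => mem_span_range_of_eq_zero (mul_zero _)
  | .kappa, 1, some (inl 0) => mem_span_range_of_eq (some (inl (q + 1))) (by
      change _ * (_ ^ 0 * _) = _ ^ (q + 1) * _
      rw [pow_zero, one_mul, h.κη])
  | .kappa, 1, some (inl (n + 1)) => mem_span_range_of_eq_zero (by
      change _ * (_ ^ (n + 1) * _) = 0
      rw [← mul_assoc, h.κ_mul_ηδ_pow, zero_mul])
  | .kappa, 1, some (inr n) => mem_span_range_of_eq_zero (mul_zero _)
  | .kappa, 2, none => mem_span_range_of_eq (some (inl 0)) (by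
      change _ * e (quiver3K.target .kappa) = _ ^ 0 * _
      rw [he, pow_zero, one_mul])
  | .kappa, 2, some (inl n) => mem_span_range_of_eq (some (inl (n + 1))) (mul_mul_pow_eq _ _ _)
  | .kappa, 2, some (inr n) => mul_ite_mem (mem_span_range_of_eq_zero (h.κ_mul_ηδ_pow n))

end Family3K

/-! ### Socle degrees and the weight of type `3K` -/

section Weight3K

/-- The degrees of the paths which span the socle of `Q(3K)^{p+2,q+2,r+1}`. The coordinates are
the multiplicities of `β`, `γ`, `δ`, `η`, `λ`, `κ`. -/
def IsSocleDegree3K (p q r : ℕ) : ℕ × ℕ × ℕ × ℕ × ℕ × ℕ → Prop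
  | (b, g, d, h, l, k) =>
    b = q + 2 ∧ g = q + 2 ∧ d = 0 ∧ h = 0 ∧ l = 0 ∧ k = 0 ∨
    b = 0 ∧ g = 0 ∧ d = r + 1 ∧ h = r + 1 ∧ l = 0 ∧ k = 0 ∨
    b = 0 ∧ g = 0 ∧ d = 0 ∧ h = 0 ∧ l = p + 2 ∧ k = p + 2 ∨
    b = 1 ∧ g = 0 ∧ d = 1 ∧ h = 0 ∧ l = 1 ∧ k = 0 ∨
    b = 0 ∧ g = 1 ∧ d = 0 ∧ h = 1 ∧ l = 0 ∧ k = 1 ∨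
    r = 0 ∧ b = 1 ∧ g = 1 ∧ d = 0 ∧ h = 0 ∧ l = 1 ∧ k = 1

open Classical in
/-- The indicator function of the degrees in the socle. -/
noncomputable def weight3K (K : Type u) [Field K] (p q r : ℕ) (m : ℕ × ℕ × ℕ × ℕ × ℕ × ℕ) : K :=
  if IsSocleDegree3K p q r m then 1 else 0

/-- The degrees of the arrows. -/
def degree3K : Arrow3K → ℕ × ℕ × ℕ × ℕ × ℕ × ℕ
  | .beta => (1, 0, 0, 0, 0, 0)
  | .gamma => (0, 1, 0, 0, 0, 0)
  | .delta => (0, 0, 1, 0, 0, 0)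
  | .eta => (0, 0, 0, 1, 0, 0)
  | .lambda => (0, 0, 0, 0, 1, 0)
  | .kappa => (0, 0, 0, 0, 0, 1)

variable {K : Type u} [Field K] {p q r : ℕ}

theorem weight3K_eq_one {m : ℕ × ℕ × ℕ × ℕ × ℕ × ℕ} (h : IsSocleDegree3K p q r m) :
    weight3K K p q r m = 1 := if_pos h

theorem weight3K_eq_zero {m : ℕ × ℕ × ℕ × ℕ × ℕ × ℕ} (h : ¬ IsSocleDegree3K p q r m) :
    weight3K K p q r m = 0 := if_neg h

theorem weight3K_ne_zero {m : ℕ × ℕ × ℕ × ℕ × ℕ × ℕ} :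
    weight3K K p q r m ≠ 0 ↔ IsSocleDegree3K p q r m := by
  simp [weight3K]

theorem weight3K_congr {m n : ℕ × ℕ × ℕ × ℕ × ℕ × ℕ}
    (h : IsSocleDegree3K p q r m ↔ IsSocleDegree3K p q r n) :
    weight3K K p q r m = weight3K K p q r n := by
  by_cases hn : IsSocleDegree3K p q r n
  · rw [weight3K_eq_one hn, weight3K_eq_one (h.2 hn)]
  · rw [weight3K_eq_zero hn, weight3K_eq_zero (mt h.1 hn)]

/-- No monomial completes this degree to a socle degree, so the path is zero in the weight ring;
likewise for the other two zero relations. -/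
theorem isSocleDegree3K_gamma_beta_delta (m : ℕ × ℕ × ℕ × ℕ × ℕ × ℕ) : ¬ IsSocleDegree3K p q r
    (degree3K .gamma + degree3K .beta + degree3K .delta + m) := by
  obtain ⟨b, g, d, h, l, k⟩ := m
  simp only [degree3K, Prod.mk_add_mk, IsSocleDegree3K]
  omega

theorem isSocleDegree3K_delta_eta_gamma (m : ℕ × ℕ × ℕ × ℕ × ℕ × ℕ) : ¬ IsSocleDegree3K p q r
    (degree3K .delta + degree3K .eta + degree3K .gamma + m) := by
  obtain ⟨b, g, d, h, l, k⟩ := m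
  simp only [degree3K, Prod.mk_add_mk, IsSocleDegree3K]
  omega

theorem isSocleDegree3K_lambda_kappa_eta (m : ℕ × ℕ × ℕ × ℕ × ℕ × ℕ) : ¬ IsSocleDegree3K p q r
    (degree3K .lambda + degree3K .kappa + degree3K .eta + m) := by
  obtain ⟨b, g, d, h, l, k⟩ := m
  simp only [degree3K, Prod.mk_add_mk, IsSocleDegree3K]
  omega

/-- The two sides of a relation are completed to socle degrees by the same monomials, here by `λ`
alone. These equivalences make `rep3K` well defined. -/
theorem isSocleDegree3K_beta_delta (m : ℕ × ℕ × ℕ × ℕ × ℕ × ℕ) :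
    IsSocleDegree3K p q r (degree3K .beta + degree3K .delta + m) ↔
      IsSocleDegree3K p q r ((0, 0, 0, 0, p + 1, p + 1 + 1) + m) := by
  obtain ⟨b, g, d, h, l, k⟩ := m
  simp only [degree3K, Prod.mk_add_mk, IsSocleDegree3K]
  refine ⟨?_, ?_⟩ <;> rintro (h | h | h | h | h | h) <;>
    first | (exfalso; omega) | (left; omega) | (right; left; omega) | (right; right; left; omega) |
      (right; right; right; left; omega)

theorem isSocleDegree3K_eta_gamma (m : ℕ × ℕ × ℕ × ℕ × ℕ × ℕ) :
    IsSocleDegree3K p q r (degree3K .eta + degree3K .gamma + m) ↔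
      IsSocleDegree3K p q r ((0, 0, 0, 0, p + 1 + 1, p + 1) + m) := by
  obtain ⟨b, g, d, h, l, k⟩ := m
  simp only [degree3K, Prod.mk_add_mk, IsSocleDegree3K]
  refine ⟨?_, ?_⟩ <;> rintro (h | h | h | h | h | h) <;>
    first | (exfalso; omega) | (left; omega) | (right; left; omega) | (right; right; left; omega) |
      (right; right; right; left; omega) | (right; right; right; right; left; omega)

theorem isSocleDegree3K_delta_lambda (m : ℕ × ℕ × ℕ × ℕ × ℕ × ℕ) :
    IsSocleDegree3K p q r (degree3K .delta + degree3K .lambda + m) ↔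
      IsSocleDegree3K p q r ((q + 1, q + 1 + 1, 0, 0, 0, 0) + m) := by
  obtain ⟨b, g, d, h, l, k⟩ := m
  simp only [degree3K, Prod.mk_add_mk, IsSocleDegree3K]
  refine ⟨?_, ?_⟩ <;> rintro (h | h | h | h | h | h) <;>
    first | (exfalso; omega) | (left; omega) | (right; left; omega) | (right; right; left; omega) |
      (right; right; right; left; omega)

theorem isSocleDegree3K_kappa_eta (m : ℕ × ℕ × ℕ × ℕ × ℕ × ℕ) :
    IsSocleDegree3K p q r (degree3K .kappa + degree3K .eta + m) ↔
      IsSocleDegree3K p q r ((q + 1 + 1, q + 1, 0, 0, 0, 0) + m) := by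
  obtain ⟨b, g, d, h, l, k⟩ := m
  simp only [degree3K, Prod.mk_add_mk, IsSocleDegree3K]
  refine ⟨?_, ?_⟩ <;> rintro (h | h | h | h | h | h) <;>
    first | (exfalso; omega) | (left; omega) | (right; left; omega) | (right; right; left; omega) |
      (right; right; right; left; omega) | (right; right; right; right; left; omega)

/-- For `r = 0` the relation reads `λβ = η`. Since `η` is completed by `γκ` as well as by `δ`, the
degree of `βγλκ` must be a socle degree, which is the sixth alternative in `IsSocleDegree3K`. -/
theorem isSocleDegree3K_lambda_beta (m : ℕ × ℕ × ℕ × ℕ × ℕ × ℕ) :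
    IsSocleDegree3K p q r (degree3K .lambda + degree3K .beta + m) ↔
      IsSocleDegree3K p q r ((0, 0, r, r + 1, 0, 0) + m) := by
  obtain ⟨b, g, d, h, l, k⟩ := m
  simp only [degree3K, Prod.mk_add_mk, IsSocleDegree3K]
  refine ⟨?_, ?_⟩ <;> rintro (h | h | h | h | h | h) <;>
    first | (exfalso; omega) | (left; omega) | (right; left; omega) | (right; right; left; omega) |
      (right; right; right; left; omega) | (right; right; right; right; left; omega) |
      (right; right; right; right; right; omega)

theorem isSocleDegree3K_gamma_kappa (m : ℕ × ℕ × ℕ × ℕ × ℕ × ℕ) :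
    IsSocleDegree3K p q r (degree3K .gamma + degree3K .kappa + m) ↔
      IsSocleDegree3K p q r ((0, 0, r + 1, r, 0, 0) + m) := by
  obtain ⟨b, g, d, h, l, k⟩ := m
  simp only [degree3K, Prod.mk_add_mk, IsSocleDegree3K]
  refine ⟨?_, ?_⟩ <;> rintro (h | h | h | h | h | h) <;>
    first | (exfalso; omega) | (left; omega) | (right; left; omega) | (right; right; left; omega) |
      (right; right; right; left; omega) | (right; right; right; right; left; omega) |
      (right; right; right; right; right; omega)

section Paths

variable {B : Type*} [Ring B] [Algebra K B]
  {ρ : B →ₐ[K] Matrix (Fin 3) (Fin 3) (WeightRing (weight3K K p q r))} {x : Arrow3K → B}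
  (hx : ∀ y, IsMonomialAt ρ (x y) (quiver3K.source y) (quiver3K.target y) (degree3K y))
include hx

theorem isMonomialAt_beta_gamma :
    IsMonomialAt ρ (x .beta * x .gamma) 0 0 (1, 1, 0, 0, 0, 0) := (hx .beta).mul (hx .gamma)

theorem isMonomialAt_gamma_beta :
    IsMonomialAt ρ (x .gamma * x .beta) 1 1 (1, 1, 0, 0, 0, 0) := (hx .gamma).mul (hx .beta)

theorem isMonomialAt_delta_eta :
    IsMonomialAt ρ (x .delta * x .eta) 1 1 (0, 0, 1, 1, 0, 0) := (hx .delta).mul (hx .eta)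

theorem isMonomialAt_eta_delta :
    IsMonomialAt ρ (x .eta * x .delta) 2 2 (0, 0, 1, 1, 0, 0) := (hx .eta).mul (hx .delta)

theorem isMonomialAt_lambda_kappa :
    IsMonomialAt ρ (x .lambda * x .kappa) 2 2 (0, 0, 0, 0, 1, 1) := (hx .lambda).mul (hx .kappa)

theorem isMonomialAt_kappa_lambda :
    IsMonomialAt ρ (x .kappa * x .lambda) 0 0 (0, 0, 0, 0, 1, 1) := (hx .kappa).mul (hx .lambda)

theorem isMonomialAt_pow_mul_beta (n : ℕ) :
    IsMonomialAt ρ ((x .beta * x .gamma) ^ n * x .beta) 0 1 (n + 1, n, 0, 0, 0, 0) :=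
  ((isMonomialAt_beta_gamma hx).pow_mul (hx .beta) n).congr (by simp [degree3K])

theorem isMonomialAt_pow_mul_gamma (n : ℕ) :
    IsMonomialAt ρ ((x .gamma * x .beta) ^ n * x .gamma) 1 0 (n, n + 1, 0, 0, 0, 0) :=
  ((isMonomialAt_gamma_beta hx).pow_mul (hx .gamma) n).congr (by simp [degree3K])

theorem isMonomialAt_pow_mul_delta (n : ℕ) :
    IsMonomialAt ρ ((x .delta * x .eta) ^ n * x .delta) 1 2 (0, 0, n + 1, n, 0, 0) :=
  ((isMonomialAt_delta_eta hx).pow_mul (hx .delta) n).congr (by simp [degree3K])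

theorem isMonomialAt_pow_mul_eta (n : ℕ) :
    IsMonomialAt ρ ((x .eta * x .delta) ^ n * x .eta) 2 1 (0, 0, n, n + 1, 0, 0) :=
  ((isMonomialAt_eta_delta hx).pow_mul (hx .eta) n).congr (by simp [degree3K])

theorem isMonomialAt_pow_mul_lambda (n : ℕ) :
    IsMonomialAt ρ ((x .lambda * x .kappa) ^ n * x .lambda) 2 0 (0, 0, 0, 0, n + 1, n) :=
  ((isMonomialAt_lambda_kappa hx).pow_mul (hx .lambda) n).congr (by simp [degree3K])

theorem isMonomialAt_pow_mul_kappa (n : ℕ) :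
    IsMonomialAt ρ ((x .kappa * x .lambda) ^ n * x .kappa) 0 2 (0, 0, 0, 0, n, n + 1) :=
  ((isMonomialAt_kappa_lambda hx).pow_mul (hx .kappa) n).congr (by simp [degree3K])

theorem isMonomialAt_beta_gamma_pow (n : ℕ) :
    IsMonomialAt ρ ((x .beta * x .gamma) ^ (n + 1)) 0 0 (n + 1, n + 1, 0, 0, 0, 0) :=
  ((isMonomialAt_beta_gamma hx).pow n).congr (by simp)

theorem isMonomialAt_gamma_beta_pow (n : ℕ) :
    IsMonomialAt ρ ((x .gamma * x .beta) ^ (n + 1)) 1 1 (n + 1, n + 1, 0, 0, 0, 0) :=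
  ((isMonomialAt_gamma_beta hx).pow n).congr (by simp)

theorem isMonomialAt_delta_eta_pow (n : ℕ) :
    IsMonomialAt ρ ((x .delta * x .eta) ^ (n + 1)) 1 1 (0, 0, n + 1, n + 1, 0, 0) :=
  ((isMonomialAt_delta_eta hx).pow n).congr (by simp)

theorem isMonomialAt_eta_delta_pow (n : ℕ) :
    IsMonomialAt ρ ((x .eta * x .delta) ^ (n + 1)) 2 2 (0, 0, n + 1, n + 1, 0, 0) :=
  ((isMonomialAt_eta_delta hx).pow n).congr (by simp)

theorem isMonomialAt_lambda_kappa_pow (n : ℕ) :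
    IsMonomialAt ρ ((x .lambda * x .kappa) ^ (n + 1)) 2 2 (0, 0, 0, 0, n + 1, n + 1) :=
  ((isMonomialAt_lambda_kappa hx).pow n).congr (by simp)

theorem isMonomialAt_kappa_lambda_pow (n : ℕ) :
    IsMonomialAt ρ ((x .kappa * x .lambda) ^ (n + 1)) 0 0 (0, 0, 0, 0, n + 1, n + 1) :=
  ((isMonomialAt_kappa_lambda hx).pow n).congr (by simp)

end Paths

end Weight3K

/-! ### The representation and the characters of `Q(3K)` -/

section Q3K

open ArrowQuiver

variable (K : Type u) [Field K] (p q r : ℕ)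

/-- The images of the arrows in `Q(3K)^{p+2,q+2,r+1}`. -/
noncomputable def arrow3K (y : Arrow3K) : Q3KPresented K (p + 2) (q + 2) (r + 1) :=
  RingQuot.mkAlgHom K (Q3KRel K (p + 2) (q + 2) (r + 1)) (arrow K quiver3K y)

theorem relations3K : Relations3K p q r (arrow3K K p q r .beta) (arrow3K K p q r .gamma)
    (arrow3K K p q r .delta) (arrow3K K p q r .eta) (arrow3K K p q r .lambda)
    (arrow3K K p q r .kappa) where
  βδ := by
    simpa [arrow3K] using RingQuot.mkAlgHom_rel K
      (Q3KRel.beta_delta (K := K) (a := p + 2) (b := q + 2) (c := r + 1))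
  ηγ := by
    simpa [arrow3K] using RingQuot.mkAlgHom_rel K
      (Q3KRel.eta_gamma (K := K) (a := p + 2) (b := q + 2) (c := r + 1))
  δl := by
    simpa [arrow3K] using RingQuot.mkAlgHom_rel K
      (Q3KRel.delta_lambda (K := K) (a := p + 2) (b := q + 2) (c := r + 1))
  κη := by
    simpa [arrow3K] using RingQuot.mkAlgHom_rel K
      (Q3KRel.kappa_eta (K := K) (a := p + 2) (b := q + 2) (c := r + 1))
  lβ := by
    simpa [arrow3K] using RingQuot.mkAlgHom_rel K
      (Q3KRel.lambda_beta (K := K) (a := p + 2) (b := q + 2) (c := r + 1))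
  γκ := by
    simpa [arrow3K] using RingQuot.mkAlgHom_rel K
      (Q3KRel.gamma_kappa (K := K) (a := p + 2) (b := q + 2) (c := r + 1))
  γβδ := by
    simpa [arrow3K] using RingQuot.mkAlgHom_rel K
      (Q3KRel.gamma_beta_delta (K := K) (a := p + 2) (b := q + 2) (c := r + 1))
  δηγ := by
    simpa [arrow3K] using RingQuot.mkAlgHom_rel K
      (Q3KRel.delta_eta_gamma (K := K) (a := p + 2) (b := q + 2) (c := r + 1))
  lκη := by
    simpa [arrow3K] using RingQuot.mkAlgHom_rel K
      (Q3KRel.lambda_kappa_eta (K := K) (a := p + 2) (b := q + 2) (c := r + 1))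

/-- The representation of `Q(3K)^{p+2,q+2,r+1}` by matrices of monomials. -/
noncomputable def rep3K : Q3KPresented K (p + 2) (q + 2) (r + 1) →ₐ[K]
    Matrix (Fin 3) (Fin 3) (WeightRing (weight3K K p q r)) :=
  RingQuot.liftAlgHom K ⟨matrixRep fun y => weightMonomial _ (degree3K y), by
    have hx (y : Arrow3K) : IsMonomialAt (matrixRep fun y => weightMonomial (weight3K K p q r)
      (degree3K y)) (arrow K quiver3K y) (quiver3K.source y) (quiver3K.target y) (degree3K y) :=
      matrixRep_arrow _ y
    have hzero {y y' y'' : Arrow3K} (h1 : quiver3K.target y = quiver3K.source y')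
        (h2 : quiver3K.target y' = quiver3K.source y'')
        (h : ∀ m, ¬ IsSocleDegree3K p q r (degree3K y + degree3K y' + degree3K y'' + m)) :
        matrixRep (K := K) (q := quiver3K) (fun y => weightMonomial (weight3K K p q r) (degree3K y))
          (arrow K quiver3K y * arrow K quiver3K y' * arrow K quiver3K y'') =
        matrixRep (K := K) (q := quiver3K) (fun y => weightMonomial (weight3K K p q r) (degree3K y)) 0 := by
      rw [map_zero]
      have h3 := hx y'
      have h4 := hx y''
      rw [← h1] at h3
      rw [← h2] at h4
      exact (((hx y).mul h3).mul h4).map_eq_zero fun m => weight3K_eq_zero (h m)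
    rintro _ _ (_ | _ | _ | _ | _ | _ | _ | _ | _)
    · refine ((hx .beta).mul (hx .delta)).map_eq_map (isMonomialAt_pow_mul_kappa hx (p + 1))
        fun m => weight3K_congr (isSocleDegree3K_beta_delta m)
    · refine ((hx .eta).mul (hx .gamma)).map_eq_map (isMonomialAt_pow_mul_lambda hx (p + 1))
        fun m => weight3K_congr (isSocleDegree3K_eta_gamma m)
    · refine ((hx .delta).mul (hx .lambda)).map_eq_map (isMonomialAt_pow_mul_gamma hx (q + 1))
        fun m => weight3K_congr (isSocleDegree3K_delta_lambda m)
    · refine ((hx .kappa).mul (hx .eta)).map_eq_map (isMonomialAt_pow_mul_beta hx (q + 1))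
        fun m => weight3K_congr (isSocleDegree3K_kappa_eta m)
    · refine ((hx .lambda).mul (hx .beta)).map_eq_map (isMonomialAt_pow_mul_eta hx r)
        fun m => weight3K_congr (isSocleDegree3K_lambda_beta m)
    · refine ((hx .gamma).mul (hx .kappa)).map_eq_map (isMonomialAt_pow_mul_delta hx r)
        fun m => weight3K_congr (isSocleDegree3K_gamma_kappa m)
    · exact hzero rfl rfl isSocleDegree3K_gamma_beta_delta
    · exact hzero rfl rfl isSocleDegree3K_delta_eta_gamma
    · exact hzero rfl rfl isSocleDegree3K_lambda_kappa_eta⟩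

/-- The characters of `Q(3K)^{p+2,q+2,r+1}` which are given by the vertices. -/
noncomputable def character3K (i : Fin 3) : Q3KPresented K (p + 2) (q + 2) (r + 1) →ₐ[K] K :=
  RingQuot.liftAlgHom K ⟨character quiver3K K i, by
    rintro _ _ (_ | _ | _ | _ | _ | _ | _ | _ | _) <;> simp⟩

theorem rep3K_mk (a : PathAlgebra K quiver3K) :
    rep3K K p q r (RingQuot.mkAlgHom K _ a) =
      matrixRep (fun y => weightMonomial _ (degree3K y)) a := by
  simp [rep3K]

end Q3K

/-! ### Triangular pairing of paths of type `3K` -/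

section Triangular

/-- On monomials the trace form is the weight of the total degree, so triangularity becomes
arithmetic of exponents. The predicate `N` marks the indices whose path can be nonzero. -/
theorem triangular_of_isMonomialAt {K : Type u} {M : Type} {V B T : Type*} [Field K]
    [AddCommMonoid M] [Fintype V] [DecidableEq V] [Ring B] [Algebra K B] {w : M → K}
    {ρ : B →ₐ[K] Matrix V V (WeightRing w)} {i j : V} {u v : T → B} {D E : T → M} (N : T → Prop)
    (height : T → ℕ) (hu0 : ∀ t, ¬ N t → u t = 0)
    (hu : ∀ t, N t → IsMonomialAt ρ (u t) i j (D t))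
    (hv : ∀ t, N t → IsMonomialAt ρ (v t) j i (E t)) (h1 : ∀ t, N t → w (E t + D t) ≠ 0)
    (h2 : ∀ t t', N t → N t' → w (E t + D t') ≠ 0 → t' = t ∨ height t' < height t) (t : T)
    (ht : u t ≠ 0) : traceForm ρ (v t * u t) ≠ 0 ∧
      ∀ t', traceForm ρ (v t * u t') ≠ 0 → t' = t ∨ height t' < height t := by
  have hN (t : T) (h : u t ≠ 0) : N t := by
    by_contra h'
    exact h (hu0 t h')
  refine ⟨?_, fun t' h => ?_⟩
  · rw [(hv t (hN t ht)).traceForm_mul (hu t (hN t ht))]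
    exact h1 t (hN t ht)
  · have ht' : N t' := hN t' fun h' => h (by rw [h', mul_zero, map_zero])
    rw [(hv t (hN t ht)).traceForm_mul (hu t' ht')] at h
    exact h2 t t' (hN t ht) ht' h

end Triangular

section Q3K

open ArrowQuiver Sum

variable {K A : Type u} [Field K] [Ring A] [Algebra K A]

/-- The paths which test for the paths along the cycles of length two. -/
def tests3K (p q r : ℕ) (e : Fin 3 → A) (x : Arrow3K → A) : Fin 3 → Fin 3 → Option (ℕ ⊕ ℕ) → A
  | 0, 0 => blockFamily ((x .beta * x .gamma) ^ (q + 1 + 1))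
      (fun n => (x .beta * x .gamma) ^ (q + 1 - n) * e 0)
      fun n => (x .kappa * x .lambda) ^ (p + 1 - n) * e 0
  | 0, 1 => blockFamily 0
      (fun n => (x .gamma * x .beta) ^ (q + 1 - n) * x .gamma) 0
  | 0, 2 => blockFamily 0
      (fun n => (x .lambda * x .kappa) ^ (p + 1 - n) * x .lambda) 0
  | 1, 0 => blockFamily 0
      (fun n => (x .beta * x .gamma) ^ (q + 1 - n) * x .beta) 0
  | 1, 1 => blockFamily ((x .gamma * x .beta) ^ (q + 1 + 1))
      (fun n => (x .gamma * x .beta) ^ (q + 1 - n) * e 1)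
      fun n => (x .delta * x .eta) ^ (r - n) * e 1
  | 1, 2 => blockFamily 0
      (fun n => (x .eta * x .delta) ^ (r - n) * x .eta) 0
  | 2, 0 => blockFamily 0
      (fun n => (x .kappa * x .lambda) ^ (p + 1 - n) * x .kappa) 0
  | 2, 1 => blockFamily 0
      (fun n => (x .delta * x .eta) ^ (r - n) * x .delta) 0
  | 2, 2 => blockFamily ((x .lambda * x .kappa) ^ (p + 1 + 1))
      (fun n => (x .lambda * x .kappa) ^ (p + 1 - n) * e 2)
      fun n => (x .eta * x .delta) ^ (r - n) * e 2

/-- The order in which the coefficients of the paths are found. -/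
def height3K (p q : ℕ) : Fin 3 → Fin 3 → Option (ℕ ⊕ ℕ) → ℕ
  | 0, 0 => blockFamily 0 (fun n => if n = q then 2 else 1) fun n => if n = p then 3 else 1
  | _, _ => 0

variable {p q r : ℕ} {e : Fin 3 → A} {x : Arrow3K → A}
  (h : Relations3K p q r (x .beta) (x .gamma) (x .delta) (x .eta) (x .lambda) (x .kappa))
  {ρ : A →ₐ[K] Matrix (Fin 3) (Fin 3) (WeightRing (weight3K K p q r))}
  (hx : ∀ y, IsMonomialAt ρ (x y) (quiver3K.source y) (quiver3K.target y) (degree3K y))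

/-- The two triangles are not balanced in opposite arrows, so they drop out. The only mixed degree
left is that of `βγλκ`, for `r = 0`. -/
theorem isSocleDegree3K_cycles_iff {p q r b d k : ℕ} :
    IsSocleDegree3K p q r (b, b, d, d, k, k) ↔ b = q + 2 ∧ d = 0 ∧ k = 0 ∨
    b = 0 ∧ d = r + 1 ∧ k = 0 ∨ b = 0 ∧ d = 0 ∧ k = p + 2 ∨ r = 0 ∧ b = 1 ∧ d = 0 ∧ k = 1 := by
  constructor
  · rintro (h | h | h | h | h | h) <;> omega
  · rintro (⟨rfl, rfl, rfl⟩ | ⟨rfl, rfl, rfl⟩ | ⟨rfl, rfl, rfl⟩ | ⟨rfl, rfl, rfl, rfl⟩) <;>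
      simp [IsSocleDegree3K]

include h hx

/-- Off the diagonal there is one sequence only. Each path is tested by the path which completes it
to a top power, so the pairing is diagonal; the same holds for the other five components. -/
theorem triangular3K_0_1 (t : Option (ℕ ⊕ ℕ)) :
    paths3K p r e x 0 1 t ≠ 0 →
    traceForm ρ (tests3K p q r e x 0 1 t *
      paths3K p r e x 0 1 t) ≠ 0 ∧
    ∀ t', traceForm ρ (tests3K p q r e x 0 1 t *
        paths3K p r e x 0 1 t') ≠ 0 →
      t' = t ∨ height3K p q 0 1 t' < height3K p q 0 1 t := by
  refine triangular_of_isMonomialAt (blockFamily False (· < q + 2) fun _ => False)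
    (height3K p q 0 1) (ρ := ρ) (i := 0) (j := 1)
    (u := paths3K p r e x 0 1) (v := tests3K p q r e x 0 1)
    (D := blockFamily 0 (fun n => (n + 1, n, 0, 0, 0, 0)) 0)
    (E := blockFamily 0 (fun n => (q + 1 - n, q + 1 - n + 1, 0, 0, 0, 0)) 0) ?_ ?_ ?_ ?_ ?_ t
  · rintro (_ | n | n) hn
    · rfl
    · exact h.βγ_pow_mul_eq_zero (not_lt.1 hn)
    · rfl
  · rintro (_ | n | n) hn
    · exact hn.elim
    · exact isMonomialAt_pow_mul_beta hx n
    · exact hn.elim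
  · rintro (_ | n | n) hn
    · exact hn.elim
    · exact isMonomialAt_pow_mul_gamma hx _
    · exact hn.elim
  · rintro (_ | n | n) hn
    · exact hn.elim
    · have hn' : n < q + 2 := hn
      rw [weight3K_ne_zero]
      simp only [blockFamily, Prod.mk_add_mk]
      simp only [IsSocleDegree3K]
      left
      refine ⟨?_, ?_, ?_, ?_, ?_, ?_⟩ <;> first | trivial | omega
    · exact hn.elim
  · rintro (_ | n | n) (_ | m | m) hn hm hw
    · exact hn.elim
    · exact hn.elim
    · exact hn.elim
    · exact hm.elim
    · have hn' : n < q + 2 := hn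
      rw [weight3K_ne_zero] at hw
      simp only [blockFamily, IsSocleDegree3K] at hw
      left
      rw [show m = n by omega]
    · exact hm.elim
    · exact hn.elim
    · exact hn.elim
    · exact hn.elim

theorem triangular3K_1_0 (t : Option (ℕ ⊕ ℕ)) :
    paths3K p r e x 1 0 t ≠ 0 →
    traceForm ρ (tests3K p q r e x 1 0 t *
      paths3K p r e x 1 0 t) ≠ 0 ∧
    ∀ t', traceForm ρ (tests3K p q r e x 1 0 t *
        paths3K p r e x 1 0 t') ≠ 0 →
      t' = t ∨ height3K p q 1 0 t' < height3K p q 1 0 t := by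
  refine triangular_of_isMonomialAt (blockFamily False (· < q + 2) fun _ => False)
    (height3K p q 1 0) (ρ := ρ) (i := 1) (j := 0)
    (u := paths3K p r e x 1 0) (v := tests3K p q r e x 1 0)
    (D := blockFamily 0 (fun n => (n, n + 1, 0, 0, 0, 0)) 0)
    (E := blockFamily 0 (fun n => (q + 1 - n + 1, q + 1 - n, 0, 0, 0, 0)) 0) ?_ ?_ ?_ ?_ ?_ t
  · rintro (_ | n | n) hn
    · rfl
    · exact h.γβ_pow_mul_eq_zero (not_lt.1 hn)
    · rfl
  · rintro (_ | n | n) hn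
    · exact hn.elim
    · exact isMonomialAt_pow_mul_gamma hx n
    · exact hn.elim
  · rintro (_ | n | n) hn
    · exact hn.elim
    · exact isMonomialAt_pow_mul_beta hx _
    · exact hn.elim
  · rintro (_ | n | n) hn
    · exact hn.elim
    · have hn' : n < q + 2 := hn
      rw [weight3K_ne_zero]
      simp only [blockFamily, Prod.mk_add_mk]
      simp only [IsSocleDegree3K]
      left
      refine ⟨?_, ?_, ?_, ?_, ?_, ?_⟩ <;> first | trivial | omega
    · exact hn.elim
  · rintro (_ | n | n) (_ | m | m) hn hm hw
    · exact hn.elim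
    · exact hn.elim
    · exact hn.elim
    · exact hm.elim
    · have hn' : n < q + 2 := hn
      rw [weight3K_ne_zero] at hw
      simp only [blockFamily, IsSocleDegree3K] at hw
      left
      rw [show m = n by omega]
    · exact hm.elim
    · exact hn.elim
    · exact hn.elim
    · exact hn.elim

theorem triangular3K_1_2 (t : Option (ℕ ⊕ ℕ)) :
    paths3K p r e x 1 2 t ≠ 0 →
    traceForm ρ (tests3K p q r e x 1 2 t *
      paths3K p r e x 1 2 t) ≠ 0 ∧
    ∀ t', traceForm ρ (tests3K p q r e x 1 2 t *
        paths3K p r e x 1 2 t') ≠ 0 →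
      t' = t ∨ height3K p q 1 2 t' < height3K p q 1 2 t := by
  refine triangular_of_isMonomialAt (blockFamily False (· < r + 1) fun _ => False)
    (height3K p q 1 2) (ρ := ρ) (i := 1) (j := 2)
    (u := paths3K p r e x 1 2) (v := tests3K p q r e x 1 2)
    (D := blockFamily 0 (fun n => (0, 0, n + 1, n, 0, 0)) 0)
    (E := blockFamily 0 (fun n => (0, 0, r - n, r - n + 1, 0, 0)) 0) ?_ ?_ ?_ ?_ ?_ t
  · rintro (_ | n | n) hn
    · rfl
    · exact h.δη_pow_mul_eq_zero (not_lt.1 hn)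
    · rfl
  · rintro (_ | n | n) hn
    · exact hn.elim
    · exact isMonomialAt_pow_mul_delta hx n
    · exact hn.elim
  · rintro (_ | n | n) hn
    · exact hn.elim
    · exact isMonomialAt_pow_mul_eta hx _
    · exact hn.elim
  · rintro (_ | n | n) hn
    · exact hn.elim
    · have hn' : n < r + 1 := hn
      rw [weight3K_ne_zero]
      simp only [blockFamily, Prod.mk_add_mk]
      simp only [IsSocleDegree3K]
      right
      left
      refine ⟨?_, ?_, ?_, ?_, ?_, ?_⟩ <;> first | trivial | omega
    · exact hn.elim
  · rintro (_ | n | n) (_ | m | m) hn hm hw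
    · exact hn.elim
    · exact hn.elim
    · exact hn.elim
    · exact hm.elim
    · have hn' : n < r + 1 := hn
      rw [weight3K_ne_zero] at hw
      simp only [blockFamily, IsSocleDegree3K] at hw
      left
      rw [show m = n by omega]
    · exact hm.elim
    · exact hn.elim
    · exact hn.elim
    · exact hn.elim

theorem triangular3K_2_1 (t : Option (ℕ ⊕ ℕ)) :
    paths3K p r e x 2 1 t ≠ 0 →
    traceForm ρ (tests3K p q r e x 2 1 t *
      paths3K p r e x 2 1 t) ≠ 0 ∧
    ∀ t', traceForm ρ (tests3K p q r e x 2 1 t *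
        paths3K p r e x 2 1 t') ≠ 0 →
      t' = t ∨ height3K p q 2 1 t' < height3K p q 2 1 t := by
  refine triangular_of_isMonomialAt (blockFamily False (· < r + 1) fun _ => False)
    (height3K p q 2 1) (ρ := ρ) (i := 2) (j := 1)
    (u := paths3K p r e x 2 1) (v := tests3K p q r e x 2 1)
    (D := blockFamily 0 (fun n => (0, 0, n, n + 1, 0, 0)) 0)
    (E := blockFamily 0 (fun n => (0, 0, r - n + 1, r - n, 0, 0)) 0) ?_ ?_ ?_ ?_ ?_ t
  · rintro (_ | n | n) hn
    · rfl
    · exact h.ηδ_pow_mul_eq_zero (not_lt.1 hn)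
    · rfl
  · rintro (_ | n | n) hn
    · exact hn.elim
    · exact isMonomialAt_pow_mul_eta hx n
    · exact hn.elim
  · rintro (_ | n | n) hn
    · exact hn.elim
    · exact isMonomialAt_pow_mul_delta hx _
    · exact hn.elim
  · rintro (_ | n | n) hn
    · exact hn.elim
    · have hn' : n < r + 1 := hn
      rw [weight3K_ne_zero]
      simp only [blockFamily, Prod.mk_add_mk]
      simp only [IsSocleDegree3K]
      right
      left
      refine ⟨?_, ?_, ?_, ?_, ?_, ?_⟩ <;> first | trivial | omega
    · exact hn.elim
  · rintro (_ | n | n) (_ | m | m) hn hm hw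
    · exact hn.elim
    · exact hn.elim
    · exact hn.elim
    · exact hm.elim
    · have hn' : n < r + 1 := hn
      rw [weight3K_ne_zero] at hw
      simp only [blockFamily, IsSocleDegree3K] at hw
      left
      rw [show m = n by omega]
    · exact hm.elim
    · exact hn.elim
    · exact hn.elim
    · exact hn.elim

theorem triangular3K_2_0 (t : Option (ℕ ⊕ ℕ)) :
    paths3K p r e x 2 0 t ≠ 0 →
    traceForm ρ (tests3K p q r e x 2 0 t *
      paths3K p r e x 2 0 t) ≠ 0 ∧
    ∀ t', traceForm ρ (tests3K p q r e x 2 0 t *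
        paths3K p r e x 2 0 t') ≠ 0 →
      t' = t ∨ height3K p q 2 0 t' < height3K p q 2 0 t := by
  refine triangular_of_isMonomialAt (blockFamily False (· < p + 2) fun _ => False)
    (height3K p q 2 0) (ρ := ρ) (i := 2) (j := 0)
    (u := paths3K p r e x 2 0) (v := tests3K p q r e x 2 0)
    (D := blockFamily 0 (fun n => (0, 0, 0, 0, n + 1, n)) 0)
    (E := blockFamily 0 (fun n => (0, 0, 0, 0, p + 1 - n, p + 1 - n + 1)) 0) ?_ ?_ ?_ ?_ ?_ t
  · rintro (_ | n | n) hn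
    · rfl
    · exact h.lκ_pow_mul_eq_zero (not_lt.1 hn)
    · rfl
  · rintro (_ | n | n) hn
    · exact hn.elim
    · exact isMonomialAt_pow_mul_lambda hx n
    · exact hn.elim
  · rintro (_ | n | n) hn
    · exact hn.elim
    · exact isMonomialAt_pow_mul_kappa hx _
    · exact hn.elim
  · rintro (_ | n | n) hn
    · exact hn.elim
    · have hn' : n < p + 2 := hn
      rw [weight3K_ne_zero]
      simp only [blockFamily, Prod.mk_add_mk]
      simp only [IsSocleDegree3K]
      right
      right
      left
      refine ⟨?_, ?_, ?_, ?_, ?_, ?_⟩ <;> first | trivial | omega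
    · exact hn.elim
  · rintro (_ | n | n) (_ | m | m) hn hm hw
    · exact hn.elim
    · exact hn.elim
    · exact hn.elim
    · exact hm.elim
    · have hn' : n < p + 2 := hn
      rw [weight3K_ne_zero] at hw
      simp only [blockFamily, IsSocleDegree3K] at hw
      left
      rw [show m = n by omega]
    · exact hm.elim
    · exact hn.elim
    · exact hn.elim
    · exact hn.elim

theorem triangular3K_0_2 (t : Option (ℕ ⊕ ℕ)) :
    paths3K p r e x 0 2 t ≠ 0 →
    traceForm ρ (tests3K p q r e x 0 2 t *
      paths3K p r e x 0 2 t) ≠ 0 ∧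
    ∀ t', traceForm ρ (tests3K p q r e x 0 2 t *
        paths3K p r e x 0 2 t') ≠ 0 →
      t' = t ∨ height3K p q 0 2 t' < height3K p q 0 2 t := by
  refine triangular_of_isMonomialAt (blockFamily False (· < p + 2) fun _ => False)
    (height3K p q 0 2) (ρ := ρ) (i := 0) (j := 2)
    (u := paths3K p r e x 0 2) (v := tests3K p q r e x 0 2)
    (D := blockFamily 0 (fun n => (0, 0, 0, 0, n, n + 1)) 0)
    (E := blockFamily 0 (fun n => (0, 0, 0, 0, p + 1 - n + 1, p + 1 - n)) 0) ?_ ?_ ?_ ?_ ?_ t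
  · rintro (_ | n | n) hn
    · rfl
    · exact h.κl_pow_mul_eq_zero (not_lt.1 hn)
    · rfl
  · rintro (_ | n | n) hn
    · exact hn.elim
    · exact isMonomialAt_pow_mul_kappa hx n
    · exact hn.elim
  · rintro (_ | n | n) hn
    · exact hn.elim
    · exact isMonomialAt_pow_mul_lambda hx _
    · exact hn.elim
  · rintro (_ | n | n) hn
    · exact hn.elim
    · have hn' : n < p + 2 := hn
      rw [weight3K_ne_zero]
      simp only [blockFamily, Prod.mk_add_mk]
      simp only [IsSocleDegree3K]
      right
      right
      left
      refine ⟨?_, ?_, ?_, ?_, ?_, ?_⟩ <;> first | trivial | omega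
    · exact hn.elim
  · rintro (_ | n | n) (_ | m | m) hn hm hw
    · exact hn.elim
    · exact hn.elim
    · exact hn.elim
    · exact hm.elim
    · have hn' : n < p + 2 := hn
      rw [weight3K_ne_zero] at hw
      simp only [blockFamily, IsSocleDegree3K] at hw
      left
      rw [show m = n by omega]
    · exact hm.elim
    · exact hn.elim
    · exact hn.elim
    · exact hn.elim


variable (he : ∀ i, IsMonomialAt ρ (e i) i i 0)
include he

/-- Vertex `0` is where the mixed degree interferes: for `r = 0` the test `βγ` of `(βγ)^(q+1)` also
sees `κλ`, and the test `κλ` of `(κλ)^(p+1)` also sees `βγ`. The heights 2 and 3 order these two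
coincidences. This is possible because `p > 0` keeps `κλ` itself at height 1; for `p = q = r = 0`
the Gram matrix of `βγ` and `κλ` would consist of ones. -/
theorem triangular3K_0_0 (hr : r = 0 → 0 < p) (t : Option (ℕ ⊕ ℕ)) :
    paths3K p r e x 0 0 t ≠ 0 →
    traceForm ρ (tests3K p q r e x 0 0 t * paths3K p r e x 0 0 t) ≠ 0 ∧
    ∀ t', traceForm ρ (tests3K p q r e x 0 0 t * paths3K p r e x 0 0 t') ≠ 0 →
      t' = t ∨ height3K p q 0 0 t' < height3K p q 0 0 t := by
  refine triangular_of_isMonomialAt (blockFamily True (· < q + 2) (· < p + 1))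
    (height3K p q 0 0) (ρ := ρ) (i := 0) (j := 0)
    (u := paths3K p r e x 0 0) (v := tests3K p q r e x 0 0)
    (D := blockFamily (0, 0, 0, 0, 0, 0) (fun n => (n + 1, n + 1, 0, 0, 0, 0)) fun n => (0, 0, 0, 0, n + 1, n + 1))
    (E := blockFamily (q + 1 + 1, q + 1 + 1, 0, 0, 0, 0) (fun n => (q + 1 - n, q + 1 - n, 0, 0, 0, 0))
      fun n => (0, 0, 0, 0, p + 1 - n, p + 1 - n)) ?_ ?_ ?_ ?_ ?_ t
  · rintro (_ | n | n) hn
    · exact (hn trivial).elim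
    · have hn' : ¬ n < q + 2 := hn
      exact h.βγ_pow_eq_zero (by omega)
    · exact if_neg hn
  · rintro (_ | n | n) hn
    · exact he 0
    · exact isMonomialAt_beta_gamma_pow hx n
    · exact (show paths3K p r e x 0 0 (some (inr n)) = _ from if_pos hn) ▸
        isMonomialAt_kappa_lambda_pow hx n
  · rintro (_ | n | n) hn
    · exact isMonomialAt_beta_gamma_pow hx _
    -- The factor `e 0` in the test matters at `n = q + 1`, where the exponent is zero and the test
    -- has to be the idempotent of the vertex instead of `1`.
    · exact ((isMonomialAt_beta_gamma hx).pow_mul (he 0) _).congr (by simp [blockFamily])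
    · exact ((isMonomialAt_kappa_lambda hx).pow_mul (he 0) _).congr (by simp [blockFamily])
  · rintro (_ | n | n) hn
    · rw [weight3K_ne_zero]
      simp only [blockFamily, Prod.mk_add_mk]
      simp only [IsSocleDegree3K]
      left
      refine ⟨?_, ?_, ?_, ?_, ?_, ?_⟩ <;> trivial
    · have hn' : n < q + 2 := hn
      rw [weight3K_ne_zero]
      simp only [blockFamily, Prod.mk_add_mk]
      simp only [IsSocleDegree3K]
      left
      refine ⟨?_, ?_, ?_, ?_, ?_, ?_⟩ <;> first | trivial | omega
    · have hn' : n < p + 1 := hn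
      rw [weight3K_ne_zero]
      simp only [blockFamily, Prod.mk_add_mk]
      simp only [IsSocleDegree3K]
      right
      right
      left
      refine ⟨?_, ?_, ?_, ?_, ?_, ?_⟩ <;> first | trivial | omega
  · rintro (_ | n | n) (_ | m | m) hn hm hw <;> rw [weight3K_ne_zero] at hw <;>
      simp only [blockFamily, Prod.mk_add_mk, add_zero, zero_add] at hw hn hm <;>
      have hw := isSocleDegree3K_cycles_iff.1 hw
    · exact Or.inl rfl
    · omega
    · omega
    · omega
    · simp only [height3K, blockFamily, Option.some.injEq, Sum.inl.injEq]
      omega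
    · simp only [height3K, blockFamily]
      split_ifs <;> omega
    · omega
    · simp only [height3K, blockFamily]
      split_ifs <;> omega
    · simp only [height3K, blockFamily, Option.some.injEq, Sum.inr.injEq]
      omega

/-- A degree mixing `βγ` with `δη` is never a socle degree, so at this vertex the pairing is
diagonal. -/
theorem triangular3K_1_1 (t : Option (ℕ ⊕ ℕ)) :
    paths3K p r e x 1 1 t ≠ 0 →
    traceForm ρ (tests3K p q r e x 1 1 t * paths3K p r e x 1 1 t) ≠ 0 ∧
    ∀ t', traceForm ρ (tests3K p q r e x 1 1 t * paths3K p r e x 1 1 t') ≠ 0 →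
      t' = t ∨ height3K p q 1 1 t' < height3K p q 1 1 t := by
  refine triangular_of_isMonomialAt (blockFamily True (· < q + 2) (· < r))
    (height3K p q 1 1) (ρ := ρ) (i := 1) (j := 1)
    (u := paths3K p r e x 1 1) (v := tests3K p q r e x 1 1)
    (D := blockFamily (0, 0, 0, 0, 0, 0) (fun n => (n + 1, n + 1, 0, 0, 0, 0)) fun n => (0, 0, n + 1, n + 1, 0, 0))
    (E := blockFamily (q + 1 + 1, q + 1 + 1, 0, 0, 0, 0) (fun n => (q + 1 - n, q + 1 - n, 0, 0, 0, 0))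
      fun n => (0, 0, r - n, r - n, 0, 0)) ?_ ?_ ?_ ?_ ?_ t
  · rintro (_ | n | n) hn
    · exact (hn trivial).elim
    · have hn' : ¬ n < q + 2 := hn
      exact h.γβ_pow_eq_zero (by omega)
    · exact if_neg hn
  · rintro (_ | n | n) hn
    · exact he 1
    · exact isMonomialAt_gamma_beta_pow hx n
    · exact (show paths3K p r e x 1 1 (some (inr n)) = _ from if_pos hn) ▸
        isMonomialAt_delta_eta_pow hx n
  · rintro (_ | n | n) hn
    · exact isMonomialAt_gamma_beta_pow hx _
    · exact ((isMonomialAt_gamma_beta hx).pow_mul (he 1) _).congr (by simp [blockFamily])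
    · exact ((isMonomialAt_delta_eta hx).pow_mul (he 1) _).congr (by simp [blockFamily])
  · rintro (_ | n | n) hn
    · rw [weight3K_ne_zero]
      simp only [blockFamily, Prod.mk_add_mk]
      simp only [IsSocleDegree3K]
      left
      refine ⟨?_, ?_, ?_, ?_, ?_, ?_⟩ <;> trivial
    · have hn' : n < q + 2 := hn
      rw [weight3K_ne_zero]
      simp only [blockFamily, Prod.mk_add_mk]
      simp only [IsSocleDegree3K]
      left
      refine ⟨?_, ?_, ?_, ?_, ?_, ?_⟩ <;> first | trivial | omega
    · have hn' : n < r := hn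
      rw [weight3K_ne_zero]
      simp only [blockFamily, Prod.mk_add_mk]
      simp only [IsSocleDegree3K]
      right
      left
      refine ⟨?_, ?_, ?_, ?_, ?_, ?_⟩ <;> first | trivial | omega
  · rintro (_ | n | n) (_ | m | m) hn hm hw <;> rw [weight3K_ne_zero] at hw <;>
      simp only [blockFamily, Prod.mk_add_mk, add_zero, zero_add] at hw hn hm <;>
      have hw := isSocleDegree3K_cycles_iff.1 hw
    · exact Or.inl rfl
    · omega
    · omega
    · omega
    · simp only [height3K, Option.some.injEq, Sum.inl.injEq]
      omega
    · omega
    · omega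
    · omega
    · simp only [height3K, Option.some.injEq, Sum.inr.injEq]
      omega

theorem triangular3K_2_2 (t : Option (ℕ ⊕ ℕ)) :
    paths3K p r e x 2 2 t ≠ 0 →
    traceForm ρ (tests3K p q r e x 2 2 t * paths3K p r e x 2 2 t) ≠ 0 ∧
    ∀ t', traceForm ρ (tests3K p q r e x 2 2 t * paths3K p r e x 2 2 t') ≠ 0 →
      t' = t ∨ height3K p q 2 2 t' < height3K p q 2 2 t := by
  refine triangular_of_isMonomialAt (blockFamily True (· < p + 2) (· < r))
    (height3K p q 2 2) (ρ := ρ) (i := 2) (j := 2)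
    (u := paths3K p r e x 2 2) (v := tests3K p q r e x 2 2)
    (D := blockFamily (0, 0, 0, 0, 0, 0) (fun n => (0, 0, 0, 0, n + 1, n + 1)) fun n => (0, 0, n + 1, n + 1, 0, 0))
    (E := blockFamily (0, 0, 0, 0, p + 1 + 1, p + 1 + 1) (fun n => (0, 0, 0, 0, p + 1 - n, p + 1 - n))
      fun n => (0, 0, r - n, r - n, 0, 0)) ?_ ?_ ?_ ?_ ?_ t
  · rintro (_ | n | n) hn
    · exact (hn trivial).elim
    · have hn' : ¬ n < p + 2 := hn
      exact h.lκ_pow_eq_zero (by omega)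
    · exact if_neg hn
  · rintro (_ | n | n) hn
    · exact he 2
    · exact isMonomialAt_lambda_kappa_pow hx n
    · exact (show paths3K p r e x 2 2 (some (inr n)) = _ from if_pos hn) ▸
        isMonomialAt_eta_delta_pow hx n
  · rintro (_ | n | n) hn
    · exact isMonomialAt_lambda_kappa_pow hx _
    · exact ((isMonomialAt_lambda_kappa hx).pow_mul (he 2) _).congr (by simp [blockFamily])
    · exact ((isMonomialAt_eta_delta hx).pow_mul (he 2) _).congr (by simp [blockFamily])
  · rintro (_ | n | n) hn
    · rw [weight3K_ne_zero]
      simp only [blockFamily, Prod.mk_add_mk]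
      simp only [IsSocleDegree3K]
      right
      right
      left
      refine ⟨?_, ?_, ?_, ?_, ?_, ?_⟩ <;> trivial
    · have hn' : n < p + 2 := hn
      rw [weight3K_ne_zero]
      simp only [blockFamily, Prod.mk_add_mk]
      simp only [IsSocleDegree3K]
      right
      right
      left
      refine ⟨?_, ?_, ?_, ?_, ?_, ?_⟩ <;> first | trivial | omega
    · have hn' : n < r := hn
      rw [weight3K_ne_zero]
      simp only [blockFamily, Prod.mk_add_mk]
      simp only [IsSocleDegree3K]
      right
      left
      refine ⟨?_, ?_, ?_, ?_, ?_, ?_⟩ <;> first | trivial | omega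
  · rintro (_ | n | n) (_ | m | m) hn hm hw <;> rw [weight3K_ne_zero] at hw <;>
      simp only [blockFamily, Prod.mk_add_mk, add_zero, zero_add] at hw hn hm <;>
      have hw := isSocleDegree3K_cycles_iff.1 hw
    · exact Or.inl rfl
    · omega
    · omega
    · omega
    · simp only [height3K, Option.some.injEq, Sum.inl.injEq]
      omega
    · omega
    · omega
    · omega
    · simp only [height3K, Option.some.injEq, Sum.inr.injEq]
      omega

end Q3K

/-! ### From a triangular pairing to the stable centre -/

section Triangular

open AlgBimodule

variable {K A : Type u} {ι : Type*} [Field K] [Ring A] [Algebra K A] [Fintype ι] [DecidableEq ι]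

/-- The tests lie in the kernels of the characters, so they vanish on decomposable elements and
yield linear forms on the stable centre. The map `σ` matches a monomial with the test that detects
it. -/
theorem SplitSymmetric.nilradicalPowRank_of_triangular (S : SplitSymmetric K A ι) {κ : Type}
    [Fintype κ] (n : κ → ℕ) (x : κ → Subalgebra.center K A) (t : Option (Σ i, Fin (n i - 1)) → A)
    (ht : ∀ z : Subalgebra.center K A, (∀ j, S.φ (z * t j) = 0) → z ∈ decomposableIdeal K A)
    (hχ : ∀ i j, S.χ i (t j) = 0)
    (σ : Option (Σ i, Fin (n i - 1)) → Option (Σ i, Fin (n i - 1)))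
    (height : Option (Σ i, Fin (n i - 1)) → ℕ)
    (h1 : ∀ j, S.φ ((wedgeMonomial n x j : Subalgebra.center K A) * t (σ j)) ≠ 0)
    (h2 : ∀ j j', S.φ ((wedgeMonomial n x j' : Subalgebra.center K A) * t (σ j)) ≠ 0 →
      j' = j ∨ height j' < height j)
    (hx : ∀ i j, i ≠ j → x i * x j ∈ decomposableIdeal K A)
    (hx' : ∀ i, x i ^ n i ∈ decomposableIdeal K A) (k : ℕ) :
    nilradicalPowRank K (StableCenter K A) (k + 1) = ∑ i, (n i - (k + 1)) := by
  refine S.nilradicalPowRank_stableCenter n x t ht (fun c hc j => ?_) hx hx' k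
  let f (j : Option (Σ i, Fin (n i - 1))) : Subalgebra.center K A →ₗ[K] K :=
    S.φ ∘ₗ LinearMap.mulRight K (t (σ j)) ∘ₗ (Subalgebra.center K A).val.toLinearMap
  have h := smul_eq_zero_of_triangular (wedgeMonomial n x) f height
    (fun j _ => ⟨h1 j, h2 j⟩) ((Finsupp.linearEquivFunOnFinite K K _).symm c) (fun j _ => by
      rw [Finsupp.linearCombination_eq_fintype_linearCombination_apply K, Fintype.linearCombination_apply]
      exact S.φ_eq_zero_of_mem hc fun i => hχ i _) j
  refine (smul_eq_zero.1 h).resolve_right fun h0 => h1 j ?_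
  rw [h0]
  change S.φ ((0 : A) * _) = 0
  rw [zero_mul, map_zero]

/-- Cyclicity of the trace and centrality of `z` allow a cycle to be rotated, so each two-cycle has
to be tested at one of its vertices only. -/
theorem traceForm_mul_pow_comm {M : Type} {V B : Type*}
    [AddCommMonoid M] [Fintype V] [DecidableEq V] [Ring B] [Algebra K B] {w : M → K}
    {ρ : B →ₐ[K] Matrix V V (WeightRing w)} (z : Subalgebra.center K B) (a b : B) (n : ℕ) :
    traceForm ρ (z * (a * b) ^ (n + 1)) = traceForm ρ (z * (b * a) ^ (n + 1)) := by
  rw [pow_succ, ← mul_assoc _ a b, ← mul_assoc, traceForm_mul_comm, ← mul_assoc,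
    Subalgebra.mem_center_iff.1 z.2, mul_assoc, ← mul_assoc b, mul_mul_pow_eq, mul_assoc _ b a,
    ← pow_succ]

end Triangular

/-! ### Peirce components and central elements of type `3K` -/

section Presentation

open ArrowQuiver Sum

/-- An algebra which is given by the quiver of type `3K` and the relations of
`Q(3K)^{p+2,q+2,r+1}`, together with its characters and its representation by matrices of
monomials. -/
structure Presentation3K (K A : Type u) [Field K] [Ring A] [Algebra K A] (p q r : ℕ) where
  /-- the presentation -/
  f : PathAlgebra K quiver3K →ₐ[K] A
  surjective : Function.Surjective f
  relations : Relations3K p q r (f (arrow K quiver3K .beta)) (f (arrow K quiver3K .gamma))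
    (f (arrow K quiver3K .delta)) (f (arrow K quiver3K .eta)) (f (arrow K quiver3K .lambda))
    (f (arrow K quiver3K .kappa))
  /-- the characters -/
  χ : Fin 3 → A →ₐ[K] K
  χ_vertex (i j : Fin 3) : χ i (f (quiver3K.vertex K j)) = if i = j then 1 else 0
  /-- the representation -/
  ρ : A →ₐ[K] Matrix (Fin 3) (Fin 3) (WeightRing (weight3K K p q r))
  ρ_f (a : PathAlgebra K quiver3K) :
    ρ (f a) = matrixRep (fun y => weightMonomial _ (degree3K y)) a

namespace Presentation3K

variable {K A : Type u} [Field K] [Ring A] [Algebra K A] {p q r : ℕ} (P : Presentation3K K A p q r)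

/-- The images of the arrows. -/
def x (y : Arrow3K) : A := P.f (arrow K quiver3K y)

/-- The images of the vertices. -/
def e (i : Fin 3) : A := P.f (quiver3K.vertex K i)

theorem relations_x : Relations3K p q r (P.x .beta) (P.x .gamma) (P.x .delta) (P.x .eta)
    (P.x .lambda) (P.x .kappa) := P.relations

theorem ρ_x (y : Arrow3K) :
    IsMonomialAt P.ρ (P.x y) (quiver3K.source y) (quiver3K.target y) (degree3K y) :=
  (P.ρ_f _).trans (matrixRep_arrow _ y)

theorem ρ_e (i : Fin 3) : IsMonomialAt P.ρ (P.e i) i i 0 :=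
  (P.ρ_f _).trans (matrixRep_vertex _ i)

theorem nilpotent_paths (i : Fin 3) (t : ℕ ⊕ ℕ) :
    IsNilpotent (paths3K p r P.e P.x i i (some t)) := by
  have h := P.relations_x
  have hpow {a : A} {N : ℕ} (ha : a ^ N = 0) (n : ℕ) : IsNilpotent (a ^ (n + 1)) :=
    IsNilpotent.pow_succ n ⟨N, ha⟩
  have hite {a : A} (ha : IsNilpotent a) (c : Prop) [Decidable c] :
      IsNilpotent (if c then a else 0) := by
    split_ifs
    · exact ha
    · exact IsNilpotent.zero
  match i, t with
  | 0, inl n => exact hpow (h.βγ_pow_eq_zero le_rfl) n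
  | 1, inl n => exact hpow (h.γβ_pow_eq_zero le_rfl) n
  | 2, inl n => exact hpow (h.lκ_pow_eq_zero le_rfl) n
  | 0, inr n => exact hite (hpow (h.κl_pow_eq_zero le_rfl) n) _
  | 1, inr n => exact hite (hpow (h.δη_pow_eq_zero le_rfl) n) _
  | 2, inr n => exact hite (hpow (h.ηδ_pow_eq_zero le_rfl) n) _

theorem finite_paths (i j : Fin 3) : {t | paths3K p r P.e P.x i j (some t) ≠ 0}.Finite := by
  have h := P.relations_x
  refine ((Set.finite_Iio (p + q + r + 3)).image inl |>.union
    ((Set.finite_Iio (p + q + r + 3)).image inr)).subset fun t ht => ?_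
  by_contra ht'
  refine ht ?_
  have hN (n : ℕ) (hn : t = inl n ∨ t = inr n) : p + q + r + 3 ≤ n := by
    by_contra hn'
    obtain rfl | rfl := hn
    · exact ht' (Or.inl ⟨n, not_le.1 hn', rfl⟩)
    · exact ht' (Or.inr ⟨n, not_le.1 hn', rfl⟩)
  match i, j, t with
  | 0, 0, inl n =>
    have := hN n (Or.inl rfl)
    exact h.βγ_pow_eq_zero (by omega)
  | 0, 0, inr n =>
    have := hN n (Or.inr rfl)
    exact if_neg (by omega)
  | 0, 1, inl n =>
    have := hN n (Or.inl rfl)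
    exact h.βγ_pow_mul_eq_zero (by omega)
  | 0, 1, inr n => rfl
  | 0, 2, inl n =>
    have := hN n (Or.inl rfl)
    exact h.κl_pow_mul_eq_zero (by omega)
  | 0, 2, inr n => rfl
  | 1, 0, inl n =>
    have := hN n (Or.inl rfl)
    exact h.γβ_pow_mul_eq_zero (by omega)
  | 1, 0, inr n => rfl
  | 1, 1, inl n =>
    have := hN n (Or.inl rfl)
    exact h.γβ_pow_eq_zero (by omega)
  | 1, 1, inr n =>
    have := hN n (Or.inr rfl)
    exact if_neg (by omega)
  | 1, 2, inl n =>
    have := hN n (Or.inl rfl)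
    exact h.δη_pow_mul_eq_zero (by omega)
  | 1, 2, inr n => rfl
  | 2, 0, inl n =>
    have := hN n (Or.inl rfl)
    exact h.lκ_pow_mul_eq_zero (by omega)
  | 2, 0, inr n => rfl
  | 2, 1, inl n =>
    have := hN n (Or.inl rfl)
    exact h.ηδ_pow_mul_eq_zero (by omega)
  | 2, 1, inr n => rfl
  | 2, 2, inl n =>
    have := hN n (Or.inl rfl)
    exact h.lκ_pow_eq_zero (by omega)
  | 2, 2, inr n =>
    have := hN n (Or.inr rfl)
    exact if_neg (by omega)

/-- The paths along the cycles of length two span the Peirce components. -/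
noncomputable def peirceSpanning (hr : r = 0 → 0 < p) :
    PeirceSpanning K A (Fin 3) (ℕ ⊕ ℕ) (weight3K K p q r) where
  e := P.e
  χ := P.χ
  ρ := P.ρ
  u := paths3K p r P.e P.x
  sum_e := by
    have h := congrArg P.f (sum_vertex (q := quiver3K) (K := K))
    rwa [map_sum, map_one] at h
  e_mul_e i j := by
    rw [e, e, ← map_mul]
    split_ifs with hij
    · rw [← hij, vertex_mul_self]
    · rw [vertex_mul_of_ne hij, map_zero]
  χ_e := P.χ_vertex
  u_none
    | 0, 0 => rfl
    | 0, 1 => rfl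
    | 0, 2 => rfl
    | 1, 0 => rfl
    | 1, 1 => rfl
    | 1, 2 => rfl
    | 2, 0 => rfl
    | 2, 1 => rfl
    | 2, 2 => rfl
  mem_span := by
    refine mem_span_of_surjective P.surjective _ ?_ ?_
    · intro i
      match i with
      | 0 => rfl
      | 1 => rfl
      | 2 => rfl
    · refine P.relations_x.arrow_mul_path_mem fun y => ?_
      rw [x, e, ← map_mul, arrow_mul_target]
  nilpotent := P.nilpotent_paths
  finite := P.finite_paths
  v := tests3K p q r P.e P.x
  height := height3K p q
  triangular
    | 0, 0 => triangular3K_0_0 P.relations_x P.ρ_x P.ρ_e hr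
    | 0, 1 => triangular3K_0_1 P.relations_x P.ρ_x
    | 0, 2 => triangular3K_0_2 P.relations_x P.ρ_x
    | 1, 0 => triangular3K_1_0 P.relations_x P.ρ_x
    | 1, 1 => triangular3K_1_1 P.relations_x P.ρ_x P.ρ_e
    | 1, 2 => triangular3K_1_2 P.relations_x P.ρ_x
    | 2, 0 => triangular3K_2_0 P.relations_x P.ρ_x
    | 2, 1 => triangular3K_2_1 P.relations_x P.ρ_x
    | 2, 2 => triangular3K_2_2 P.relations_x P.ρ_x P.ρ_e

/-- The cycles of length two at the vertices `0`, `0`, `1`. -/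
def cycle : Fin 3 → A
  | 0 => P.x .kappa * P.x .lambda
  | 1 => P.x .beta * P.x .gamma
  | 2 => P.x .delta * P.x .eta

/-- The exponents of the generators of the stable center. -/
def _root_.exponent3K (p q r : ℕ) : Fin 3 → ℕ
  | 0 => p + 2
  | 1 => q + 2
  | 2 => r + 1

/-- The elements which test for the members of the stable center. -/
def test : Option (Σ i, Fin (exponent3K p q r i - 1)) → A
  | none => (P.x .beta * P.x .gamma) ^ (q + 1 + 1)
  | some t => P.cycle t.1 ^ (t.2.1 + 1)

theorem χ_test (i : Fin 3) (j : Option (Σ i, Fin (exponent3K p q r i - 1))) :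
    P.χ i (P.test j) = 0 := by
  have h := P.relations_x
  have hpow {a : A} {N : ℕ} (ha : a ^ N = 0) (n : ℕ) : P.χ i (a ^ (n + 1)) = 0 :=
    ((IsNilpotent.pow_succ n ⟨N, ha⟩).map (P.χ i)).eq_zero
  match j with
  | none => exact hpow (h.βγ_pow_eq_zero le_rfl) _
  | some ⟨0, n⟩ => exact hpow (h.κl_pow_eq_zero le_rfl) _
  | some ⟨1, n⟩ => exact hpow (h.βγ_pow_eq_zero le_rfl) _
  | some ⟨2, n⟩ => exact hpow (h.δη_pow_eq_zero le_rfl) _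

open AlgBimodule

/-- Up to rotation, and since the top powers at vertex `0` coincide, the tests exhaust the
non-idempotent paths in the diagonal Peirce components. -/
theorem mem_decomposableIdeal (hr : r = 0 → 0 < p) (z : Subalgebra.center K A)
    (hz : ∀ j, traceForm P.ρ (z * P.test j) = 0) : z ∈ decomposableIdeal K A := by
  have h := P.relations_x
  have h0 : traceForm P.ρ ((z : A) * 0) = 0 := by rw [mul_zero, map_zero]
  have hβγ (n : ℕ) : traceForm P.ρ (z * (P.x .beta * P.x .gamma) ^ (n + 1)) = 0 := by
    obtain hn | hn | hn : n < q + 1 ∨ n = q + 1 ∨ q + 2 ≤ n := by omega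
    · exact hz (some ⟨1, n, hn⟩)
    · exact hn ▸ hz none
    · rw [h.βγ_pow_eq_zero (by omega), h0]
  have hκl (n : ℕ) : traceForm P.ρ (z * (P.x .kappa * P.x .lambda) ^ (n + 1)) = 0 := by
    obtain hn | hn | hn : n < p + 1 ∨ n = p + 1 ∨ p + 2 ≤ n := by omega
    · exact hz (some ⟨0, n, hn⟩)
    · rw [hn, ← h.βγ_pow]
      exact hz none
    · rw [h.κl_pow_eq_zero (by omega), h0]
  have hite {a : A} (c : Prop) [Decidable c] (ha : c → traceForm P.ρ (z * a) = 0) :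
      traceForm P.ρ (z * if c then a else 0) = 0 := by
    split_ifs with hc
    · exact ha hc
    · exact h0
  refine (P.peirceSpanning hr).mem_decomposableIdeal z fun i t => ?_
  match i, t with
  | 0, inl n => exact hβγ n
  | 0, inr n => exact hite _ fun _ => hκl n
  | 1, inl n => exact (traceForm_mul_pow_comm z _ _ n).trans (hβγ n)
  | 1, inr n => exact hite _ fun hn => hz (some ⟨2, n, hn⟩)
  | 2, inl n => exact (traceForm_mul_pow_comm z _ _ n).trans (hκl n)
  | 2, inr n =>
    exact hite _ fun hn => (traceForm_mul_pow_comm z _ _ n).trans (hz (some ⟨2, n, hn⟩))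

/-- The diagonal matrices which are the images of the central elements. -/
noncomputable def diag (K : Type u) [Field K] (p q r : ℕ) :
    Fin 3 → Fin 3 → WeightRing (weight3K K p q r)
  | 0, 0 => weightMonomial _ (0, 0, 0, 0, 1, 1)
  | 0, 1 => if r = 0 then weightMonomial _ (q + 1, q + 1, 0, 0, 0, 0) else 0
  | 0, 2 => weightMonomial _ (0, 0, 0, 0, 1, 1)
  | 1, 0 => weightMonomial _ (1, 1, 0, 0, 0, 0)
  | 1, 1 => weightMonomial _ (1, 1, 0, 0, 0, 0)
  | 1, 2 => if r = 0 then weightMonomial _ (0, 0, 0, 0, p + 1, p + 1) else 0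
  | 2, 0 => 0
  | 2, 1 => weightMonomial _ (0, 0, 1, 1, 0, 0)
  | 2, 2 => weightMonomial _ (0, 0, 1, 1, 0, 0)

/-- Representatives of the generators of the stable center. -/
def centralElement : Fin 3 → A
  | 0 => P.x .kappa * P.x .lambda + P.x .lambda * P.x .kappa +
      if r = 0 then (P.x .gamma * P.x .beta) ^ (q + 1) else 0
  | 1 => P.x .beta * P.x .gamma + P.x .gamma * P.x .beta +
      if r = 0 then (P.x .lambda * P.x .kappa) ^ (p + 1) else 0
  | 2 => P.x .delta * P.x .eta + P.x .eta * P.x .delta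

theorem ρ_centralElement (i : Fin 3) :
    P.ρ (P.centralElement i) = Matrix.diagonal (diag K p q r i) := by
  have hd (d : Fin 3 → WeightRing (weight3K K p q r)) : Matrix.diagonal d =
      Matrix.single 0 0 (d 0) + Matrix.single 1 1 (d 1) + Matrix.single 2 2 (d 2) := by
    ext i j
    fin_cases i <;> fin_cases j <;> simp
  have hite (i : Fin 3) (a : A) (m) (h : IsMonomialAt P.ρ a i i m) :
      P.ρ (if r = 0 then a else 0) =
        Matrix.single i i (if r = 0 then weightMonomial _ m else 0) := by
    split_ifs
    · exact h
    · rw [map_zero, Matrix.single_zero]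
  rw [hd]
  match i with
  | 0 =>
    rw [centralElement, map_add, map_add, isMonomialAt_kappa_lambda P.ρ_x,
      isMonomialAt_lambda_kappa P.ρ_x, hite 1 _ _ (isMonomialAt_gamma_beta_pow P.ρ_x q)]
    exact add_right_comm _ _ _
  | 1 =>
    rw [centralElement, map_add, map_add, isMonomialAt_beta_gamma P.ρ_x,
      isMonomialAt_gamma_beta P.ρ_x, hite 2 _ _ (isMonomialAt_lambda_kappa_pow P.ρ_x p)]
    rfl
  | 2 =>
    rw [centralElement, map_add, isMonomialAt_delta_eta P.ρ_x, isMonomialAt_eta_delta P.ρ_x]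
    simp [diag]

end Presentation3K

end Presentation

/-! ### The stable centre of type `3K` -/

section Presentation

open ArrowQuiver Sum

namespace Presentation3K

variable {K : Type u} [Field K] {p q r : ℕ}

theorem weightMonomial3K_mul_eq_zero {m n : ℕ × ℕ × ℕ × ℕ × ℕ × ℕ}
    (h : ∀ l, ¬ IsSocleDegree3K p q r (m + n + l)) :
    weightMonomial (weight3K K p q r) m * weightMonomial (weight3K K p q r) n = 0 := by
  rw [weightMonomial_mul]
  exact weightMonomial_eq_zero _ fun l => weight3K_eq_zero (h l)

theorem weightMonomial3K_mul_eq {m n m' n' : ℕ × ℕ × ℕ × ℕ × ℕ × ℕ}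
    (h : ∀ l, IsSocleDegree3K p q r (m + n + l) ↔ IsSocleDegree3K p q r (m' + n' + l)) :
    weightMonomial (weight3K K p q r) m * weightMonomial (weight3K K p q r) n =
    weightMonomial (weight3K K p q r) m' * weightMonomial (weight3K K p q r) n' := by
  rw [weightMonomial_mul, weightMonomial_mul]
  exact weightMonomial_eq _ fun l => weight3K_congr (h l)

/-- The correction terms for `r = 0` are forced. From `κλβ = κη = (βγ)^(q+1) β` the entry of the
first element at vertex `1` must be `(γβ)^(q+1)`; from `λβγ = ηγ = (λκ)^(p+1) λ` the entry of the
second at vertex `2` must be `(λκ)^(p+1)`. For `r > 0` these products vanish and no correction is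
needed. -/
theorem diag_mul_arrow (i : Fin 3) (y : Arrow3K) :
    diag K p q r i (quiver3K.source y) * weightMonomial _ (degree3K y) =
      weightMonomial _ (degree3K y) * diag K p q r i (quiver3K.target y) :=
  match i, y with
  | 0, .beta => by
    change weightMonomial _ _ * weightMonomial _ (1, 0, 0, 0, 0, 0) =
      weightMonomial _ (1, 0, 0, 0, 0, 0) * if r = 0 then weightMonomial _ _ else 0
    split_ifs with hr
    · refine weightMonomial3K_mul_eq ?_
      rintro ⟨b, g, d, h, l, k⟩
      simp only [Prod.mk_add_mk, IsSocleDegree3K]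
      refine ⟨?_, ?_⟩ <;> rintro (h | h | h | h | h | h) <;>
        first | (exfalso; omega) | (left; omega) | (right; right; right; right; right; omega)
    · rw [mul_zero]
      refine weightMonomial3K_mul_eq_zero ?_
      rintro ⟨b, g, d, h, l, k⟩
      simp only [Prod.mk_add_mk, IsSocleDegree3K]
      omega
  | 0, .gamma => by
    change (if r = 0 then weightMonomial _ _ else 0) * weightMonomial _ (0, 1, 0, 0, 0, 0) =
      weightMonomial _ (0, 1, 0, 0, 0, 0) * weightMonomial _ _
    split_ifs with hr
    · refine weightMonomial3K_mul_eq ?_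
      rintro ⟨b, g, d, h, l, k⟩
      simp only [Prod.mk_add_mk, IsSocleDegree3K]
      refine ⟨?_, ?_⟩ <;> rintro (h | h | h | h | h | h) <;>
        first | (exfalso; omega) | (left; omega) | (right; right; right; right; right; omega)
    · rw [zero_mul]
      refine (weightMonomial3K_mul_eq_zero ?_).symm
      rintro ⟨b, g, d, h, l, k⟩
      simp only [Prod.mk_add_mk, IsSocleDegree3K]
      omega
  | 0, .delta => by
    change (if r = 0 then weightMonomial _ _ else 0) * weightMonomial _ (0, 0, 1, 0, 0, 0) =
      weightMonomial _ (0, 0, 1, 0, 0, 0) * weightMonomial _ _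
    rw [ite_mul, zero_mul, weightMonomial3K_mul_eq_zero, weightMonomial3K_mul_eq_zero, ite_self] <;>
      rintro ⟨b, g, d, h, l, k⟩ <;> simp only [Prod.mk_add_mk, IsSocleDegree3K] <;> omega
  | 0, .eta => by
    change weightMonomial _ _ * weightMonomial _ (0, 0, 0, 1, 0, 0) =
      weightMonomial _ (0, 0, 0, 1, 0, 0) * if r = 0 then weightMonomial _ _ else 0
    rw [mul_ite, mul_zero, weightMonomial3K_mul_eq_zero, weightMonomial3K_mul_eq_zero, ite_self] <;>
      rintro ⟨b, g, d, h, l, k⟩ <;> simp only [Prod.mk_add_mk, IsSocleDegree3K] <;> omega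
  | 0, .lambda => mul_comm _ _
  | 0, .kappa => mul_comm _ _
  | 1, .beta => mul_comm _ _
  | 1, .gamma => mul_comm _ _
  | 1, .delta => by
    change weightMonomial _ _ * weightMonomial _ (0, 0, 1, 0, 0, 0) =
      weightMonomial _ (0, 0, 1, 0, 0, 0) * if r = 0 then weightMonomial _ _ else 0
    rw [mul_ite, mul_zero, weightMonomial3K_mul_eq_zero, weightMonomial3K_mul_eq_zero, ite_self] <;>
      rintro ⟨b, g, d, h, l, k⟩ <;> simp only [Prod.mk_add_mk, IsSocleDegree3K] <;> omega
  | 1, .eta => by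
    change (if r = 0 then weightMonomial _ _ else 0) * weightMonomial _ (0, 0, 0, 1, 0, 0) =
      weightMonomial _ (0, 0, 0, 1, 0, 0) * weightMonomial _ _
    rw [ite_mul, zero_mul, weightMonomial3K_mul_eq_zero, weightMonomial3K_mul_eq_zero, ite_self] <;>
      rintro ⟨b, g, d, h, l, k⟩ <;> simp only [Prod.mk_add_mk, IsSocleDegree3K] <;> omega
  | 1, .lambda => by
    change (if r = 0 then weightMonomial _ _ else 0) * weightMonomial _ (0, 0, 0, 0, 1, 0) =
      weightMonomial _ (0, 0, 0, 0, 1, 0) * weightMonomial _ _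
    split_ifs with hr
    · refine weightMonomial3K_mul_eq ?_
      rintro ⟨b, g, d, h, l, k⟩
      simp only [Prod.mk_add_mk, IsSocleDegree3K]
      refine ⟨?_, ?_⟩ <;> rintro (h | h | h | h | h | h) <;>
        first | (exfalso; omega) | (right; right; left; omega) |
          (right; right; right; right; right; omega)
    · rw [zero_mul]
      refine (weightMonomial3K_mul_eq_zero ?_).symm
      rintro ⟨b, g, d, h, l, k⟩
      simp only [Prod.mk_add_mk, IsSocleDegree3K]
      omega
  | 1, .kappa => by
    change weightMonomial _ _ * weightMonomial _ (0, 0, 0, 0, 0, 1) =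
      weightMonomial _ (0, 0, 0, 0, 0, 1) * if r = 0 then weightMonomial _ _ else 0
    split_ifs with hr
    · refine weightMonomial3K_mul_eq ?_
      rintro ⟨b, g, d, h, l, k⟩
      simp only [Prod.mk_add_mk, IsSocleDegree3K]
      refine ⟨?_, ?_⟩ <;> rintro (h | h | h | h | h | h) <;>
        first | (exfalso; omega) | (right; right; left; omega) |
          (right; right; right; right; right; omega)
    · rw [mul_zero]
      refine weightMonomial3K_mul_eq_zero ?_
      rintro ⟨b, g, d, h, l, k⟩
      simp only [Prod.mk_add_mk, IsSocleDegree3K]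
      omega
  | 2, .beta => by
    refine (zero_mul _).trans (Eq.symm ?_)
    change weightMonomial _ (1, 0, 0, 0, 0, 0) * weightMonomial _ _ = 0
    refine weightMonomial3K_mul_eq_zero ?_
    rintro ⟨b, g, d, h, l, k⟩
    simp only [Prod.mk_add_mk, IsSocleDegree3K]
    omega
  | 2, .gamma => by
    refine Eq.trans ?_ (mul_zero _).symm
    change weightMonomial _ _ * weightMonomial _ (0, 1, 0, 0, 0, 0) = 0
    refine weightMonomial3K_mul_eq_zero ?_
    rintro ⟨b, g, d, h, l, k⟩
    simp only [Prod.mk_add_mk, IsSocleDegree3K]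
    omega
  | 2, .delta => mul_comm _ _
  | 2, .eta => mul_comm _ _
  | 2, .lambda => by
    refine Eq.trans ?_ (mul_zero _).symm
    change weightMonomial _ _ * weightMonomial _ (0, 0, 0, 0, 1, 0) = 0
    refine weightMonomial3K_mul_eq_zero ?_
    rintro ⟨b, g, d, h, l, k⟩
    simp only [Prod.mk_add_mk, IsSocleDegree3K]
    omega
  | 2, .kappa => by
    refine (zero_mul _).trans (Eq.symm ?_)
    change weightMonomial _ (0, 0, 0, 0, 0, 1) * weightMonomial _ _ = 0
    refine weightMonomial3K_mul_eq_zero ?_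
    rintro ⟨b, g, d, h, l, k⟩
    simp only [Prod.mk_add_mk, IsSocleDegree3K]
    omega

variable {A : Type u} [Ring A] [Algebra K A] (P : Presentation3K K A p q r)

theorem centralElement_mem_center (hr : r = 0 → 0 < p) (i : Fin 3) :
    P.centralElement i ∈ Subalgebra.center K A :=
  mem_center_of_surjective P.surjective (P.peirceSpanning hr).ρ_injective P.ρ_f
    (P.ρ_centralElement i) (diag_mul_arrow i)

open AlgBimodule

/-- The vertices at which the cycles start. -/
def cycleVertex : Fin 3 → Fin 3
  | 0 => 0
  | 1 => 0
  | 2 => 1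

/-- The degrees of the powers of the cycles. -/
def cycleDegree (n : ℕ) : Fin 3 → ℕ × ℕ × ℕ × ℕ × ℕ × ℕ
  | 0 => (0, 0, 0, 0, n, n)
  | 1 => (n, n, 0, 0, 0, 0)
  | 2 => (0, 0, n, n, 0, 0)

theorem isMonomialAt_cycle_pow (i : Fin 3) (n : ℕ) :
    IsMonomialAt P.ρ (P.cycle i ^ (n + 1)) (cycleVertex i) (cycleVertex i)
      (cycleDegree (n + 1) i) :=
  match i with
  | 0 => isMonomialAt_kappa_lambda_pow P.ρ_x n
  | 1 => isMonomialAt_beta_gamma_pow P.ρ_x n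
  | 2 => isMonomialAt_delta_eta_pow P.ρ_x n

/-- All tests sit at the vertices `0` and `1`, and those at `1` exist only for `r ≠ 0`. So two
diagonal entries decide. -/
theorem mem_decomposableIdeal_of_diagonal (hr : r = 0 → 0 < p) (z : Subalgebra.center K A)
    {d : Fin 3 → WeightRing (weight3K K p q r)} (hz : P.ρ z = Matrix.diagonal d)
    (h0 : d 0 = 0 ∨ ∃ m, d 0 = weightMonomial _ m ∧
      ∀ n, ¬ IsSocleDegree3K p q r (m + (0, 0, 0, 0, n + 1, n + 1)) ∧
        ¬ IsSocleDegree3K p q r (m + (n + 1, n + 1, 0, 0, 0, 0)))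
    (h1 : r ≠ 0 → d 1 = 0 ∨ ∃ m, d 1 = weightMonomial _ m ∧
      ∀ n, ¬ IsSocleDegree3K p q r (m + (0, 0, n + 1, n + 1, 0, 0))) :
    z ∈ decomposableIdeal K A := by
  have hd {i : Fin 3} {t : A} {n} (ht : IsMonomialAt P.ρ t i i n)
      (h : d i = 0 ∨ ∃ m, d i = weightMonomial _ m ∧ ¬ IsSocleDegree3K p q r (m + n)) :
      traceForm P.ρ (z * t) = 0 := by
    rw [ht.diagonal_mul hz]
    obtain h | ⟨m, h, h'⟩ := h
    · rw [h, zero_mul, map_zero]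
    · rw [h, weightMonomial_mul, weightForm_monomial, weight3K_eq_zero h']
  refine P.mem_decomposableIdeal hr z fun j => ?_
  match j with
  | none =>
    exact hd (isMonomialAt_beta_gamma_pow P.ρ_x _) (h0.imp_right fun ⟨m, h, h'⟩ => ⟨m, h, (h' _).2⟩)
  | some ⟨0, n⟩ =>
    exact hd (P.isMonomialAt_cycle_pow 0 _) (h0.imp_right fun ⟨m, h, h'⟩ => ⟨m, h, (h' _).1⟩)
  | some ⟨1, n⟩ =>
    exact hd (P.isMonomialAt_cycle_pow 1 _) (h0.imp_right fun ⟨m, h, h'⟩ => ⟨m, h, (h' _).2⟩)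
  | some ⟨2, n⟩ =>
    have hn : n.1 < r := n.2
    exact hd (P.isMonomialAt_cycle_pow 2 _)
      ((h1 (by omega)).imp_right fun ⟨m, h, h'⟩ => ⟨m, h, h' _⟩)

theorem ρ_centralElement_pow (i : Fin 3) (n : ℕ) :
    P.ρ (P.centralElement i ^ n) = Matrix.diagonal (diag K p q r i ^ n) := by
  rw [map_pow, ρ_centralElement, Matrix.diagonal_pow]

theorem diag_zero_one (h : r ≠ 0) : diag K p q r 0 1 = 0 := if_neg h

/-- Where both diagonal entries are nonzero, the product mixes two different two-cycles, and a
further cycle takes it out of the socle degrees. For `r = 0` it may be a nonzero socle element,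
which the ideal absorbs. -/
theorem centralElement_mul_mem (hr : r = 0 → 0 < p) (i j : Fin 3) (hij : i < j)
    (z : Subalgebra.center K A) (hz : (z : A) = P.centralElement i * P.centralElement j) :
    z ∈ decomposableIdeal K A := by
  have hd : P.ρ z = Matrix.diagonal fun k => diag K p q r i k * diag K p q r j k := by
    rw [hz, map_mul, ρ_centralElement, ρ_centralElement, Matrix.diagonal_mul_diagonal]
  refine P.mem_decomposableIdeal_of_diagonal hr z hd ?_ fun h0 => ?_
  · obtain ⟨rfl, rfl⟩ | rfl : i = 0 ∧ j = 1 ∨ j = 2 := by omega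
    · refine Or.inr ⟨(1, 1, 0, 0, 1, 1), weightMonomial_mul _ _ _, fun n => ?_⟩
      simp only [Prod.mk_add_mk, isSocleDegree3K_cycles_iff]
      omega
    · exact Or.inl (mul_zero _)
  · obtain rfl | ⟨rfl, rfl⟩ : i = 0 ∨ i = 1 ∧ j = 2 := by omega
    · exact Or.inl ((congrArg (· * _) (diag_zero_one h0)).trans (zero_mul _))
    · refine Or.inr ⟨(1, 1, 1, 1, 0, 0), weightMonomial_mul _ _ _, fun n => ?_⟩
      simp only [Prod.mk_add_mk, isSocleDegree3K_cycles_iff]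
      omega

/-- The exponent is the one at which the cycle reaches its top power, so no further cycle pairs with
it. -/
theorem centralElement_pow_mem (hr : r = 0 → 0 < p) (i : Fin 3) (z : Subalgebra.center K A)
    (hz : (z : A) = P.centralElement i ^ exponent3K p q r i) : z ∈ decomposableIdeal K A := by
  refine P.mem_decomposableIdeal_of_diagonal hr z (d := diag K p q r i ^ exponent3K p q r i) ?_ ?_ ?_
  · rw [hz, ρ_centralElement_pow]
  · match i with
    | 0 =>
      refine Or.inr ⟨_, weightMonomial_pow _ _ _, fun n => ?_⟩
      simp only [exponent3K, Prod.smul_mk, smul_eq_mul, Prod.mk_add_mk, isSocleDegree3K_cycles_iff]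
      omega
    | 1 =>
      refine Or.inr ⟨_, weightMonomial_pow _ _ _, fun n => ?_⟩
      simp only [exponent3K, Prod.smul_mk, smul_eq_mul, Prod.mk_add_mk, isSocleDegree3K_cycles_iff]
      omega
    | 2 => exact Or.inl (zero_pow r.succ_ne_zero)
  · intro h0
    match i with
    | 0 =>
      exact Or.inl ((congrArg (· ^ (p + 2)) (diag_zero_one h0)).trans (zero_pow (by omega)))
    | 1 =>
      refine Or.inr ⟨_, weightMonomial_pow _ _ _, fun n => ?_⟩
      simp only [exponent3K, Prod.smul_mk, smul_eq_mul, Prod.mk_add_mk, isSocleDegree3K_cycles_iff]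
      omega
    | 2 =>
      refine Or.inr ⟨_, weightMonomial_pow _ _ _, fun n => ?_⟩
      simp only [exponent3K, Prod.smul_mk, smul_eq_mul, Prod.mk_add_mk, isSocleDegree3K_cycles_iff]
      omega

theorem traceForm_centralElement_pow_mul {i k : Fin 3} {m n : ℕ × ℕ × ℕ × ℕ × ℕ × ℕ} {t : A}
    (hd : diag K p q r i k = weightMonomial _ m) (ht : IsMonomialAt P.ρ t k k n) (a : ℕ) :
    traceForm P.ρ (P.centralElement i ^ a * t) = weight3K K p q r (a • m + n) := by
  rw [ht.diagonal_mul (P.ρ_centralElement_pow i a), Pi.pow_apply, hd, weightMonomial_pow,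
    weightMonomial_mul, weightForm_monomial]

theorem traceForm_centralElement_pow_mul_eq_zero {i k : Fin 3} {n : ℕ × ℕ × ℕ × ℕ × ℕ × ℕ} {t : A}
    (hd : diag K p q r i k = 0) (ht : IsMonomialAt P.ρ t k k n) (a : ℕ) :
    traceForm P.ρ (P.centralElement i ^ (a + 1) * t) = 0 := by
  rw [ht.diagonal_mul (P.ρ_centralElement_pow i (a + 1)), Pi.pow_apply, hd,
    zero_pow a.succ_ne_zero, zero_mul, map_zero]

/-- The condition under which a power of a central element pairs nontrivially with a power of a
cycle. -/
def Pairs (p q r a b : ℕ) : Fin 3 → Fin 3 → Prop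
  | 0, 0 => a + b = p
  | 1, 1 => a + b = q
  | 2, 2 => a + b + 1 = r
  | 0, 1 => r = 0 ∧ a = 0 ∧ b = 0
  | 1, 0 => r = 0 ∧ a = 0 ∧ b = 0
  | _, _ => False

/-- For equal indices the exponents `a + 1` and `b + 1` have to add up to the top power. The only
mixed pairing is that of `κλ` with `βγ`, for `r = 0` and first powers. -/
theorem traceForm_ne_zero_iff (i j : Fin 3) (a b : ℕ) (hb : b < exponent3K p q r j - 1) :
    traceForm P.ρ (P.centralElement i ^ (a + 1) * P.cycle j ^ (b + 1)) ≠ 0 ↔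
      Pairs p q r a b i j := by
  have hz (i j : Fin 3) (h : diag K p q r i (cycleVertex j) = 0) :
      ¬ traceForm P.ρ (P.centralElement i ^ (a + 1) * P.cycle j ^ (b + 1)) ≠ 0 :=
    not_not.2 (P.traceForm_centralElement_pow_mul_eq_zero h (P.isMonomialAt_cycle_pow j b) a)
  match i, j with
  | 0, 0 =>
    rw [P.traceForm_centralElement_pow_mul rfl (P.isMonomialAt_cycle_pow 0 b), weight3K_ne_zero]
    simp only [cycleDegree, Prod.smul_mk, smul_eq_mul, Prod.mk_add_mk, isSocleDegree3K_cycles_iff,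
      Pairs]
    omega
  | 0, 1 =>
    rw [P.traceForm_centralElement_pow_mul rfl (P.isMonomialAt_cycle_pow 1 b), weight3K_ne_zero]
    simp only [cycleDegree, Prod.smul_mk, smul_eq_mul, Prod.mk_add_mk, isSocleDegree3K_cycles_iff,
      Pairs]
    omega
  | 0, 2 =>
    have hb' : b < r := hb
    exact iff_of_false (hz 0 2 (diag_zero_one (by omega))) id
  | 1, 0 =>
    rw [P.traceForm_centralElement_pow_mul rfl (P.isMonomialAt_cycle_pow 0 b), weight3K_ne_zero]
    simp only [cycleDegree, Prod.smul_mk, smul_eq_mul, Prod.mk_add_mk, isSocleDegree3K_cycles_iff,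
      Pairs]
    omega
  | 1, 1 =>
    rw [P.traceForm_centralElement_pow_mul rfl (P.isMonomialAt_cycle_pow 1 b), weight3K_ne_zero]
    simp only [cycleDegree, Prod.smul_mk, smul_eq_mul, Prod.mk_add_mk, isSocleDegree3K_cycles_iff,
      Pairs]
    omega
  | 1, 2 =>
    rw [P.traceForm_centralElement_pow_mul rfl (P.isMonomialAt_cycle_pow 2 b), weight3K_ne_zero]
    refine iff_of_false ?_ id
    simp only [cycleDegree, Prod.smul_mk, smul_eq_mul, Prod.mk_add_mk, isSocleDegree3K_cycles_iff]
    omega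
  | 2, 0 => exact iff_of_false (hz 2 0 rfl) id
  | 2, 1 => exact iff_of_false (hz 2 1 rfl) id
  | 2, 2 =>
    rw [P.traceForm_centralElement_pow_mul rfl (P.isMonomialAt_cycle_pow 2 b), weight3K_ne_zero]
    simp only [cycleDegree, Prod.smul_mk, smul_eq_mul, Prod.mk_add_mk, isSocleDegree3K_cycles_iff,
      Pairs]
    omega

theorem traceForm_cycle_pow (i : Fin 3) (b : ℕ) (hb : b < exponent3K p q r i - 1) :
    traceForm P.ρ (P.cycle i ^ (b + 1)) = 0 := by
  rw [(P.isMonomialAt_cycle_pow i b).traceForm_eq]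
  apply weight3K_eq_zero
  match i with
  | 0 | 1 | 2 =>
    simp only [exponent3K] at hb
    simp only [cycleDegree, isSocleDegree3K_cycles_iff]
    omega

theorem traceForm_centralElement_pow_mul_test_none (i : Fin 3) (a : ℕ) :
    traceForm P.ρ (P.centralElement i ^ (a + 1) * P.test none) = 0 := by
  have h := isMonomialAt_beta_gamma_pow P.ρ_x (q + 1)
  match i with
  | 0 | 1 =>
    refine (P.traceForm_centralElement_pow_mul rfl h _).trans (weight3K_eq_zero ?_)
    simp only [Prod.smul_mk, smul_eq_mul, Prod.mk_add_mk, isSocleDegree3K_cycles_iff]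
    omega
  | 2 => exact P.traceForm_centralElement_pow_mul_eq_zero rfl h a

/-- The order in which the coefficients of an element of the stable center are found. -/
def stableHeight (p q r : ℕ) : Option (Σ i, Fin (exponent3K p q r i - 1)) → ℕ
  | none => 0
  | some ⟨0, n⟩ => if n.1 = p then 3 else 1
  | some ⟨1, n⟩ => if n.1 = q then 2 else 1
  | some ⟨2, _⟩ => 1

include P in
theorem nilradicalPowRank_stableCenter (hr : r = 0 → 0 < p) (k : ℕ) :
    nilradicalPowRank K (StableCenter K A) (k + 1) = ∑ i, (exponent3K p q r i - (k + 1)) := by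
  let x (i : Fin 3) : Subalgebra.center K A :=
    ⟨P.centralElement i, P.centralElement_mem_center hr i⟩
  have hsome (i : Fin 3) (n : Fin (exponent3K p q r i - 1)) :
      ((wedgeMonomial (exponent3K p q r) x (some ⟨i, n⟩) : Subalgebra.center K A) : A) =
        P.centralElement i ^ (n.1 + 1) := SubmonoidClass.coe_pow (x i) _
  have hnone : ((wedgeMonomial (exponent3K p q r) x none : Subalgebra.center K A) : A) = 1 := rfl
  refine (P.peirceSpanning hr).splitSymmetric.nilradicalPowRank_of_triangular
    (exponent3K p q r) x P.test (P.mem_decomposableIdeal hr) P.χ_test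
    -- Reversal matches the exponent `a + 1` with the exponent that completes it to the top power;
    -- the monomial `1` is matched with the socle element itself.
    (Option.map fun t => ⟨t.1, t.2.rev⟩) (stableHeight p q r) ?_ ?_ ?_ ?_ k
  · change ∀ j, traceForm P.ρ _ ≠ 0
    rintro (_ | ⟨i, n⟩)
    · rw [hnone, one_mul]
      change traceForm P.ρ (_ ^ (q + 1 + 1)) ≠ 0
      rw [(isMonomialAt_beta_gamma_pow P.ρ_x (q + 1)).traceForm_eq, weight3K_ne_zero,
        isSocleDegree3K_cycles_iff]
      exact Or.inl ⟨rfl, rfl, rfl⟩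
    · rw [hsome]
      refine (P.traceForm_ne_zero_iff i i n.1 n.rev.1 n.rev.2).2 ?_
      have hn := n.2
      rw [Fin.val_rev]
      match i with
      | 0 | 1 | 2 =>
        simp only [exponent3K, Pairs] at hn ⊢
        omega
  · change ∀ j j', traceForm P.ρ _ ≠ 0 → _
    rintro (_ | ⟨i, n⟩) (_ | ⟨j, m⟩) h
    · exact Or.inl rfl
    · rw [hsome] at h
      exact absurd (P.traceForm_centralElement_pow_mul_test_none j m.1) h
    · rw [hnone, one_mul] at h
      exact absurd (P.traceForm_cycle_pow i n.rev.1 n.rev.2) h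
    · rw [hsome] at h
      have h' := (P.traceForm_ne_zero_iff j i m.1 n.rev.1 n.rev.2).1 h
      have hn := n.2
      have hm := m.2
      rw [Fin.val_rev] at h'
      match i, j with
      | 0, 0 | 1, 1 | 2, 2 =>
        left
        congr 2
        refine Fin.ext ?_
        simp only [exponent3K, Pairs] at hn hm h'
        omega
      -- The mixed pairing tests the highest power of the first generator against the second
      -- generator itself. Height 3 dominates; in the reverse case, `r = 0` forces `p > 0`, so the
      -- first generator has height 1 and is dominated by height 2.
      | 0, 1 =>
        simp only [exponent3K, Pairs] at hn hm h'
        simp only [stableHeight]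
        split_ifs <;> omega
      | 1, 0 =>
        simp only [exponent3K, Pairs] at hn hm h'
        simp only [stableHeight]
        split_ifs <;> omega
      | 0, 2 | 1, 2 | 2, 0 | 2, 1 => exact h'.elim
  · intro i j hij
    obtain h | h := lt_or_gt_of_ne hij
    · exact P.centralElement_mul_mem hr i j h _ rfl
    · rw [mul_comm]
      exact P.centralElement_mul_mem hr j i h _ rfl
  · intro i
    exact P.centralElement_pow_mem hr i _ (SubmonoidClass.coe_pow (x i) _)

end Presentation3K

variable (K : Type u) [Field K] (p q r : ℕ)

/-- The presentation of `Q(3K)^{p+2,q+2,r+1}`. -/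
noncomputable def presentation3K :
    Presentation3K K (Q3KPresented K (p + 2) (q + 2) (r + 1)) p q r where
  f := RingQuot.mkAlgHom K (Q3KRel K (p + 2) (q + 2) (r + 1))
  surjective := RingQuot.mkAlgHom_surjective K _
  relations := relations3K K p q r
  χ := character3K K p q r
  χ_vertex i j := by simp [character3K]
  ρ := rep3K K p q r
  ρ_f := rep3K_mk K p q r

end Presentation

/-! ### Relations and spanning sets of type `3A` -/

section Relations

variable {K A : Type u} [Field K] [Ring A] [Algebra K A]

/-- The relations of `Q(3A)_1^{2,2}(d)`. -/
structure Relations3A (d : K) (β γ δ η : A) : Prop where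
  βδη : β * δ * η = β * γ * β
  δηγ : δ * η * γ = γ * β * γ
  ηγβ : η * γ * β = d • (η * δ * η)
  γβδ : γ * β * δ = d • (δ * η * δ)
  βδηδ : β * δ * η * δ = 0
  ηγβγ : η * γ * β * γ = 0

namespace Relations3A

variable {d : K} {β γ δ η : A} (h : Relations3A d β γ δ η)
include h

theorem γβγβ : γ * β * γ * β = d • (δ * η * δ * η) := by
  rw [mul_assoc, mul_assoc, ← mul_assoc β, ← h.βδη, ← mul_assoc, ← mul_assoc, h.γβδ, smul_mul_assoc]

theorem ηδηγ : η * δ * η * γ = 0 := by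
  rw [mul_assoc, mul_assoc, ← mul_assoc δ, h.δηγ, ← mul_assoc, ← mul_assoc, h.ηγβγ]

theorem γβγβγ : γ * β * γ * β * γ = 0 := by
  rw [h.γβγβ, smul_mul_assoc, mul_assoc δ, mul_assoc δ, mul_assoc δ, h.ηδηγ, mul_zero, smul_zero]

/-- As `d` is invertible, `δηδη` is a multiple of `γβγβ`. Moving `δ` through `γβ` then exhibits the
zero path `βδηδ`. -/
theorem δηδηδ (hd : d ≠ 0) : δ * η * δ * η * δ = 0 := by
  refine (smul_eq_zero.1 (?_ : d • (δ * η * δ * η * δ) = 0)).resolve_left hd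
  rw [← smul_mul_assoc, ← h.γβγβ, mul_assoc _ β δ, mul_assoc _ γ, ← mul_assoc γ β, h.γβδ,
    mul_smul_comm, mul_assoc γ β, ← mul_assoc β, ← mul_assoc β, h.βδηδ, mul_zero, smul_zero]

theorem ηδηδη (hd : d ≠ 0) : η * δ * η * δ * η = 0 := by
  refine (smul_eq_zero.1 (?_ : d • (η * δ * η * δ * η) = 0)).resolve_left hd
  have h1 : η * (γ * β * γ * β) = 0 := by
    rw [← mul_assoc, ← mul_assoc, ← mul_assoc, h.ηγβγ, zero_mul]
  rw [h.γβγβ, mul_smul_comm, ← mul_assoc, ← mul_assoc, ← mul_assoc] at h1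
  exact h1

theorem βγβγβ : β * γ * β * γ * β = 0 := by
  have h1 : β * (γ * β * γ * β) = 0 := by
    rw [h.γβγβ, mul_smul_comm, ← mul_assoc, ← mul_assoc, ← mul_assoc, h.βδηδ, zero_mul, smul_zero]
  rwa [← mul_assoc, ← mul_assoc, ← mul_assoc] at h1

end Relations3A

/-- A family of four elements. -/
def familyOfFour {α : Type*} (a b c d : α) : Option (Fin 3) → α
  | none => a
  | some 0 => b
  | some 1 => c
  | some 2 => d

/-- The paths which span the Peirce components of `Q(3A)_1^{2,2}(d)`. -/
def paths3A (e : Fin 3 → A) (x : Arrow3A → A) : Fin 3 → Fin 3 → Option (Fin 3) → A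
  | 0, 0 => familyOfFour (e 0) (x .beta * x .gamma) (x .beta * x .gamma * x .beta * x .gamma) 0
  | 0, 1 => familyOfFour 0 (x .beta) (x .beta * x .gamma * x .beta) 0
  | 0, 2 => familyOfFour 0 (x .beta * x .delta) 0 0
  | 1, 0 => familyOfFour 0 (x .gamma) (x .gamma * x .beta * x .gamma) 0
  | 1, 1 => familyOfFour (e 1) (x .gamma * x .beta) (x .delta * x .eta)
      (x .delta * x .eta * x .delta * x .eta)
  | 1, 2 => familyOfFour 0 (x .delta) (x .delta * x .eta * x .delta) 0
  | 2, 0 => familyOfFour 0 (x .eta * x .gamma) 0 0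
  | 2, 1 => familyOfFour 0 (x .eta) (x .eta * x .delta * x .eta) 0
  | 2, 2 => familyOfFour (e 2) (x .eta * x .delta) (x .eta * x .delta * x .eta * x .delta) 0

theorem mem_span_range_of_eq_smul {T : Type*} {u : T → A} (t : T) {a : A} {k : K}
    (h : a = k • u t) : a ∈ Submodule.span K (Set.range u) :=
  h ▸ Submodule.smul_mem _ _ (Submodule.subset_span ⟨t, rfl⟩)

theorem Relations3A.arrow_mul_path_mem {d : K} (hd : d ≠ 0) {e : Fin 3 → A} {x : Arrow3A → A}
    (h : Relations3A d (x .beta) (x .gamma) (x .delta) (x .eta))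
    (he : ∀ y, x y * e (quiver3A.target y) = x y) (y : Arrow3A)
    (j : Fin 3) (t : Option (Fin 3)) : x y * paths3A e x (quiver3A.target y) j t ∈
      Submodule.span K (Set.range (paths3A e x (quiver3A.source y) j)) :=
  match y, j, t with
  | .beta, 0, none => mem_span_range_of_eq_zero (mul_zero _)
  | .beta, 0, some 0 => mem_span_range_of_eq (some 0) rfl
  | .beta, 0, some 1 => mem_span_range_of_eq (some 1) (by
      change _ * (_ * _ * _) = _ * _ * _ * _
      simp only [mul_assoc])
  | .beta, 0, some 2 => mem_span_range_of_eq_zero (mul_zero _)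
  | .beta, 1, none => mem_span_range_of_eq (some 0) (by
      change _ * e (quiver3A.target .beta) = _
      exact he .beta)
  | .beta, 1, some 0 => mem_span_range_of_eq (some 1) (mul_assoc _ _ _).symm
  | .beta, 1, some 1 => mem_span_range_of_eq (some 1) (by
      change _ * (_ * _) = _ * _ * _
      rw [← mul_assoc, h.βδη])
  | .beta, 1, some 2 => mem_span_range_of_eq_zero (by
      change _ * (_ * _ * _ * _) = 0
      rw [← mul_assoc, ← mul_assoc, ← mul_assoc, h.βδηδ, zero_mul])
  | .beta, 2, none => mem_span_range_of_eq_zero (mul_zero _)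
  | .beta, 2, some 0 => mem_span_range_of_eq (some 0) rfl
  | .beta, 2, some 1 => mem_span_range_of_eq_zero (by
      change _ * (_ * _ * _) = 0
      rw [← mul_assoc, ← mul_assoc, h.βδηδ])
  | .beta, 2, some 2 => mem_span_range_of_eq_zero (mul_zero _)
  | .gamma, 0, none => mem_span_range_of_eq (some 0) (by
      change _ * e (quiver3A.target .gamma) = _
      exact he .gamma)
  | .gamma, 0, some 0 => mem_span_range_of_eq (some 1) (mul_assoc _ _ _).symm
  | .gamma, 0, some 1 => mem_span_range_of_eq_zero (by
      change _ * (_ * _ * _ * _) = 0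
      rw [← mul_assoc, ← mul_assoc, ← mul_assoc, h.γβγβγ])
  | .gamma, 0, some 2 => mem_span_range_of_eq_zero (mul_zero _)
  | .gamma, 1, none => mem_span_range_of_eq_zero (mul_zero _)
  | .gamma, 1, some 0 => mem_span_range_of_eq (some 0) rfl
  | .gamma, 1, some 1 => mem_span_range_of_eq_smul (some 2) (by
      change _ * (_ * _ * _) = _
      rw [← mul_assoc, ← mul_assoc]
      exact h.γβγβ)
  | .gamma, 1, some 2 => mem_span_range_of_eq_zero (mul_zero _)
  | .gamma, 2, none => mem_span_range_of_eq_zero (mul_zero _)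
  | .gamma, 2, some 0 => mem_span_range_of_eq_smul (some 1) ((mul_assoc _ _ _).symm.trans h.γβδ)
  | .gamma, 2, some 1 => mem_span_range_of_eq_zero (mul_zero _)
  | .gamma, 2, some 2 => mem_span_range_of_eq_zero (mul_zero _)
  | .delta, 0, none => mem_span_range_of_eq_zero (mul_zero _)
  | .delta, 0, some 0 => mem_span_range_of_eq (some 1) (by
      change _ * (_ * _) = _ * _ * _
      rw [← mul_assoc, h.δηγ])
  | .delta, 0, some 1 => mem_span_range_of_eq_zero (mul_zero _)
  | .delta, 0, some 2 => mem_span_range_of_eq_zero (mul_zero _)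
  | .delta, 1, none => mem_span_range_of_eq_zero (mul_zero _)
  | .delta, 1, some 0 => mem_span_range_of_eq (some 1) rfl
  | .delta, 1, some 1 => mem_span_range_of_eq (some 2) (by
      change _ * (_ * _ * _) = _ * _ * _ * _
      simp only [mul_assoc])
  | .delta, 1, some 2 => mem_span_range_of_eq_zero (mul_zero _)
  | .delta, 2, none => mem_span_range_of_eq (some 0) (by
      change _ * e (quiver3A.target .delta) = _
      exact he .delta)
  | .delta, 2, some 0 => mem_span_range_of_eq (some 1) (mul_assoc _ _ _).symm
  | .delta, 2, some 1 => mem_span_range_of_eq_zero (by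
      change _ * (_ * _ * _ * _) = 0
      rw [← mul_assoc, ← mul_assoc, ← mul_assoc, h.δηδηδ hd])
  | .delta, 2, some 2 => mem_span_range_of_eq_zero (mul_zero _)
  | .eta, 0, none => mem_span_range_of_eq_zero (mul_zero _)
  | .eta, 0, some 0 => mem_span_range_of_eq (some 0) rfl
  | .eta, 0, some 1 => mem_span_range_of_eq_zero (by
      change _ * (_ * _ * _) = 0
      rw [← mul_assoc, ← mul_assoc, h.ηγβγ])
  | .eta, 0, some 2 => mem_span_range_of_eq_zero (mul_zero _)
  | .eta, 1, none => mem_span_range_of_eq (some 0) (by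
      change _ * e (quiver3A.target .eta) = _
      exact he .eta)
  | .eta, 1, some 0 => mem_span_range_of_eq_smul (some 1) ((mul_assoc _ _ _).symm.trans h.ηγβ)
  | .eta, 1, some 1 => mem_span_range_of_eq (some 1) (mul_assoc _ _ _).symm
  | .eta, 1, some 2 => mem_span_range_of_eq_zero (by
      change _ * (_ * _ * _ * _) = 0
      rw [← mul_assoc, ← mul_assoc, ← mul_assoc, h.ηδηδη hd])
  | .eta, 2, none => mem_span_range_of_eq_zero (mul_zero _)
  | .eta, 2, some 0 => mem_span_range_of_eq (some 0) rfl
  | .eta, 2, some 1 => mem_span_range_of_eq (some 1) (by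
      change _ * (_ * _ * _) = _ * _ * _ * _
      simp only [mul_assoc])
  | .eta, 2, some 2 => mem_span_range_of_eq_zero (mul_zero _)

end Relations

/-! ### The weight of type `3A` -/

section Weight3A

/-- The values of the trace form of `Q(3A)_1^{2,2}(d)` on the cycles, in terms of the
multiplicities of `β`, `γ`, `δ`, `η`. -/
def weight3A {K : Type u} [Field K] (d : K) (m : ℕ × ℕ × ℕ × ℕ) : K :=
  if m = (2, 2, 0, 0) ∨ m = (1, 1, 1, 1) then d else if m = (0, 0, 2, 2) then 1 else 0

/-- The degrees of the arrows. -/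
def degree3A : Arrow3A → ℕ × ℕ × ℕ × ℕ
  | .beta => (1, 0, 0, 0)
  | .gamma => (0, 1, 0, 0)
  | .delta => (0, 0, 1, 0)
  | .eta => (0, 0, 0, 1)

variable {K : Type u} [Field K] {d : K}

theorem weight3A_ne_zero (hd : d ≠ 0) {m : ℕ × ℕ × ℕ × ℕ} :
    weight3A d m ≠ 0 ↔ m = (2, 2, 0, 0) ∨ m = (1, 1, 1, 1) ∨ m = (0, 0, 2, 2) := by
  rw [weight3A]
  split_ifs with h1 h2
  · exact iff_of_true hd (h1.imp_right Or.inl)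
  · exact iff_of_true one_ne_zero (Or.inr (Or.inr h2))
  · simp only [ne_eq, not_true_eq_false, false_iff]
    tauto

theorem weight3A_eq_zero {m : ℕ × ℕ × ℕ × ℕ}
    (h : ¬ (m = (2, 2, 0, 0) ∨ m = (1, 1, 1, 1) ∨ m = (0, 0, 2, 2))) : weight3A d m = 0 := by
  rw [weight3A, if_neg (by tauto), if_neg (by tauto)]

section Paths

variable {A : Type u} [Ring A] [Algebra K A] {e : Fin 3 → A} {x : Arrow3A → A}
  {ρ : A →ₐ[K] Matrix (Fin 3) (Fin 3) (WeightRing (weight3A d))}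

/-- The paths which test for the paths that span the Peirce components. -/
def tests3A (d : K) (e : Fin 3 → A) (x : Arrow3A → A) : Fin 3 → Fin 3 → Option (Fin 3) → A
  | 0, 0 => familyOfFour (x .beta * x .gamma * x .beta * x .gamma) (x .beta * x .gamma) (e 0) 0
  | 0, 1 => familyOfFour 0 (x .gamma * x .beta * x .gamma) (x .gamma) 0
  | 0, 2 => familyOfFour 0 (x .eta * x .gamma) 0 0
  | 1, 0 => familyOfFour 0 (x .beta * x .gamma * x .beta) (x .beta) 0
  | 1, 1 => familyOfFour (x .delta * x .eta * x .delta * x .eta)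
      (x .gamma * x .beta - d • (x .delta * x .eta)) (x .delta * x .eta - x .gamma * x .beta) (e 1)
  | 1, 2 => familyOfFour 0 (x .eta * x .delta * x .eta) (x .eta) 0
  | 2, 0 => familyOfFour 0 (x .beta * x .delta) 0 0
  | 2, 1 => familyOfFour 0 (x .delta * x .eta * x .delta) (x .delta) 0
  | 2, 2 => familyOfFour (x .eta * x .delta * x .eta * x .delta) (x .eta * x .delta) (e 2) 0

/-- With explicit degrees and a Boolean marking of the nonzero members, diagonality of the pairing
is a finite check on exponents. -/
theorem triangular_of_familyOfFour (hd : d ≠ 0) {i j : Fin 3} {u v : Option (Fin 3) → A}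
    (D E : Option (Fin 3) → ℕ × ℕ × ℕ × ℕ) (N : Option (Fin 3) → Bool)
    (hu : ∀ t, if N t then IsMonomialAt ρ (u t) i j (D t) else u t = 0)
    (hv : ∀ t, if N t then IsMonomialAt ρ (v t) j i (E t) else True)
    (h : ∀ t t', N t → N t' → ((E t + D t' = (2, 2, 0, 0) ∨ E t + D t' = (1, 1, 1, 1) ∨
      E t + D t' = (0, 0, 2, 2)) ↔ t' = t)) (t : Option (Fin 3)) (ht : u t ≠ 0) :
    traceForm ρ (v t * u t) ≠ 0 ∧ ∀ t', traceForm ρ (v t * u t') ≠ 0 → t' = t ∨ 0 < 0 :=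
  triangular_of_isMonomialAt (fun t => N t) (fun _ => 0)
    (fun t ht => by simpa [ht] using hu t) (fun t ht => by simpa [ht] using hu t)
    (fun t ht => by simpa [ht] using hv t)
    (fun t ht => (weight3A_ne_zero hd).2 ((h t t ht ht).2 rfl))
    (fun t t' ht ht' hw => Or.inl ((h t t' ht ht').1 ((weight3A_ne_zero hd).1 hw))) t ht

end Paths

end Weight3A

/-! ### Peirce components of type `3A` -/

section Presentation

open ArrowQuiver AlgBimodule

/-- An algebra which is given by the quiver of type `3A` and the relations of
`Q(3A)_1^{2,2}(d)`, together with its characters and its representation by matrices of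
monomials. -/
structure Presentation3A (K A : Type u) [Field K] [Ring A] [Algebra K A] (d : K) where
  /-- the presentation -/
  f : PathAlgebra K quiver3A →ₐ[K] A
  surjective : Function.Surjective f
  relations : Relations3A d (f (arrow K quiver3A .beta)) (f (arrow K quiver3A .gamma))
    (f (arrow K quiver3A .delta)) (f (arrow K quiver3A .eta))
  /-- the characters -/
  χ : Fin 3 → A →ₐ[K] K
  χ_vertex (i j : Fin 3) : χ i (f (quiver3A.vertex K j)) = if i = j then 1 else 0
  /-- the representation -/
  ρ : A →ₐ[K] Matrix (Fin 3) (Fin 3) (WeightRing (weight3A d))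
  ρ_f (a : PathAlgebra K quiver3A) :
    ρ (f a) = matrixRep (fun y => weightMonomial _ (degree3A y)) a

namespace Presentation3A

variable {K A : Type u} [Field K] [Ring A] [Algebra K A] {d : K} (P : Presentation3A K A d)

/-- The images of the arrows. -/
def x (y : Arrow3A) : A := P.f (arrow K quiver3A y)

/-- The images of the vertices. -/
def e (i : Fin 3) : A := P.f (quiver3A.vertex K i)

theorem relations_x : Relations3A d (P.x .beta) (P.x .gamma) (P.x .delta) (P.x .eta) := P.relations

theorem ρ_x (y : Arrow3A) :
    IsMonomialAt P.ρ (P.x y) (quiver3A.source y) (quiver3A.target y) (degree3A y) :=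
  (P.ρ_f _).trans (matrixRep_arrow _ y)

theorem ρ_e (i : Fin 3) : IsMonomialAt P.ρ (P.e i) i i 0 :=
  (P.ρ_f _).trans (matrixRep_vertex _ i)

theorem ρ_beta_gamma : IsMonomialAt P.ρ (P.x .beta * P.x .gamma) 0 0 (1, 1, 0, 0) :=
  (P.ρ_x .beta).mul (P.ρ_x .gamma)

theorem ρ_beta_gamma_beta_gamma : IsMonomialAt P.ρ (P.x .beta * P.x .gamma * P.x .beta * P.x .gamma) 0 0 (2, 2, 0, 0) :=
  (((P.ρ_x .beta).mul (P.ρ_x .gamma)).mul (P.ρ_x .beta)).mul (P.ρ_x .gamma)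

theorem ρ_beta_gamma_beta : IsMonomialAt P.ρ (P.x .beta * P.x .gamma * P.x .beta) 0 1 (2, 1, 0, 0) :=
  ((P.ρ_x .beta).mul (P.ρ_x .gamma)).mul (P.ρ_x .beta)

theorem ρ_beta_delta : IsMonomialAt P.ρ (P.x .beta * P.x .delta) 0 2 (1, 0, 1, 0) :=
  (P.ρ_x .beta).mul (P.ρ_x .delta)

theorem ρ_gamma_beta_gamma : IsMonomialAt P.ρ (P.x .gamma * P.x .beta * P.x .gamma) 1 0 (1, 2, 0, 0) :=
  ((P.ρ_x .gamma).mul (P.ρ_x .beta)).mul (P.ρ_x .gamma)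

theorem ρ_gamma_beta : IsMonomialAt P.ρ (P.x .gamma * P.x .beta) 1 1 (1, 1, 0, 0) :=
  (P.ρ_x .gamma).mul (P.ρ_x .beta)

theorem ρ_delta_eta : IsMonomialAt P.ρ (P.x .delta * P.x .eta) 1 1 (0, 0, 1, 1) :=
  (P.ρ_x .delta).mul (P.ρ_x .eta)

theorem ρ_delta_eta_delta_eta : IsMonomialAt P.ρ (P.x .delta * P.x .eta * P.x .delta * P.x .eta) 1 1 (0, 0, 2, 2) :=
  (((P.ρ_x .delta).mul (P.ρ_x .eta)).mul (P.ρ_x .delta)).mul (P.ρ_x .eta)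

theorem ρ_delta_eta_delta : IsMonomialAt P.ρ (P.x .delta * P.x .eta * P.x .delta) 1 2 (0, 0, 2, 1) :=
  ((P.ρ_x .delta).mul (P.ρ_x .eta)).mul (P.ρ_x .delta)

theorem ρ_eta_gamma : IsMonomialAt P.ρ (P.x .eta * P.x .gamma) 2 0 (0, 1, 0, 1) :=
  (P.ρ_x .eta).mul (P.ρ_x .gamma)

theorem ρ_eta_delta_eta : IsMonomialAt P.ρ (P.x .eta * P.x .delta * P.x .eta) 2 1 (0, 0, 1, 2) :=
  ((P.ρ_x .eta).mul (P.ρ_x .delta)).mul (P.ρ_x .eta)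

theorem ρ_eta_delta : IsMonomialAt P.ρ (P.x .eta * P.x .delta) 2 2 (0, 0, 1, 1) :=
  (P.ρ_x .eta).mul (P.ρ_x .delta)

theorem ρ_eta_delta_eta_delta : IsMonomialAt P.ρ (P.x .eta * P.x .delta * P.x .eta * P.x .delta) 2 2 (0, 0, 2, 2) :=
  (((P.ρ_x .eta).mul (P.ρ_x .delta)).mul (P.ρ_x .eta)).mul (P.ρ_x .delta)

theorem triangular_0_0 (hd0 : d ≠ 0) : ∀ t, paths3A P.e P.x 0 0 t ≠ 0 →
    traceForm P.ρ (tests3A d P.e P.x 0 0 t * paths3A P.e P.x 0 0 t) ≠ 0 ∧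
    ∀ t', traceForm P.ρ (tests3A d P.e P.x 0 0 t * paths3A P.e P.x 0 0 t') ≠ 0 →
      t' = t ∨ 0 < 0 :=
  triangular_of_familyOfFour hd0
    (familyOfFour (0, 0, 0, 0) (1, 1, 0, 0) (2, 2, 0, 0) (0, 0, 0, 0))
    (familyOfFour (2, 2, 0, 0) (1, 1, 0, 0) (0, 0, 0, 0) (0, 0, 0, 0))
    (familyOfFour true true true false)
    (fun
      | none => P.ρ_e 0
      | some 0 => P.ρ_beta_gamma
      | some 1 => P.ρ_beta_gamma_beta_gamma
      | some 2 => rfl)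
    (fun
      | none => P.ρ_beta_gamma_beta_gamma
      | some 0 => P.ρ_beta_gamma
      | some 1 => P.ρ_e 0
      | some 2 => trivial)
    (by decide)

theorem triangular_0_1 (hd0 : d ≠ 0) : ∀ t, paths3A P.e P.x 0 1 t ≠ 0 →
    traceForm P.ρ (tests3A d P.e P.x 0 1 t * paths3A P.e P.x 0 1 t) ≠ 0 ∧
    ∀ t', traceForm P.ρ (tests3A d P.e P.x 0 1 t * paths3A P.e P.x 0 1 t') ≠ 0 →
      t' = t ∨ 0 < 0 :=
  triangular_of_familyOfFour hd0
    (familyOfFour (0, 0, 0, 0) (1, 0, 0, 0) (2, 1, 0, 0) (0, 0, 0, 0))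
    (familyOfFour (0, 0, 0, 0) (1, 2, 0, 0) (0, 1, 0, 0) (0, 0, 0, 0))
    (familyOfFour false true true false)
    (fun
      | none => rfl
      | some 0 => P.ρ_x .beta
      | some 1 => P.ρ_beta_gamma_beta
      | some 2 => rfl)
    (fun
      | none => trivial
      | some 0 => P.ρ_gamma_beta_gamma
      | some 1 => P.ρ_x .gamma
      | some 2 => trivial)
    (by decide)

theorem triangular_0_2 (hd0 : d ≠ 0) : ∀ t, paths3A P.e P.x 0 2 t ≠ 0 →
    traceForm P.ρ (tests3A d P.e P.x 0 2 t * paths3A P.e P.x 0 2 t) ≠ 0 ∧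
    ∀ t', traceForm P.ρ (tests3A d P.e P.x 0 2 t * paths3A P.e P.x 0 2 t') ≠ 0 →
      t' = t ∨ 0 < 0 :=
  triangular_of_familyOfFour hd0
    (familyOfFour (0, 0, 0, 0) (1, 0, 1, 0) (0, 0, 0, 0) (0, 0, 0, 0))
    (familyOfFour (0, 0, 0, 0) (0, 1, 0, 1) (0, 0, 0, 0) (0, 0, 0, 0))
    (familyOfFour false true false false)
    (fun
      | none => rfl
      | some 0 => P.ρ_beta_delta
      | some 1 => rfl
      | some 2 => rfl)
    (fun
      | none => trivial
      | some 0 => P.ρ_eta_gamma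
      | some 1 => trivial
      | some 2 => trivial)
    (by decide)

theorem triangular_1_0 (hd0 : d ≠ 0) : ∀ t, paths3A P.e P.x 1 0 t ≠ 0 →
    traceForm P.ρ (tests3A d P.e P.x 1 0 t * paths3A P.e P.x 1 0 t) ≠ 0 ∧
    ∀ t', traceForm P.ρ (tests3A d P.e P.x 1 0 t * paths3A P.e P.x 1 0 t') ≠ 0 →
      t' = t ∨ 0 < 0 :=
  triangular_of_familyOfFour hd0
    (familyOfFour (0, 0, 0, 0) (0, 1, 0, 0) (1, 2, 0, 0) (0, 0, 0, 0))
    (familyOfFour (0, 0, 0, 0) (2, 1, 0, 0) (1, 0, 0, 0) (0, 0, 0, 0))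
    (familyOfFour false true true false)
    (fun
      | none => rfl
      | some 0 => P.ρ_x .gamma
      | some 1 => P.ρ_gamma_beta_gamma
      | some 2 => rfl)
    (fun
      | none => trivial
      | some 0 => P.ρ_beta_gamma_beta
      | some 1 => P.ρ_x .beta
      | some 2 => trivial)
    (by decide)

theorem triangular_1_2 (hd0 : d ≠ 0) : ∀ t, paths3A P.e P.x 1 2 t ≠ 0 →
    traceForm P.ρ (tests3A d P.e P.x 1 2 t * paths3A P.e P.x 1 2 t) ≠ 0 ∧
    ∀ t', traceForm P.ρ (tests3A d P.e P.x 1 2 t * paths3A P.e P.x 1 2 t') ≠ 0 →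
      t' = t ∨ 0 < 0 :=
  triangular_of_familyOfFour hd0
    (familyOfFour (0, 0, 0, 0) (0, 0, 1, 0) (0, 0, 2, 1) (0, 0, 0, 0))
    (familyOfFour (0, 0, 0, 0) (0, 0, 1, 2) (0, 0, 0, 1) (0, 0, 0, 0))
    (familyOfFour false true true false)
    (fun
      | none => rfl
      | some 0 => P.ρ_x .delta
      | some 1 => P.ρ_delta_eta_delta
      | some 2 => rfl)
    (fun
      | none => trivial
      | some 0 => P.ρ_eta_delta_eta
      | some 1 => P.ρ_x .eta
      | some 2 => trivial)
    (by decide)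

theorem triangular_2_0 (hd0 : d ≠ 0) : ∀ t, paths3A P.e P.x 2 0 t ≠ 0 →
    traceForm P.ρ (tests3A d P.e P.x 2 0 t * paths3A P.e P.x 2 0 t) ≠ 0 ∧
    ∀ t', traceForm P.ρ (tests3A d P.e P.x 2 0 t * paths3A P.e P.x 2 0 t') ≠ 0 →
      t' = t ∨ 0 < 0 :=
  triangular_of_familyOfFour hd0
    (familyOfFour (0, 0, 0, 0) (0, 1, 0, 1) (0, 0, 0, 0) (0, 0, 0, 0))
    (familyOfFour (0, 0, 0, 0) (1, 0, 1, 0) (0, 0, 0, 0) (0, 0, 0, 0))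
    (familyOfFour false true false false)
    (fun
      | none => rfl
      | some 0 => P.ρ_eta_gamma
      | some 1 => rfl
      | some 2 => rfl)
    (fun
      | none => trivial
      | some 0 => P.ρ_beta_delta
      | some 1 => trivial
      | some 2 => trivial)
    (by decide)

theorem triangular_2_1 (hd0 : d ≠ 0) : ∀ t, paths3A P.e P.x 2 1 t ≠ 0 →
    traceForm P.ρ (tests3A d P.e P.x 2 1 t * paths3A P.e P.x 2 1 t) ≠ 0 ∧
    ∀ t', traceForm P.ρ (tests3A d P.e P.x 2 1 t * paths3A P.e P.x 2 1 t') ≠ 0 →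
      t' = t ∨ 0 < 0 :=
  triangular_of_familyOfFour hd0
    (familyOfFour (0, 0, 0, 0) (0, 0, 0, 1) (0, 0, 1, 2) (0, 0, 0, 0))
    (familyOfFour (0, 0, 0, 0) (0, 0, 2, 1) (0, 0, 1, 0) (0, 0, 0, 0))
    (familyOfFour false true true false)
    (fun
      | none => rfl
      | some 0 => P.ρ_x .eta
      | some 1 => P.ρ_eta_delta_eta
      | some 2 => rfl)
    (fun
      | none => trivial
      | some 0 => P.ρ_delta_eta_delta
      | some 1 => P.ρ_x .delta
      | some 2 => trivial)
    (by decide)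

theorem triangular_2_2 (hd0 : d ≠ 0) : ∀ t, paths3A P.e P.x 2 2 t ≠ 0 →
    traceForm P.ρ (tests3A d P.e P.x 2 2 t * paths3A P.e P.x 2 2 t) ≠ 0 ∧
    ∀ t', traceForm P.ρ (tests3A d P.e P.x 2 2 t * paths3A P.e P.x 2 2 t') ≠ 0 →
      t' = t ∨ 0 < 0 :=
  triangular_of_familyOfFour hd0
    (familyOfFour (0, 0, 0, 0) (0, 0, 1, 1) (0, 0, 2, 2) (0, 0, 0, 0))
    (familyOfFour (0, 0, 2, 2) (0, 0, 1, 1) (0, 0, 0, 0) (0, 0, 0, 0))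
    (familyOfFour true true true false)
    (fun
      | none => P.ρ_e 2
      | some 0 => P.ρ_eta_delta
      | some 1 => P.ρ_eta_delta_eta_delta
      | some 2 => rfl)
    (fun
      | none => P.ρ_eta_delta_eta_delta
      | some 0 => P.ρ_eta_delta
      | some 1 => P.ρ_e 2
      | some 2 => trivial)
    (by decide)

theorem isMonomialAt_paths_1_1 : ∀ t, IsMonomialAt P.ρ (paths3A P.e P.x 1 1 t) 1 1
    (familyOfFour (0, 0, 0, 0) (1, 1, 0, 0) (0, 0, 1, 1) (0, 0, 2, 2) t)
  | none => P.ρ_e 1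
  | some 0 => P.ρ_gamma_beta
  | some 1 => P.ρ_delta_eta
  | some 2 => P.ρ_delta_eta_delta_eta

/-- This component is not diagonal on monomials: `γβ` and `δη` have the Gram matrix with rows `(d,
d)` and `(d, 1)`, of determinant `d(1-d)`. The tests `γβ - dδη` and `δη - γβ` are dual to the two
paths up to the nonzero factors `d - d²` and `1 - d`. -/
theorem triangular_1_1 (hd0 : d ≠ 0) (hd1 : d ≠ 1) : ∀ t, paths3A P.e P.x 1 1 t ≠ 0 →
    traceForm P.ρ (tests3A d P.e P.x 1 1 t * paths3A P.e P.x 1 1 t) ≠ 0 ∧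
    ∀ t', traceForm P.ρ (tests3A d P.e P.x 1 1 t * paths3A P.e P.x 1 1 t') ≠ 0 →
      t' = t ∨ 0 < 0 := by
  have h (a : A) (m) (ha : IsMonomialAt P.ρ a 1 1 m) (t) :
      traceForm P.ρ (a * paths3A P.e P.x 1 1 t) = weight3A d (m +
        familyOfFour (0, 0, 0, 0) (1, 1, 0, 0) (0, 0, 1, 1) (0, 0, 2, 2) t) :=
    ha.traceForm_mul (P.isMonomialAt_paths_1_1 t)
  have hd : d - d * d ≠ 0 := by
    rw [show d - d * d = d * (1 - d) by ring]
    exact mul_ne_zero hd0 (sub_ne_zero.2 hd1.symm)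
  have hv (t t') : traceForm P.ρ (tests3A d P.e P.x 1 1 t * paths3A P.e P.x 1 1 t') ≠ 0 ↔
      t' = t := by
    match t with
    | none =>
      change traceForm P.ρ (P.x .delta * P.x .eta * P.x .delta * P.x .eta * _) ≠ 0 ↔ _
      rw [h _ _ P.ρ_delta_eta_delta_eta]
      match t' with
      | none | some 0 | some 1 | some 2 => simp [familyOfFour, weight3A]
    | some 0 =>
      change traceForm P.ρ ((P.x .gamma * P.x .beta - d • (P.x .delta * P.x .eta)) * _) ≠ 0 ↔ _
      rw [sub_mul, smul_mul_assoc, map_sub, map_smul, h _ _ P.ρ_gamma_beta, h _ _ P.ρ_delta_eta]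
      match t' with
      | none | some 0 | some 1 | some 2 => simp [familyOfFour, weight3A, hd]
    | some 1 =>
      change traceForm P.ρ ((P.x .delta * P.x .eta - P.x .gamma * P.x .beta) * _) ≠ 0 ↔ _
      rw [sub_mul, map_sub, h _ _ P.ρ_gamma_beta, h _ _ P.ρ_delta_eta]
      match t' with
      | none | some 0 | some 1 | some 2 =>
        simp [familyOfFour, weight3A, sub_ne_zero.2 hd1.symm]
    | some 2 =>
      change traceForm P.ρ (P.e 1 * _) ≠ 0 ↔ _
      rw [h _ _ (P.ρ_e 1)]
      match t' with
      | none | some 0 | some 1 | some 2 => simp [familyOfFour, weight3A]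
  exact fun t _ => ⟨(hv t t).2 rfl, fun t' h' => Or.inl ((hv t t').1 h')⟩

theorem nilpotent_paths (hd0 : d ≠ 0) (i t : Fin 3) :
    IsNilpotent (paths3A P.e P.x i i (some t)) := by
  have h := P.relations_x
  have hcube (a b : A) (hab : a * b * a * b * a = 0) : (a * b) ^ 3 = 0 := by
    rw [pow_succ, pow_two, ← mul_assoc, ← mul_assoc, hab, zero_mul]
  have h1 (a b : A) (hab : a * b * a * b * a = 0) : IsNilpotent (a * b) := ⟨3, hcube a b hab⟩
  have h2 (a b : A) (hab : a * b * a * b * a = 0) : IsNilpotent (a * b * a * b) := by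
    rw [mul_assoc, ← pow_two]
    exact (h1 a b hab).pow_succ 1
  match i, t with
  | 0, 0 => exact h1 _ _ h.βγβγβ
  | 0, 1 => exact h2 _ _ h.βγβγβ
  | 0, 2 => exact IsNilpotent.zero
  | 1, 0 => exact h1 _ _ h.γβγβγ
  | 1, 1 => exact h1 _ _ (h.δηδηδ hd0)
  | 1, 2 => exact h2 _ _ (h.δηδηδ hd0)
  | 2, 0 => exact h1 _ _ (h.ηδηδη hd0)
  | 2, 1 => exact h2 _ _ (h.ηδηδη hd0)
  | 2, 2 => exact IsNilpotent.zero

/-- The paths span the Peirce components. -/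
noncomputable def peirceSpanning (hd0 : d ≠ 0) (hd1 : d ≠ 1) :
    PeirceSpanning K A (Fin 3) (Fin 3) (weight3A d) where
  e := P.e
  χ := P.χ
  ρ := P.ρ
  u := paths3A P.e P.x
  sum_e := by
    have h := congrArg P.f (sum_vertex (q := quiver3A) (K := K))
    rwa [map_sum, map_one] at h
  e_mul_e i j := by
    rw [e, e, ← map_mul]
    split_ifs with hij
    · rw [← hij, vertex_mul_self]
    · rw [vertex_mul_of_ne hij, map_zero]
  χ_e := P.χ_vertex
  u_none
    | 0, 0 => rfl
    | 0, 1 => rfl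
    | 0, 2 => rfl
    | 1, 0 => rfl
    | 1, 1 => rfl
    | 1, 2 => rfl
    | 2, 0 => rfl
    | 2, 1 => rfl
    | 2, 2 => rfl
  mem_span := by
    refine mem_span_of_surjective P.surjective _ ?_ ?_
    · intro i
      match i with
      | 0 => rfl
      | 1 => rfl
      | 2 => rfl
    · refine P.relations_x.arrow_mul_path_mem hd0 fun y => ?_
      rw [x, e, ← map_mul, arrow_mul_target]
  nilpotent := P.nilpotent_paths hd0
  finite _ _ := Set.toFinite _
  v := tests3A d P.e P.x
  height _ _ _ := 0
  triangular
    | 0, 0 => P.triangular_0_0 hd0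
    | 0, 1 => P.triangular_0_1 hd0
    | 0, 2 => P.triangular_0_2 hd0
    | 1, 0 => P.triangular_1_0 hd0
    | 1, 1 => P.triangular_1_1 hd0 hd1
    | 1, 2 => P.triangular_1_2 hd0
    | 2, 0 => P.triangular_2_0 hd0
    | 2, 1 => P.triangular_2_1 hd0
    | 2, 2 => P.triangular_2_2 hd0

end Presentation3A

end Presentation

/-! ### The stable centre of type `3A` -/

section Presentation

open ArrowQuiver AlgBimodule

namespace Presentation3A

/-- The coefficients of the diagonal matrices which are the images of two central elements. -/
def diagCoeff {K : Type u} [Field K] (d : K) : Fin 2 → Fin 3 → K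
  | 0, 2 => d
  | _, _ => 1

/-- The degrees of the diagonal matrices which are the images of two central elements. -/
def diagDegree : Fin 2 → Fin 3 → ℕ × ℕ × ℕ × ℕ
  | 0, 0 => (1, 1, 0, 0)
  | 0, 1 => (1, 1, 0, 0)
  | 0, 2 => (0, 0, 1, 1)
  | 1, 0 => (1, 1, 0, 0)
  | 1, 1 => (0, 0, 1, 1)
  | 1, 2 => (0, 0, 1, 1)

variable {K A : Type u} [Field K] [Ring A] [Algebra K A] {d : K} (P : Presentation3A K A d)

/-- The diagonal matrices which are the images of two central elements. -/
noncomputable def diag (d : K) (s : Fin 2) (i : Fin 3) : WeightRing (weight3A d) :=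
  diagCoeff d s i • weightMonomial _ (diagDegree s i)

/-- Two central elements, which generate the stable center. -/
def centralElement : Fin 2 → A
  | 0 => P.x .beta * P.x .gamma + P.x .gamma * P.x .beta + d • (P.x .eta * P.x .delta)
  | 1 => P.x .beta * P.x .gamma + P.x .delta * P.x .eta + P.x .eta * P.x .delta

theorem ρ_centralElement (s : Fin 2) :
    P.ρ (P.centralElement s) = Matrix.diagonal (diag d s) := by
  have hd (d' : Fin 3 → WeightRing (weight3A d)) : Matrix.diagonal d' =
      Matrix.single 0 0 (d' 0) + Matrix.single 1 1 (d' 1) + Matrix.single 2 2 (d' 2) := by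
    ext i j
    fin_cases i <;> fin_cases j <;> simp
  rw [hd]
  match s with
  | 0 =>
    rw [centralElement, map_add, map_add, map_smul, P.ρ_beta_gamma, P.ρ_gamma_beta, P.ρ_eta_delta,
      Matrix.smul_single]
    simp [diag, diagCoeff, diagDegree]
  | 1 =>
    rw [centralElement, map_add, map_add, P.ρ_beta_gamma, P.ρ_delta_eta, P.ρ_eta_delta]
    simp [diag, diagCoeff, diagDegree]

/-- The entries follow the relations. The scalar `d` at vertex `2` comes from `γβδ = dδηδ` and `ηγβ
= dηδη`; the second element changes from `βγ` to `δη` along `β` and `γ` because `βδη = βγβ` and `δηγ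
= γβγ`. -/
theorem diag_mul_arrow (s : Fin 2) (y : Arrow3A) :
    diag d s (quiver3A.source y) * weightMonomial _ (degree3A y) =
      weightMonomial _ (degree3A y) * diag d s (quiver3A.target y) := by
  have hmul (m n : ℕ × ℕ × ℕ × ℕ) : weightMonomial (weight3A d) m * weightMonomial (weight3A d) n =
      weightMonomial (weight3A d) (m + n) := weightMonomial_mul _ m n
  match s, y with
  | 0, .beta => exact mul_comm _ _
  | 0, .gamma => exact mul_comm _ _
  | 0, .delta =>
    change ((1 : K) • weightMonomial _ (1, 1, 0, 0)) * weightMonomial _ (0, 0, 1, 0) =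
      weightMonomial _ (0, 0, 1, 0) * (d • weightMonomial _ (0, 0, 1, 1))
    rw [one_smul, mul_smul_comm, hmul, hmul]
    refine weightMonomial_eq_smul _ ?_
    rintro ⟨b, g, d, h⟩
    simp only [weight3A, Prod.mk_add_mk, Prod.mk.injEq]
    split_ifs <;> first | (exfalso; omega) | simp
  | 0, .eta =>
    change (d • weightMonomial _ (0, 0, 1, 1)) * weightMonomial _ (0, 0, 0, 1) =
      weightMonomial _ (0, 0, 0, 1) * ((1 : K) • weightMonomial _ (1, 1, 0, 0))
    rw [one_smul, smul_mul_assoc, hmul, hmul]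
    refine (weightMonomial_eq_smul _ ?_).symm
    rintro ⟨b, g, d, h⟩
    simp only [weight3A, Prod.mk_add_mk, Prod.mk.injEq]
    split_ifs <;> first | (exfalso; omega) | simp
  | 1, .beta =>
    change ((1 : K) • weightMonomial _ (1, 1, 0, 0)) * weightMonomial _ (1, 0, 0, 0) =
      weightMonomial _ (1, 0, 0, 0) * ((1 : K) • weightMonomial _ (0, 0, 1, 1))
    rw [one_smul, one_smul, hmul, hmul]
    refine weightMonomial_eq _ ?_
    rintro ⟨b, g, d, h⟩
    simp only [weight3A, Prod.mk_add_mk, Prod.mk.injEq]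
    split_ifs <;> first | (exfalso; omega) | simp
  | 1, .gamma =>
    change ((1 : K) • weightMonomial _ (0, 0, 1, 1)) * weightMonomial _ (0, 1, 0, 0) =
      weightMonomial _ (0, 1, 0, 0) * ((1 : K) • weightMonomial _ (1, 1, 0, 0))
    rw [one_smul, one_smul, hmul, hmul]
    refine weightMonomial_eq _ ?_
    rintro ⟨b, g, d, h⟩
    simp only [weight3A, Prod.mk_add_mk, Prod.mk.injEq]
    split_ifs <;> first | (exfalso; omega) | simp
  | 1, .delta => exact mul_comm _ _
  | 1, .eta => exact mul_comm _ _

/-- The central elements, as members of the center. -/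
def central (hd0 : d ≠ 0) (hd1 : d ≠ 1) (s : Fin 2) : Subalgebra.center K A :=
  ⟨P.centralElement s, mem_center_of_surjective P.surjective (P.peirceSpanning hd0 hd1).ρ_injective
    P.ρ_f (P.ρ_centralElement s) (diag_mul_arrow s)⟩

/-- The elements which test for the members of the stable center. -/
def test : Option (Σ i, Fin (exponent3K 0 0 0 i - 1)) → A
  | none => P.x .beta * P.x .gamma * P.x .beta * P.x .gamma
  | some ⟨0, _⟩ => P.x .gamma * P.x .beta
  | some ⟨1, _⟩ => P.x .delta * P.x .eta
  | some ⟨2, _⟩ => 0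

/-- The vertices at which the tests take place. -/
def testVertex : Option (Σ i, Fin (exponent3K 0 0 0 i - 1)) → Fin 3
  | none => 0
  | some _ => 1

/-- The degrees of the tests. -/
def testDegree : Option (Σ i, Fin (exponent3K 0 0 0 i - 1)) → ℕ × ℕ × ℕ × ℕ
  | none => (2, 2, 0, 0)
  | some ⟨0, _⟩ => (1, 1, 0, 0)
  | some ⟨1, _⟩ => (0, 0, 1, 1)
  | some ⟨2, _⟩ => (0, 0, 0, 0)

theorem ρ_test : ∀ j, IsMonomialAt P.ρ (P.test j) (testVertex j) (testVertex j) (testDegree j)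
  | none => P.ρ_beta_gamma_beta_gamma
  | some ⟨0, _⟩ => P.ρ_gamma_beta
  | some ⟨1, _⟩ => P.ρ_delta_eta
  | some ⟨2, j⟩ => j.elim0

theorem χ_test (hd0 : d ≠ 0) (i : Fin 3) : ∀ j, P.χ i (P.test j) = 0
  | none => ((P.nilpotent_paths hd0 0 1).map (P.χ i)).eq_zero
  | some ⟨0, _⟩ => ((P.nilpotent_paths hd0 1 0).map (P.χ i)).eq_zero
  | some ⟨1, _⟩ => ((P.nilpotent_paths hd0 1 1).map (P.χ i)).eq_zero
  | some ⟨2, j⟩ => j.elim0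

/-- Besides rotation of cycles, this uses `γβγβ = dδηδη` with `d` invertible, so that one socle test
serves all vertices. -/
theorem mem_decomposableIdeal (hd0 : d ≠ 0) (hd1 : d ≠ 1) (z : Subalgebra.center K A)
    (hz : ∀ j, traceForm P.ρ (z * P.test j) = 0) : z ∈ decomposableIdeal K A := by
  have h0 : traceForm P.ρ ((z : A) * 0) = 0 := by rw [mul_zero, map_zero]
  have hcomm (a b : A) : traceForm P.ρ (z * (a * b)) = traceForm P.ρ (z * (b * a)) := by
    have := traceForm_mul_pow_comm (ρ := P.ρ) z a b 0
    rwa [zero_add, pow_one, pow_one] at this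
  have hγβ := hz (some ⟨0, 0, Nat.one_pos⟩)
  have hδη := hz (some ⟨1, 0, Nat.one_pos⟩)
  have hδηδη : traceForm P.ρ (z * (P.x .delta * P.x .eta * P.x .delta * P.x .eta)) = 0 := by
    refine (smul_eq_zero.1 (?_ : d • traceForm P.ρ (z *
      (P.x .delta * P.x .eta * P.x .delta * P.x .eta)) = 0)).resolve_left hd0
    rw [← map_smul, ← mul_smul_comm, ← P.relations_x.γβγβ, hcomm]
    refine Eq.trans (congrArg (fun a => traceForm P.ρ (z * a)) ?_) (hz none)
    simp only [test, mul_assoc]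
  refine (P.peirceSpanning hd0 hd1).mem_decomposableIdeal z fun i t => ?_
  match i, t with
  | 0, 0 => exact (hcomm _ _).trans hγβ
  | 0, 1 => exact hz none
  | 0, 2 => exact h0
  | 1, 0 => exact hγβ
  | 1, 1 => exact hδη
  | 1, 2 => exact hδηδη
  | 2, 0 => exact (hcomm _ _).trans hδη
  | 2, 1 =>
    refine (hcomm _ _).trans (Eq.trans (congrArg (fun a => traceForm P.ρ (z * a)) ?_) hδηδη)
    simp only [mul_assoc]
  | 2, 2 => exact h0

theorem traceForm_central_mul (hd0 : d ≠ 0) (hd1 : d ≠ 1) (s : Fin 2)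
    (j : Option (Σ i, Fin (exponent3K 0 0 0 i - 1))) :
    traceForm P.ρ ((P.central hd0 hd1 s : A) * P.test j) =
      diagCoeff d s (testVertex j) * weight3A d (diagDegree s (testVertex j) + testDegree j) := by
  change traceForm P.ρ (P.centralElement s * P.test j) = _
  rw [(P.ρ_test j).diagonal_mul (P.ρ_centralElement s), diag, smul_mul_assoc, weightMonomial_mul,
    map_smul, weightForm_monomial, smul_eq_mul]

/-- By length: the product has length four, every test has length at least two, and socle degrees
have length four. -/
theorem central_mul_central_mem (hd0 : d ≠ 0) (hd1 : d ≠ 1) (s s' : Fin 2) :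
    P.central hd0 hd1 s * P.central hd0 hd1 s' ∈ decomposableIdeal K A := by
  refine P.mem_decomposableIdeal hd0 hd1 _ fun j => ?_
  have h : P.ρ ((P.central hd0 hd1 s * P.central hd0 hd1 s' : Subalgebra.center K A) : A) =
      Matrix.diagonal fun i => diag d s i * diag d s' i := by
    rw [← Matrix.diagonal_mul_diagonal, ← P.ρ_centralElement, ← P.ρ_centralElement, ← map_mul]
    rfl
  rw [(P.ρ_test j).diagonal_mul h, diag, diag, smul_mul_smul_comm, smul_mul_assoc,
    weightMonomial_mul, weightMonomial_mul, map_smul, weightForm_monomial, weight3A_eq_zero,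
    smul_zero]
  have h1 (s : Fin 2) (i : Fin 3) : diagDegree s i = (1, 1, 0, 0) ∨ diagDegree s i = (0, 0, 1, 1) := by
    revert s i
    decide
  have h2 : testDegree j = (2, 2, 0, 0) ∨ testDegree j = (1, 1, 0, 0) ∨ testDegree j = (0, 0, 1, 1) :=
    match j with
    | none => Or.inl rfl
    | some ⟨0, _⟩ => Or.inr (Or.inl rfl)
    | some ⟨1, _⟩ => Or.inr (Or.inr rfl)
    | some ⟨2, j⟩ => j.elim0
  obtain h3 | h3 := h1 s (testVertex j) <;> obtain h4 | h4 := h1 s' (testVertex j) <;>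
    obtain h5 | h5 | h5 := h2 <;> rw [h3, h4, h5] <;> decide

/-- Representatives of the generators of the stable center. -/
def generator (hd0 : d ≠ 0) (hd1 : d ≠ 1) : Fin 3 → Subalgebra.center K A
  | 0 => P.central hd0 hd1 0 - d • P.central hd0 hd1 1
  | 1 => P.central hd0 hd1 1 - P.central hd0 hd1 0
  | 2 => 0

theorem generator_mul_generator_mem (hd0 : d ≠ 0) (hd1 : d ≠ 1) (i j : Fin 3) :
    P.generator hd0 hd1 i * P.generator hd0 hd1 j ∈ decomposableIdeal K A := by
  have h (i : Fin 3) : P.generator hd0 hd1 i ∈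
      Submodule.span K (Set.range (P.central hd0 hd1)) := by
    have hs (s : Fin 2) : P.central hd0 hd1 s ∈ Submodule.span K (Set.range (P.central hd0 hd1)) :=
      Submodule.subset_span ⟨s, rfl⟩
    match i with
    | 0 => exact Submodule.sub_mem _ (hs 0) (Submodule.smul_mem _ _ (hs 1))
    | 1 => exact Submodule.sub_mem _ (hs 1) (hs 0)
    | 2 => exact Submodule.zero_mem _
  have hle : Submodule.span K (Set.range (P.central hd0 hd1)) *
      Submodule.span K (Set.range (P.central hd0 hd1)) ≤
        (decomposableIdeal K A).restrictScalars K := by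
    rw [Submodule.span_mul_span]
    refine Submodule.span_le.2 ?_
    rintro _ ⟨_, ⟨s, rfl⟩, _, ⟨s', rfl⟩, rfl⟩
    exact P.central_mul_central_mem hd0 hd1 s s'
  exact hle (Submodule.mul_mem_mul (h i) (h j))

/-- The pairing of the generators with the tests. -/
theorem traceForm_generator_mul (hd0 : d ≠ 0) (hd1 : d ≠ 1) (i : Fin 3)
    (hi : 0 < exponent3K 0 0 0 i - 1) (j : Option (Σ i, Fin (exponent3K 0 0 0 i - 1))) :
    traceForm P.ρ ((P.generator hd0 hd1 i : A) * P.test j) ≠ 0 ↔ some ⟨i, 0, hi⟩ = j := by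
  have h := P.traceForm_central_mul hd0 hd1
  have hd : d - d * d ≠ 0 := by
    rw [show d - d * d = d * (1 - d) by ring]
    exact mul_ne_zero hd0 (sub_ne_zero.2 hd1.symm)
  match i, hi with
  | 0, hi =>
    -- At vertex `1` the generators are `γβ - dδη` and `δη - γβ`, the combinations that diagonalize
    -- the Gram matrix; their pairings with `γβ` and `δη` are `d - d²` and `1 - d` on the diagonal
    -- and zero off it.
    have h' : traceForm P.ρ ((P.generator hd0 hd1 0 : A) * P.test j) =
        diagCoeff d 0 (testVertex j) *
          weight3A d (diagDegree 0 (testVertex j) + testDegree j) -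
        d * (diagCoeff d 1 (testVertex j) *
          weight3A d (diagDegree 1 (testVertex j) + testDegree j)) := by
      rw [← h 0 j, ← h 1 j, ← smul_eq_mul d, ← map_smul, ← map_sub, ← smul_mul_assoc, ← sub_mul]
      rfl
    rw [h']
    match j with
    | none => simp [testVertex, testDegree, diagDegree, diagCoeff, weight3A]
    | some ⟨0, ⟨0, _⟩⟩ => simp [testVertex, testDegree, diagDegree, diagCoeff, weight3A, hd]
    | some ⟨1, ⟨0, _⟩⟩ => simp [testVertex, testDegree, diagDegree, diagCoeff, weight3A]
    | some ⟨2, j⟩ => exact j.elim0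
  | 1, hi =>
    have h' : traceForm P.ρ ((P.generator hd0 hd1 1 : A) * P.test j) =
        diagCoeff d 1 (testVertex j) *
          weight3A d (diagDegree 1 (testVertex j) + testDegree j) -
        diagCoeff d 0 (testVertex j) *
          weight3A d (diagDegree 0 (testVertex j) + testDegree j) := by
      rw [← h 1 j, ← h 0 j, ← map_sub, ← sub_mul]
      rfl
    rw [h']
    match j with
    | none => simp [testVertex, testDegree, diagDegree, diagCoeff, weight3A]
    | some ⟨0, ⟨0, _⟩⟩ => simp [testVertex, testDegree, diagDegree, diagCoeff, weight3A]
    | some ⟨1, ⟨0, _⟩⟩ =>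
      simp [testVertex, testDegree, diagDegree, diagCoeff, weight3A, sub_ne_zero.2 hd1.symm]
    | some ⟨2, j⟩ => exact j.elim0
  | 2, hi => exact absurd hi (lt_irrefl 0)

-- The exponents are `2, 2, 1`. The third generator is zero and contributes no monomial, so the
-- stable centre has dimension three and its nilradical has square zero.
include P in
theorem nilradicalPowRank_stableCenter (hd0 : d ≠ 0) (hd1 : d ≠ 1) (k : ℕ) :
    nilradicalPowRank K (StableCenter K A) (k + 1) = ∑ i, (exponent3K 0 0 0 i - (k + 1)) := by
  have hsome (i : Fin 3) (n : Fin (exponent3K 0 0 0 i - 1)) :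
      wedgeMonomial (exponent3K 0 0 0) (P.generator hd0 hd1) (some ⟨i, n⟩) =
        P.generator hd0 hd1 i ∧ n = ⟨0, n.pos⟩ := by
    have hn : n.1 = 0 := by
      match i, n with
      | 0, ⟨0, _⟩ => rfl
      | 1, ⟨0, _⟩ => rfl
      | 2, n => exact n.elim0
    refine ⟨?_, Fin.ext hn⟩
    change P.generator hd0 hd1 i ^ (n.1 + 1) = _
    rw [hn, zero_add, pow_one]
  have hnone : ((wedgeMonomial (exponent3K 0 0 0) (P.generator hd0 hd1) none :
    Subalgebra.center K A) : A) = 1 := rfl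
  have hpair (j) (j' : Option (Σ i, Fin (exponent3K 0 0 0 i - 1))) : traceForm P.ρ
      ((wedgeMonomial (exponent3K 0 0 0) (P.generator hd0 hd1) j' : Subalgebra.center K A) *
        P.test j) ≠ 0 ↔ j' = j := by
    match j' with
    | none =>
      rw [hnone, one_mul, (P.ρ_test j).traceForm_eq]
      match j with
      | none => simpa [testDegree, weight3A] using hd0
      | some ⟨0, _⟩ => simp [testDegree, weight3A]
      | some ⟨1, _⟩ => simp [testDegree, weight3A]
      | some ⟨2, j⟩ => exact j.elim0
    | some ⟨i, n⟩ =>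
      rw [(hsome i n).1, P.traceForm_generator_mul hd0 hd1 i n.pos, ← (hsome i n).2]
  refine (P.peirceSpanning hd0 hd1).splitSymmetric.nilradicalPowRank_of_triangular
    (exponent3K 0 0 0) (P.generator hd0 hd1) P.test (P.mem_decomposableIdeal hd0 hd1)
    (P.χ_test hd0) id (fun _ => 0) (fun j => (hpair j j).2 rfl)
    (fun j j' h => Or.inl ((hpair j j').1 h))
    (fun i j _ => P.generator_mul_generator_mem hd0 hd1 i j) (fun i => ?_) k
  match i with
  | 0 =>
    rw [show exponent3K 0 0 0 0 = 2 from rfl, pow_two]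
    exact P.generator_mul_generator_mem hd0 hd1 0 0
  | 1 =>
    rw [show exponent3K 0 0 0 1 = 2 from rfl, pow_two]
    exact P.generator_mul_generator_mem hd0 hd1 1 1
  | 2 =>
    rw [show exponent3K 0 0 0 2 = 1 from rfl, pow_one]
    exact Ideal.zero_mem _

end Presentation3A

variable {K : Type u} [Field K] {d : K}

theorem relations3A : Relations3A d
    (RingQuot.mkAlgHom K (Q3ARel K d) (arrow K quiver3A .beta))
    (RingQuot.mkAlgHom K (Q3ARel K d) (arrow K quiver3A .gamma))
    (RingQuot.mkAlgHom K (Q3ARel K d) (arrow K quiver3A .delta))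
    (RingQuot.mkAlgHom K (Q3ARel K d) (arrow K quiver3A .eta)) where
  βδη := by simpa using RingQuot.mkAlgHom_rel K (Q3ARel.beta_delta_eta (d := d))
  δηγ := by simpa using RingQuot.mkAlgHom_rel K (Q3ARel.delta_eta_gamma (d := d))
  ηγβ := by simpa using RingQuot.mkAlgHom_rel K (Q3ARel.eta_gamma_beta (d := d))
  γβδ := by simpa using RingQuot.mkAlgHom_rel K (Q3ARel.gamma_beta_delta (d := d))
  βδηδ := by simpa using RingQuot.mkAlgHom_rel K (Q3ARel.beta_delta_eta_delta (d := d))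
  ηγβγ := by simpa using RingQuot.mkAlgHom_rel K (Q3ARel.eta_gamma_beta_gamma (d := d))

variable (d)

/-- The representation of `Q(3A)_1^{2,2}(d)` by matrices of monomials. -/
noncomputable def rep3A : Q3A K d →ₐ[K] Matrix (Fin 3) (Fin 3) (WeightRing (weight3A d)) :=
  RingQuot.liftAlgHom K ⟨matrixRep fun y => weightMonomial _ (degree3A y), by
    have hx (y : Arrow3A) : IsMonomialAt (matrixRep fun y => weightMonomial (weight3A d)
      (degree3A y)) (arrow K quiver3A y) (quiver3A.source y) (quiver3A.target y) (degree3A y) :=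
      matrixRep_arrow _ y
    have hβ := hx .beta
    have hγ := hx .gamma
    have hδ := hx .delta
    have hη := hx .eta
    rintro _ _ (_ | _ | _ | _ | _ | _)
    · refine ((hβ.mul hδ).mul hη).map_eq_map ((hβ.mul hγ).mul hβ) ?_
      rintro ⟨b, g, d, h⟩
      simp only [weight3A, degree3A, Prod.mk_add_mk, Prod.mk.injEq]
      split_ifs <;> first | (exfalso; omega) | rfl
    · refine ((hδ.mul hη).mul hγ).map_eq_map ((hγ.mul hβ).mul hγ) ?_
      rintro ⟨b, g, d, h⟩
      simp only [weight3A, degree3A, Prod.mk_add_mk, Prod.mk.injEq]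
      split_ifs <;> first | (exfalso; omega) | rfl
    · rw [map_smul, (hη.mul hγ).mul hβ, (hη.mul hδ).mul hη, Matrix.smul_single]
      refine congrArg _ (weightMonomial_eq_smul _ ?_)
      rintro ⟨b, g, d, h⟩
      simp only [weight3A, degree3A, Prod.mk_add_mk, Prod.mk.injEq]
      split_ifs <;> first | (exfalso; omega) | simp
    · rw [map_smul, (hγ.mul hβ).mul hδ, (hδ.mul hη).mul hδ, Matrix.smul_single]
      refine congrArg _ (weightMonomial_eq_smul _ ?_)
      rintro ⟨b, g, d, h⟩
      simp only [weight3A, degree3A, Prod.mk_add_mk, Prod.mk.injEq]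
      split_ifs <;> first | (exfalso; omega) | simp
    · rw [map_zero]
      refine (((hβ.mul hδ).mul hη).mul hδ).map_eq_zero ?_
      rintro ⟨b, g, d, h⟩
      apply weight3A_eq_zero
      simp only [degree3A, Prod.mk_add_mk, Prod.mk.injEq]
      omega
    · rw [map_zero]
      refine (((hη.mul hγ).mul hβ).mul hγ).map_eq_zero ?_
      rintro ⟨b, g, d, h⟩
      apply weight3A_eq_zero
      simp only [degree3A, Prod.mk_add_mk, Prod.mk.injEq]
      omega⟩

/-- The presentation of `Q(3A)_1^{2,2}(d)`. -/
noncomputable def presentation3A : Presentation3A K (Q3A K d) d where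
  f := RingQuot.mkAlgHom K (Q3ARel K d)
  surjective := RingQuot.mkAlgHom_surjective K _
  relations := relations3A
  χ i := RingQuot.liftAlgHom K ⟨character quiver3A K i, by
    rintro _ _ (_ | _ | _ | _ | _ | _) <;> simp⟩
  χ_vertex i j := by simp
  ρ := rep3A d
  ρ_f a := by simp [rep3A]

end Presentation

/-! ### The ranks determine the parameters -/

section Corollary

variable (K : Type u) [Field K] (d : K)

theorem Q3K_two_two_one : Q3K K d 2 2 1 = AlgCat.of K (Q3A K d) := if_pos rfl

theorem Q3K_of_ne {a b c : ℕ} (h : (a, b, c) ≠ (2, 2, 1)) :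
    Q3K K d a b c = AlgCat.of K (Q3KPresented K a b c) := if_neg h

/-- The algebras are finite dimensional, and the stable centre has the rank sequence
of the parameters. -/
theorem finite_and_nilradicalPowRank_Q3K {d : K} (hd0 : d ≠ 0) (hd1 : d ≠ 1) {a b c : ℕ}
    (hab : b ≤ a) (hbc : c ≤ b) (hc : 1 ≤ c) (hb : 2 ≤ b) :
    Module.Finite K (Q3K K d a b c) ∧ ∀ k, nilradicalPowRank K (StableCenter K (Q3K K d a b c))
      (k + 1) = (a - (k + 1)) + (b - (k + 1)) + (c - (k + 1)) := by
  obtain ⟨p, rfl⟩ := Nat.exists_eq_add_of_le' (hb.trans hab)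
  obtain ⟨q, rfl⟩ := Nat.exists_eq_add_of_le' hb
  obtain ⟨r, rfl⟩ := Nat.exists_eq_add_of_le' hc
  by_cases h : (p + 2, q + 2, r + 1) = (2, 2, 1)
  · obtain ⟨rfl, rfl, rfl⟩ : p = 0 ∧ q = 0 ∧ r = 0 := by simpa using h
    rw [show Q3K K d (0 + 2) (0 + 2) (0 + 1) = _ from Q3K_two_two_one K d]
    refine ⟨((presentation3A d).peirceSpanning hd0 hd1).moduleFinite, fun k ↦ ?_⟩
    refine ((presentation3A d).nilradicalPowRank_stableCenter hd0 hd1 k).trans ?_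
    rw [Fin.sum_univ_three]
    rfl
  -- Since `q ≤ p`, the excluded triple is the only one with `p = 0` and `r = 0`.
  · have hr : r = 0 → 0 < p := by
      rintro rfl
      by_contra hp
      exact h (by simp; omega)
    rw [Q3K_of_ne K d h]
    refine ⟨((presentation3K K p q r).peirceSpanning hr).moduleFinite, fun k ↦ ?_⟩
    refine ((presentation3K K p q r).nilradicalPowRank_stableCenter hr k).trans ?_
    rw [Fin.sum_univ_three]
    rfl

end Corollary

theorem corollary5p7 (K : Type u) [Field K] [IsAlgClosed K] (d : K) (hd0 : d ≠ 0) (hd1 : d ≠ 1)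
    (a b c a' b' c' : ℕ)
    (hab : b ≤ a) (hbc : c ≤ b) (hc : 1 ≤ c) (hb : 2 ≤ b)
    (hab' : b' ≤ a') (hbc' : c' ≤ b') (hc' : 1 ≤ c') (hb' : 2 ≤ b') :
    StablyEquivalentOfMoritaType K (Q3K K d a b c) (Q3K K d a' b' c') ↔
      a = a' ∧ b = b' ∧ c = c' := by
  obtain ⟨hfin, hrank⟩ := finite_and_nilradicalPowRank_Q3K K hd0 hd1 hab hbc hc hb
  obtain ⟨hfin', hrank'⟩ := finite_and_nilradicalPowRank_Q3K K hd0 hd1 hab' hbc' hc' hb'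
  constructor
  · intro h
    refine eq_of_sum_sub_eq hab hbc hc hab' hbc' hc' fun k ↦ ?_
    rw [← hrank, ← hrank', h.nilradicalPowRank_eq]
  · rintro ⟨rfl, rfl, rfl⟩
    exact AlgBimodule.stablyEquivalent_refl
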